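/- Theorem 4.2. Let $G=(V,A)$ be a finite directed graph with root $r\in V$, where each arc $e$ has a rational failure probability $0<p_e<1$; put $n=|V|$, $m=|A|$ (parallel arcs and loops are allowed) and $p_{\max}=\max_{e\in A}p_e$. Reachability is $$Z_{\mathrm{reach}}(G,r;\mathbf p)=\sum_{S}\ \prod_{e\in S}(1-p_e)\prod_{e\in A\setminus S}p_e ,$$ the sum being over all $S\subseteq A$ such that $(V,S)$ contains a directed path from every vertex to $r$, i.e. it is the probability that the graph is still root-connected when every arc $e$ fails independently with probability $p_e$. The graph is bi-directed if its arcs can be matched up by an involution that sends each arc $u\to v$ to an arc $v\to u$ with the same failure probability. There is an FPRAS for reachability in bi-directed graphs: there are a single randomized algorithm and an absolute constant $C$ such that, for every bi-directed $(G,r,\mathbf p)$ as above and every rational $0<\varepsilon\le 1$, the algorithm on input $(G,r,\mathbf p,\varepsilon)$ outputs, with probability at least $3/4$, a rational number $\widetilde Z$ with $|\widetilde Z-Z_{\mathrm{reach}}(G,r;\mathbf p)|\le\varepsilon Z_{\mathrm{reach}}(G,r;\mathbf p)$, and, if $m\ge 1$, its expected running time is at most $$C\,\varepsilon^{-2}(1-p_{\max})^{-3}m^2n^3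 .$$ Here an algorithm is a fixed program for a random access machine (registers and arrays of natural numbers, addition, truncated subtraction, comparison, indirect addressing, tossing a coin of bias $\min(a/b,1)$ for $a,b$ in registers, interpreted as $0$ if $b=0$), in which each such operation costs one step; rational numbers are given and returned as pairs (numerator, denominator). -/

import Mathlib

noncomputable section

/-! ### The reachability problem -/

/-- An input of the reachability problem: a finite directed graph with vertex set `{0, …, n-1}`,
arcs numbered `0, …, m-1` (parallel arcs and loops are allowed), a distinguished root, and a
rational failure probability in `(0,1)` for each arc. Arc `e` goes from `tail e` to `head e`. -/
structure ReachInstance where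
  n : ℕ
  m : ℕ
  root : Fin n
  tail : Fin m → Fin n
  head : Fin m → Fin n
  p : Fin m → ℚ
  p_pos : ∀ e, 0 < p e
  p_lt_one : ∀ e, p e < 1

namespace ReachInstance

/-- Every arc `u → v` comes with an anti-parallel twin `v → u` of the same failure probability.
(For a graph without parallel arcs this just says that `v → u` is an arc, with the same failure
probability, whenever `u → v` is. With parallel arcs the twins are matched one to one. A loop may
be its own twin.) -/
def IsBidirected (G : ReachInstance) : Prop :=
  ∃ rev : Fin G.m → Fin G.m, Function.Involutive rev ∧
    ∀ e, G.tail (rev e) = G.head e ∧ G.head (rev e) = G.tail e ∧ G.p (rev e) = G.p e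

/-- The subgraph `(V, S)` is root-connected: every vertex has a directed path in `S` to the
root. -/
def RootConnected (G : ReachInstance) (S : Finset (Fin G.m)) : Prop :=
  ∀ v, Relation.ReflTransGen (fun u w => ∃ e ∈ S, G.tail e = u ∧ G.head e = w) v G.root

/-- The weight of a subgraph: the probability that exactly the arcs in `S` survive. -/
def wt (G : ReachInstance) (S : Finset (Fin G.m)) : ℚ :=
  (∏ e ∈ S, (1 - G.p e)) * ∏ e ∈ Sᶜ, G.p e

open Classical in
/-- Reachability: the probability that the surviving graph is root-connected. -/
def Zreach (G : ReachInstance) : ℚ :=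
  ∑ S : Finset (Fin G.m) with G.RootConnected S, G.wt S

/-- The maximum failure probability (a maximum over a finite set; used only if there is an
arc). -/
def pMax (G : ReachInstance) : ℝ := ⨆ e, (G.p e : ℝ)

end ReachInstance

/-! ### Randomized random access machines

Programs are finite syntax trees, so one program has to serve inputs of all sizes. The memory
consists of scalar registers and one-dimensional arrays, both numbered by `ℕ` (a program mentions
only finitely many of them), and each cell holds a natural number. Every elementary operation and
every evaluation of a test counts as one step. The arithmetic consists of addition and truncated
subtraction only: there is no multiplication at unit cost, so numbers grow by at most one bit per
step. -/

/-- The memory of the machine. -/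
structure Mem where
  reg : ℕ → ℕ
  arr : ℕ → ℕ → ℕ

namespace Mem

/-- Overwrite register `x` by `v`. -/
def setReg (σ : Mem) (x v : ℕ) : Mem :=
  { σ with reg := Function.update σ.reg x v }

/-- Overwrite cell `i` of array `a` by `v`. -/
def setArr (σ : Mem) (a i v : ℕ) : Mem :=
  { σ with arr := Function.update σ.arr a (Function.update (σ.arr a) i v) }

end Mem

/-- Programs. Below, `R x` is the content of register `x`. -/
inductive Cmd where
  /-- do nothing -/
  | skip
  /-- `R x := k` -/
  | const (x k : ℕ)
  /-- `R x := R y + R z` -/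
  | add (x y z : ℕ)
  /-- `R x := max (R y - R z) 0` -/
  | sub (x y z : ℕ)
  /-- `R x := a[R i]` -/
  | load (x a i : ℕ)
  /-- `a[R i] := R x` -/
  | store (a i x : ℕ)
  /-- toss a fresh coin: `R x := 1` with probability `R y / R z`, otherwise `R x := 0` -/
  | coin (x y z : ℕ)
  /-- first `c`, then `d` -/
  | seq (c d : Cmd)
  /-- `if R x < R y then c else d` -/
  | branch (x y : ℕ) (c d : Cmd)
  /-- `while R x < R y do c` -/
  | loop (x y : ℕ) (c : Cmd)

/-- The distribution of a coin that shows `1` with probability `min (a / b) 1` and `0` otherwise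
(`0` with certainty if `b = 0`). -/
def coinDist (a b : ℕ) : PMF ℕ :=
  (PMF.ofFintype
    (fun t : Bool => ((if t then min ((a : NNReal) / b) 1 else 1 - min ((a : NNReal) / b) 1 : NNReal) :
      ENNReal))
    (by
      rw [Fintype.sum_bool, ← ENNReal.coe_add]
      simp)).map
    fun t => if t then 1 else 0

/-- A configuration: the commands that are still to be executed, and the memory. The machine has
halted when no command is left. -/
abbrev Config := List Cmd × Mem

/-- The transition kernel: one step of the machine. A halted machine stays as it is. -/
def step : Config → PMF Config
  | ([], σ) => PMF.pure ([], σ)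
  | (Cmd.skip :: K, σ) => PMF.pure (K, σ)
  | (Cmd.const x k :: K, σ) => PMF.pure (K, σ.setReg x k)
  | (Cmd.add x y z :: K, σ) => PMF.pure (K, σ.setReg x (σ.reg y + σ.reg z))
  | (Cmd.sub x y z :: K, σ) => PMF.pure (K, σ.setReg x (σ.reg y - σ.reg z))
  | (Cmd.load x a i :: K, σ) => PMF.pure (K, σ.setReg x (σ.arr a (σ.reg i)))
  | (Cmd.store a i x :: K, σ) => PMF.pure (K, σ.setArr a (σ.reg i) (σ.reg x))
  | (Cmd.coin x y z :: K, σ) =>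
      (coinDist (σ.reg y) (σ.reg z)).map fun v => (K, σ.setReg x v)
  | (Cmd.seq c d :: K, σ) => PMF.pure (c :: d :: K, σ)
  | (Cmd.branch x y c d :: K, σ) =>
      PMF.pure (if σ.reg x < σ.reg y then (c :: K, σ) else (d :: K, σ))
  | (Cmd.loop x y c :: K, σ) =>
      PMF.pure (if σ.reg x < σ.reg y then (c :: Cmd.loop x y c :: K, σ) else (K, σ))

/-- The distribution of the configuration after `t` steps. -/
def run : ℕ → Config → PMF Config
  | 0, c => PMF.pure c
  | t + 1, c => (step c).bind (run t)

/-- The expected number `E[T]` of steps until program `A` halts when it is started on memory `σ`,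
computed as `∑ t, P(T > t)`. It is `∞` if the program fails to halt with positive probability. -/
def expectedTime (A : Cmd) (σ : Mem) : ENNReal :=
  ∑' t, (run t ([A], σ)).toOuterMeasure {c | c.1 ≠ []}

/-- The probability that program `A`, started on memory `σ`, ever halts and that the final memory
then satisfies `P`: the limit of the (nondecreasing) probabilities that this has happened within
`t` steps. -/
def haltProb (A : Cmd) (σ : Mem) (P : Mem → Prop) : ENNReal :=
  ⨆ t, (run t ([A], σ)).toOuterMeasure {c | c.1 = [] ∧ P c.2}

/-- The initial memory for a graph and an accuracy `ε > 0`. Registers `0, …, 4` hold the number of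
vertices, the number of arcs, the root, and the numerator and the denominator of `ε`; the entries
`e` of the arrays `0, …, 3` hold the tail of the arc `e`, its head, and the numerator and the
denominator of its failure probability. All other cells are zero. -/
def ReachInstance.encode (G : ReachInstance) (ε : ℚ) : Mem where
  reg x := match x with
    | 0 => G.n
    | 1 => G.m
    | 2 => G.root
    | 3 => ε.num.toNat
    | 4 => ε.den
    | _ => 0
  arr a i := if h : i < G.m then
      match a with
      | 0 => G.tail ⟨i, h⟩
      | 1 => G.head ⟨i, h⟩
      | 2 => (G.p ⟨i, h⟩).num.toNat
      | 3 => (G.p ⟨i, h⟩).den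
      | _ => 0
    else 0

/-- The result left in memory, the fraction `R 0 / R 1`, is well-formed and is a
`(1 ± ε)`-approximation of `Z`. -/
def Approximates (Z ε : ℚ) (σ : Mem) : Prop :=
  σ.reg 1 ≠ 0 ∧ |(σ.reg 0 : ℚ) / (σ.reg 1 : ℚ) - Z| ≤ ε * Z

end

/-!
The algorithm is a product estimator whose samples come from cluster popping, a relative of
Wilson's cycle popping.

*Root sets.* Contracting vertices into the root is replaced by enlarging the root set: `Z R` is the
probability that every vertex reaches the set `R` along surviving arcs, so that `Z {r}` is the
reachability and `Z V = 1`. List the vertices in breadth-first order from the root and write `T j`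
for the set of the first `j` of them. Then `Z {r}` is the product of the ratios
`Z (T j) / Z (T (j + 1))`, and each ratio is the probability that vertex `j` reaches `T j` in a sample
given that everything reaches `T (j + 1)`. In a bi-directed graph an arc leads from vertex `j` back to
`T j`, whence the ratio is at least `1 - p_max` (`q_mul_Z_le_Z_erase`). Hence `O(n ε⁻² (1 - p_max)⁻¹)`
samples per ratio suffice for Chebyshev's inequality (`prodExp_sq_error_le`).

*Cluster popping.* To sample given that everything reaches `T`, start from a fresh sample with
current root set `R = V`, and while `R ≠ T` pick `x` in `R \ T`. If `x` reaches another root, drop `x`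
from `R`; otherwise the set `C` of the vertices that `x` reaches is a cluster: sample the arcs out of
`C` afresh, and add `C` to `R`. The invariant is that the current outcome is a sample given that
everything reaches `R`. It is preserved because being a cluster depends only on the arcs out of `C`,
while the event that everything reaches `R ∪ C` does not depend on them
(`mean_resample_cluster`, `mean_pop`).

*Running time.* The potential `∑ w ∉ R, Z (R ∪ {w}) / Z R` grows by one on average in every iteration
(`mean_popValue_add_le`), and it vanishes at `R = V`; so its value at `T` bounds the expected number
of iterations. In a bi-directed graph it is at most `n (1 + m / (1 - p_max))`: an outcome in which
everything reaches `R ∪ {w}` but not `R` is repaired by one arc and by the reversal of the arcs among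
the vertices reached by its tail, in such a way that it can be recovered from `w`, the arc and the
repaired outcome (`IsReversal.Z_insert_le`). One iteration takes `O(n + m)` steps, and a connected
graph has `n ≤ m + 1`.

*The machine.* The weakest pre-expectation `wp k c f σ` bounds the expectation of `k` times the
running time plus a reward `f` of the final memory (`ev_le_wp`). With `k = 1` and `f = 0` it bounds
the expected time. With `k = 0` and the indicator of failure as `f` it bounds the probability of
halting with a bad result, and a program of finite expected time halts almost surely
(`one_le_haltProb_add`). Only upper bounds are ever needed, so that a loop is handled by any
invariant `I` that satisfies the inequality of `wp_loop_le`.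
-/

open scoped ENNReal

set_option linter.unusedSectionVars false

noncomputable section

/-! ### Expected rewards of programs -/

/-- The expectation of an extended nonnegative function under a discrete distribution. -/
def pexp {α : Type*} (p : PMF α) (g : α → ℝ≥0∞) : ℝ≥0∞ := ∑' a, p a * g a

theorem pexp_pure {α : Type*} (a : α) (g : α → ℝ≥0∞) : pexp (PMF.pure a) g = g a := by
  rw [pexp, tsum_eq_single a]
  · simp
  · intro b hb
    simp [PMF.pure_apply, hb]

theorem pexp_map {α β : Type*} (p : PMF α) (h : α → β) (g : β → ℝ≥0∞) :
    pexp (p.map h) g = pexp p (fun a => g (h a)) := by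
  classical
  simp only [pexp, PMF.map_apply, ← ENNReal.tsum_mul_right]
  rw [ENNReal.tsum_comm]
  refine tsum_congr fun a => ?_
  rw [tsum_eq_single (h a)]
  · simp
  · intro b hb
    simp [hb]

/-- The probability of heads of the machine's coin. -/
def coinBias (a b : ℕ) : ℝ≥0∞ := ((min ((a : NNReal) / b) 1 : NNReal) : ℝ≥0∞)

theorem pexp_coinDist (a b : ℕ) (g : ℕ → ℝ≥0∞) :
    pexp (coinDist a b) g = coinBias a b * g 1 + (1 - coinBias a b) * g 0 := by
  rw [coinDist, pexp_map, pexp, tsum_fintype, Fintype.sum_bool]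
  simp [coinBias]

/-- The expectation, truncated after `t` steps, of `k` times the number of steps plus the reward
`f` of the final memory; a run that has not halted by then gets no reward. -/
def ev (k : ℝ≥0∞) (f : Mem → ℝ≥0∞) : ℕ → Config → ℝ≥0∞
  | 0, c => if c.1 = [] then f c.2 else 0
  | t + 1, c => (if c.1 = [] then 0 else k) + pexp (step c) (ev k f t)

/-- The weakest pre-expectation: `wp k c f σ` is the expectation of `k` times the number of steps
of `c` plus the reward `f` of the final memory, for `c` started on `σ`. The value of a loop is the
least solution of its unfolding inequality. -/
def wp (k : ℝ≥0∞) : Cmd → (Mem → ℝ≥0∞) → Mem → ℝ≥0∞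
  | .skip, f => fun σ => k + f σ
  | .const x v, f => fun σ => k + f (σ.setReg x v)
  | .add x y z, f => fun σ => k + f (σ.setReg x (σ.reg y + σ.reg z))
  | .sub x y z, f => fun σ => k + f (σ.setReg x (σ.reg y - σ.reg z))
  | .load x a i, f => fun σ => k + f (σ.setReg x (σ.arr a (σ.reg i)))
  | .store a i x, f => fun σ => k + f (σ.setArr a (σ.reg i) (σ.reg x))
  | .coin x y z, f => fun σ => k + (coinBias (σ.reg y) (σ.reg z) * f (σ.setReg x 1)
      + (1 - coinBias (σ.reg y) (σ.reg z)) * f (σ.setReg x 0))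
  | .seq c d, f => fun σ => k + wp k c (wp k d f) σ
  | .branch x y c d, f => fun σ => k + if σ.reg x < σ.reg y then wp k c f σ else wp k d f σ
  | .loop x y c, f => sInf {X | ∀ σ, k + (if σ.reg x < σ.reg y then wp k c X σ else f σ) ≤ X σ}

theorem wp_seq (k : ℝ≥0∞) (c d : Cmd) (f : Mem → ℝ≥0∞) (σ : Mem) :
    wp k (.seq c d) f σ = k + wp k c (wp k d f) σ := rfl

theorem wp_const (k : ℝ≥0∞) (x v : ℕ) (f : Mem → ℝ≥0∞) (σ : Mem) :
    wp k (.const x v) f σ = k + f (σ.setReg x v) := rfl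

theorem wp_add (k : ℝ≥0∞) (x y z : ℕ) (f : Mem → ℝ≥0∞) :
    wp k (.add x y z) f = fun σ => k + f (σ.setReg x (σ.reg y + σ.reg z)) := rfl

theorem wp_branch (k : ℝ≥0∞) (x y : ℕ) (c d : Cmd) (f : Mem → ℝ≥0∞) (σ : Mem) :
    wp k (.branch x y c d) f σ =
      k + if σ.reg x < σ.reg y then wp k c f σ else wp k d f σ := rfl

theorem wp_skip (k : ℝ≥0∞) (f : Mem → ℝ≥0∞) (σ : Mem) : wp k .skip f σ = k + f σ := rfl

theorem wp_coin (k : ℝ≥0∞) (x y z : ℕ) (f : Mem → ℝ≥0∞) (σ : Mem) :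
    wp k (.coin x y z) f σ = k + (coinBias (σ.reg y) (σ.reg z) * f (σ.setReg x 1)
      + (1 - coinBias (σ.reg y) (σ.reg z)) * f (σ.setReg x 0)) := rfl

/-- Park induction: any prefix point of the unfolding bounds the value of a loop. -/
theorem wp_loop_le {k : ℝ≥0∞} {x y : ℕ} {c : Cmd} {f I : Mem → ℝ≥0∞}
    (h : ∀ σ, k + (if σ.reg x < σ.reg y then wp k c I σ else f σ) ≤ I σ) (σ : Mem) :
    wp k (.loop x y c) f σ ≤ I σ := by
  have : wp k (.loop x y c) f ≤ I := sInf_le h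
  exact this σ

/-- The memory `τ` agrees with `σ` on the registers outside `R` and on the arrays outside `A`. -/
def Agree (R A : List ℕ) (σ τ : Mem) : Prop :=
  (∀ r, r ∉ R → τ.reg r = σ.reg r) ∧ ∀ a, a ∉ A → τ.arr a = σ.arr a

/-- The registers that a program may write. -/
def Cmd.regs : Cmd → List ℕ
  | .skip => []
  | .const x _ => [x]
  | .add x _ _ => [x]
  | .sub x _ _ => [x]
  | .load x _ _ => [x]
  | .store _ _ _ => []
  | .coin x _ _ => [x]
  | .seq c d => c.regs ++ d.regs
  | .branch _ _ c d => c.regs ++ d.regs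
  | .loop _ _ c => c.regs

/-- The arrays that a program may write. -/
def Cmd.arrs : Cmd → List ℕ
  | .store a _ _ => [a]
  | .seq c d => c.arrs ++ d.arrs
  | .branch _ _ c d => c.arrs ++ d.arrs
  | .loop _ _ c => c.arrs
  | _ => []

theorem Agree.refl (R A : List ℕ) (σ : Mem) : Agree R A σ σ := ⟨fun _ _ => rfl, fun _ _ => rfl⟩

theorem Agree.trans {R A : List ℕ} {σ τ ρ : Mem} (h : Agree R A σ τ) (h' : Agree R A τ ρ) :
    Agree R A σ ρ :=
  ⟨fun r hr => (h'.1 r hr).trans (h.1 r hr), fun a ha => (h'.2 a ha).trans (h.2 a ha)⟩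

theorem Agree.mono {R A R' A' : List ℕ} {σ τ : Mem} (h : Agree R A σ τ) (hR : R ⊆ R')
    (hA : A ⊆ A') : Agree R' A' σ τ :=
  ⟨fun r hr => h.1 r fun h' => hr (hR h'), fun a ha => h.2 a fun h' => ha (hA h')⟩

theorem agree_setReg (x v : ℕ) (σ : Mem) : Agree [x] [] σ (σ.setReg x v) := by
  refine ⟨fun r hr => ?_, fun a _ => rfl⟩
  simp at hr
  simp [Mem.setReg, hr]

theorem agree_setArr (a i v : ℕ) (σ : Mem) : Agree [] [a] σ (σ.setArr a i v) := by
  refine ⟨fun r hr => rfl, fun b hb => ?_⟩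
  simp at hb
  simp [Mem.setArr, hb]

/-- The pre-expectation is monotone in the reward; moreover only the rewards of memories that the
program can produce according to its footprint count. -/
theorem wp_mono_agree (k : ℝ≥0∞) (c : Cmd) : ∀ (f g : Mem → ℝ≥0∞) (σ : Mem),
    (∀ τ, Agree c.regs c.arrs σ τ → f τ ≤ g τ) → wp k c f σ ≤ wp k c g σ := by
  induction c with
  | skip => intro f g σ h; exact add_le_add le_rfl (h _ (Agree.refl _ _ _))
  | const x v => intro f g σ h; exact add_le_add le_rfl (h _ (agree_setReg _ _ _))
  | add x y z => intro f g σ h; exact add_le_add le_rfl (h _ (agree_setReg _ _ _))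
  | sub x y z => intro f g σ h; exact add_le_add le_rfl (h _ (agree_setReg _ _ _))
  | load x a i => intro f g σ h; exact add_le_add le_rfl (h _ (agree_setReg _ _ _))
  | store a i x => intro f g σ h; exact add_le_add le_rfl (h _ (agree_setArr _ _ _ _))
  | coin x y z =>
    intro f g σ h
    exact add_le_add le_rfl (add_le_add (mul_le_mul_right (h _ (agree_setReg _ _ _)) _)
      (mul_le_mul_right (h _ (agree_setReg _ _ _)) _))
  | seq c d ihc ihd =>
    intro f g σ h
    refine add_le_add le_rfl (ihc _ _ _ fun τ hτ => ihd _ _ _ fun ρ hρ => h ρ ?_)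
    exact (hτ.mono (by simp [Cmd.regs]) (by simp [Cmd.arrs])).trans
      (hρ.mono (by simp [Cmd.regs]) (by simp [Cmd.arrs]))
  | branch x y c d ihc ihd =>
    intro f g σ h
    simp only [wp]
    refine add_le_add le_rfl ?_
    split
    · exact ihc _ _ _ fun τ hτ => h τ (hτ.mono (by simp [Cmd.regs]) (by simp [Cmd.arrs]))
    · exact ihd _ _ _ fun τ hτ => h τ (hτ.mono (by simp [Cmd.regs]) (by simp [Cmd.arrs]))
  | loop x y c ih =>
    intro f g σ h
    classical
    rw [show wp k (.loop x y c) g σ = ⨅ X ∈ {X : Mem → ℝ≥0∞ |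
      ∀ σ, k + (if σ.reg x < σ.reg y then wp k c X σ else g σ) ≤ X σ}, X σ from by
        simp only [wp]
        rw [sInf_eq_iInf]
        simp]
    refine le_iInf₂ fun X hX => ?_
    -- a solution for `g`, set to `∞` off the reachable memories, is a solution for `f`
    let Y : Mem → ℝ≥0∞ := fun τ => if Agree c.regs c.arrs σ τ then X τ else ⊤
    have hY : wp k (.loop x y c) f σ ≤ Y σ := by
      refine wp_loop_le (fun τ => ?_) σ
      by_cases hτ : Agree c.regs c.arrs σ τ
      · refine le_trans ?_ ((hX τ).trans (le_of_eq (by simp [Y, hτ])))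
        refine add_le_add le_rfl ?_
        split
        · refine ih _ _ _ fun ρ hρ => ?_
          simp [Y, hτ.trans hρ]
        · exact h τ hτ
      · simp [Y, hτ]
    simpa [Y, Agree.refl] using hY

/-- It suffices to consider rewards that vanish off the memories permitted by the footprint. -/
theorem wp_frame {k : ℝ≥0∞} {c : Cmd} {f : Mem → ℝ≥0∞} {σ : Mem} {X : ℝ≥0∞}
    (h : ∀ g : Mem → ℝ≥0∞, (∀ τ, g τ ≤ f τ) → (∀ τ, ¬ Agree c.regs c.arrs σ τ → g τ = 0) →
      wp k c g σ ≤ X) : wp k c f σ ≤ X := by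
  classical
  refine le_trans (wp_mono_agree k c f (fun τ => if Agree c.regs c.arrs σ τ then f τ else 0) σ
    fun τ hτ => by simp [hτ]) (h _ (fun τ => ?_) fun τ hτ => by simp [hτ])
  split <;> simp

theorem wp_mono {k : ℝ≥0∞} {c : Cmd} {f g : Mem → ℝ≥0∞} (h : ∀ τ, f τ ≤ g τ) (σ : Mem) :
    wp k c f σ ≤ wp k c g σ := wp_mono_agree k c f g σ fun τ _ => h τ

/-- The least prefix point is itself a prefix point. -/
theorem wp_loop_prefix (k : ℝ≥0∞) (x y : ℕ) (c : Cmd) (f : Mem → ℝ≥0∞) (σ : Mem) :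
    k + (if σ.reg x < σ.reg y then wp k c (wp k (.loop x y c) f) σ else f σ)
      ≤ wp k (.loop x y c) f σ := by
  conv_rhs => rw [wp]
  rw [sInf_apply]
  refine le_iInf fun ⟨X, hX⟩ => le_trans (add_le_add le_rfl ?_) (hX σ)
  split
  · exact wp_mono (fun τ => wp_loop_le hX τ) σ
  · exact le_rfl

theorem wp_loop (k : ℝ≥0∞) (x y : ℕ) (c : Cmd) (f : Mem → ℝ≥0∞) (σ : Mem) :
    wp k (.loop x y c) f σ =
      k + (if σ.reg x < σ.reg y then wp k c (wp k (.loop x y c) f) σ else f σ) := by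
  refine le_antisymm (wp_loop_le (I := fun σ => k + (if σ.reg x < σ.reg y then
    wp k c (wp k (.loop x y c) f) σ else f σ)) (fun τ => add_le_add le_rfl ?_) σ)
    (wp_loop_prefix k x y c f σ)
  split
  · exact wp_mono (wp_loop_prefix k x y c f) τ
  · exact le_rfl

/-- Soundness of the pre-expectation for the small-step semantics, for a command in front of a
continuation `K`. -/
theorem ev_cons_le_wp (k : ℝ≥0∞) (g : Mem → ℝ≥0∞) (c : Cmd) :
    ∀ (t : ℕ) (K : List Cmd) (f : Mem → ℝ≥0∞), (∀ s ≤ t, ∀ σ, ev k g s (K, σ) ≤ f σ) →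
      ∀ σ, ev k g t (c :: K, σ) ≤ wp k c f σ := by
  induction c with
  | seq c d ihc ihd =>
    intro t K f h σ
    cases t with
    | zero => simp [ev]
    | succ t =>
      simp only [ev, step, pexp_pure, wp]
      refine add_le_add (by simp) (ihc t _ _ (fun s hs τ => ihd s _ _ (fun s' hs' => ?_) τ) σ)
      exact h s' (by omega)
  | branch x y c d ihc ihd =>
    intro t K f h σ
    cases t with
    | zero => simp [ev]
    | succ t =>
      simp only [ev, step, pexp_pure, wp]
      refine add_le_add (by simp) ?_
      split
      · exact ihc t _ _ (fun s hs => h s (by omega)) σ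
      · exact ihd t _ _ (fun s hs => h s (by omega)) σ
  | loop x y c ih =>
    intro t
    induction t using Nat.strong_induction_on with
    | _ t iht =>
      intro K f h σ
      cases t with
      | zero => simp [ev]
      | succ t =>
        rw [wp_loop]
        simp only [ev, step, pexp_pure]
        refine add_le_add (by simp) ?_
        split
        · exact ih t _ _ (fun s hs => iht s (by omega) K f fun s' hs' => h s' (by omega)) σ
        · exact h t (by omega) σ
  | coin x y z =>
    intro t K f h σ
    cases t with
    | zero => simp [ev]
    | succ t =>
      simp only [ev, step, pexp_map, pexp_coinDist, wp]
      refine add_le_add (by simp) (add_le_add (mul_le_mul_right (h t (by omega) _) _)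
        (mul_le_mul_right (h t (by omega) _) _))
  | _ =>
    intro t K f h σ
    cases t with
    | zero => simp [ev]
    | succ t =>
      simp only [ev, step, pexp_pure, wp]
      exact add_le_add (by simp) (h t (by omega) _)

theorem ev_le_wp (k : ℝ≥0∞) (f : Mem → ℝ≥0∞) (c : Cmd) (t : ℕ) (σ : Mem) :
    ev k f t ([c], σ) ≤ wp k c f σ := by
  have h : ∀ (s : ℕ) (τ : Mem), ev k f s ([], τ) ≤ f τ := by
    intro s
    induction s with
    | zero => simp [ev]
    | succ s ih => intro τ; simpa [ev, step, pexp_pure] using ih τ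
  exact ev_cons_le_wp k f c t [] f (fun s _ => h s) σ

theorem run_succ_toOuterMeasure (t : ℕ) (c : Config) (s : Set Config) :
    (run (t + 1) c).toOuterMeasure s = pexp (step c) fun c' => (run t c').toOuterMeasure s := by
  rw [run, PMF.toOuterMeasure_bind_apply, pexp]

/-- The truncated expected running time is the truncated reward at unit cost per step. -/
theorem sum_running_eq_ev (N : ℕ) : ∀ c : Config,
    ∑ t ∈ Finset.range N, (run t c).toOuterMeasure {c | c.1 ≠ []} = ev 1 (fun _ => 0) N c := by
  induction N with
  | zero => intro c; simp [ev]
  | succ N ih =>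
    intro c
    rw [Finset.sum_range_succ', ev, add_comm]
    congr 1
    · by_cases h : c.1 = [] <;> simp [run, PMF.toOuterMeasure_pure_apply, h]
    · simp only [run_succ_toOuterMeasure]
      simp only [pexp]
      rw [← Summable.tsum_finsetSum (fun _ _ => ENNReal.summable)]
      refine tsum_congr fun c' => ?_
      rw [← Finset.mul_sum, ih]

theorem halted_eq_ev (P : Mem → Prop) [DecidablePred P] (t : ℕ) : ∀ c : Config,
    (run t c).toOuterMeasure {c | c.1 = [] ∧ P c.2} = ev 0 (fun σ => if P σ then 1 else 0) t c := by
  induction t with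
  | zero =>
    intro c
    by_cases h : c.1 = [] <;> by_cases h' : P c.2 <;>
      simp [run, ev, PMF.toOuterMeasure_pure_apply, h, h']
  | succ t ih =>
    intro c
    rw [run_succ_toOuterMeasure, ev]
    simp only [ih, ite_self, zero_add]

theorem expectedTime_le_wp (c : Cmd) (σ : Mem) : expectedTime c σ ≤ wp 1 c (fun _ => 0) σ := by
  rw [expectedTime, ENNReal.tsum_eq_iSup_nat]
  exact iSup_le fun N => (sum_running_eq_ev N _).le.trans (ev_le_wp _ _ _ _ _)

/-- A program of finite expected running time halts almost surely, so that it achieves `P` unless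
it halts on a memory that violates `P`. -/
theorem one_le_haltProb_add (c : Cmd) (σ : Mem) (P : Mem → Prop) [DecidablePred P]
    (hT : expectedTime c σ ≠ ∞) :
    1 ≤ haltProb c σ P + wp 0 c (fun σ => if P σ then 0 else 1) σ := by
  have hsum : ∀ t, 1 ≤ haltProb c σ P + wp 0 c (fun σ => if P σ then 0 else 1) σ
      + (run t ([c], σ)).toOuterMeasure {c | c.1 ≠ []} := by
    intro t
    have h1 : (1 : ℝ≥0∞) = (run t ([c], σ)).toOuterMeasure Set.univ := by
      rw [(PMF.toOuterMeasure_apply_eq_one_iff _ _).2 (Set.subset_univ _)]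
    have h2 : (Set.univ : Set Config) = ({c | c.1 = [] ∧ P c.2} ∪ {c | c.1 = [] ∧ ¬ P c.2})
        ∪ {c | c.1 ≠ []} := by
      ext c
      by_cases h : c.1 = [] <;> by_cases h' : P c.2 <;> simp [h, h']
    refine (h1.trans (congrArg _ h2)).le.trans ?_
    refine (MeasureTheory.measure_union_le _ _).trans (add_le_add ?_ le_rfl)
    refine (MeasureTheory.measure_union_le _ _).trans (add_le_add ?_ ?_)
    · exact le_iSup (fun t => (run t ([c], σ)).toOuterMeasure {c | c.1 = [] ∧ P c.2}) t
    · rw [halted_eq_ev (fun σ => ¬ P σ)]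
      refine (ev_le_wp _ _ _ _ _).trans (wp_mono (fun τ => ?_) σ)
      by_cases h' : P τ <;> simp [h']
  have hlim := ENNReal.tendsto_atTop_zero_of_tsum_ne_top hT
  have := (tendsto_const_nhds (x := haltProb c σ P
    + wp 0 c (fun σ => if P σ then 0 else 1) σ)).add hlim
  rw [add_zero] at this
  exact ge_of_tendsto' this hsum

/-! ### Deterministic program logic with running times -/

/-- Started on `σ`, the program halts after at most `T` steps on a memory that satisfies `Q`.
It is expressed by the pre-expectation, so that random choices that do not matter for `Q` and `T`
are allowed. -/
def Runs (c : Cmd) (σ : Mem) (T : ℕ) (Q : Mem → Prop) : Prop :=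
  ∀ (k : ℝ≥0∞) (f : Mem → ℝ≥0∞) (F : ℝ≥0∞), (∀ τ, Q τ → f τ ≤ F) → wp k c f σ ≤ k * T + F

theorem Runs.conseq {c : Cmd} {σ : Mem} {T T' : ℕ} {P Q : Mem → Prop} (h : Runs c σ T P)
    (hT : T ≤ T') (hQ : ∀ τ, P τ → Q τ) : Runs c σ T' Q := by
  intro k f F hf
  refine (h k f F fun τ hτ => hf τ (hQ τ hτ)).trans ?_
  gcongr

/-- Whatever lies outside the footprint of a program is unchanged by it. -/
theorem Runs.frame {c : Cmd} {σ : Mem} {T : ℕ} {Q : Mem → Prop} (h : Runs c σ T Q) :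
    Runs c σ T (fun τ => Q τ ∧ Agree c.regs c.arrs σ τ) := by
  classical
  intro k f F hf
  refine le_trans (wp_mono_agree k c f (fun τ => if Agree c.regs c.arrs σ τ then f τ else 0) σ
    fun τ hτ => by simp [hτ]) (h k _ F fun τ hτ => ?_)
  by_cases h' : Agree c.regs c.arrs σ τ
  · simpa [h'] using hf τ ⟨hτ, h'⟩
  · simp [h']

theorem Runs.seq {c d : Cmd} {σ : Mem} {T₁ T₂ : ℕ} {P Q : Mem → Prop} (h : Runs c σ T₁ P)
    (h' : ∀ τ, P τ → Runs d τ T₂ Q) : Runs (.seq c d) σ (T₁ + T₂ + 1) Q := by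
  intro k f F hf
  have := h k (wp k d f) (k * T₂ + F) fun τ hτ => h' τ hτ k f F hf
  simp only [wp]
  calc k + wp k c (wp k d f) σ ≤ k + (k * T₁ + (k * T₂ + F)) := by gcongr
    _ = _ := by push_cast; ring

theorem Runs.branch {x y : ℕ} {c d : Cmd} {σ : Mem} {T : ℕ} {Q : Mem → Prop}
    (h : σ.reg x < σ.reg y → Runs c σ T Q) (h' : ¬ σ.reg x < σ.reg y → Runs d σ T Q) :
    Runs (.branch x y c d) σ (T + 1) Q := by
  intro k f F hf
  simp only [wp]
  calc _ ≤ k + (k * T + F) := by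
        gcongr
        split
        · exact h ‹_› k f F hf
        · exact h' ‹_› k f F hf
    _ = _ := by push_cast; ring

theorem steps_le {k X : ℝ≥0∞} {a b : ℕ} (h : a ≤ b) : k * (a : ℝ≥0∞) + X ≤ k * (b : ℝ≥0∞) + X := by
  gcongr

/-- The amortized rule for loops: the invariant `I b` carries a time budget `b`. -/
theorem Runs.loop {x y : ℕ} {c : Cmd} {Q : Mem → Prop} (I : ℕ → Mem → Prop)
    (hstep : ∀ b σ, I b σ → σ.reg x < σ.reg y →
      ∃ t, t + 1 ≤ b ∧ Runs c σ t fun τ => ∃ b', b' + t + 1 ≤ b ∧ I b' τ)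
    (hend : ∀ b σ, I b σ → ¬ σ.reg x < σ.reg y → 1 ≤ b ∧ Q σ) :
    ∀ b σ, I b σ → Runs (.loop x y c) σ b Q := by
  intro b
  induction b using Nat.strong_induction_on with
  | _ b ih =>
    intro σ hI k f F hf
    rw [wp_loop]
    split
    · rename_i hg
      obtain ⟨t, hb, ht⟩ := hstep b σ hI hg
      have := ht k (wp k (.loop x y c) f) (k * ((b - t - 1 : ℕ) : ℝ≥0∞) + F) ?_
      · calc _ ≤ k + (k * t + (k * ((b - t - 1 : ℕ) : ℝ≥0∞) + F)) := by gcongr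
          _ = k * ((1 + t + (b - t - 1) : ℕ) : ℝ≥0∞) + F := by push_cast; ring
          _ = _ := by congr 3; omega
      · rintro τ ⟨b', hb', hI'⟩
        refine (ih b' (by omega) τ hI' k f F hf).trans ?_
        gcongr
        omega
    · rename_i hg
      obtain ⟨h1, h2⟩ := hend b σ hI hg
      refine add_le_add ?_ (hf σ h2)
      calc k = k * (1 : ℕ) := by simp
        _ ≤ _ := by gcongr

/-- The effect of an elementary deterministic command. -/
def Cmd.det : Cmd → Mem → Mem
  | .const x v, σ => σ.setReg x v
  | .add x y z, σ => σ.setReg x (σ.reg y + σ.reg z)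
  | .sub x y z, σ => σ.setReg x (σ.reg y - σ.reg z)
  | .load x a i, σ => σ.setReg x (σ.arr a (σ.reg i))
  | .store a i x, σ => σ.setArr a (σ.reg i) (σ.reg x)
  | _, σ => σ

/-- Whether a command is elementary and deterministic. -/
def Cmd.isDet : Cmd → Bool
  | .coin _ _ _ | .seq _ _ | .branch _ _ _ _ | .loop _ _ _ => false
  | _ => true

/-- The commands of a list in a row. -/
def Cmd.block : List Cmd → Cmd
  | [] => .skip
  | c :: l => .seq c (block l)

/-- The effect of a list of elementary deterministic commands. -/
def exec : List Cmd → Mem → Mem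
  | [], σ => σ
  | c :: l, σ => exec l (c.det σ)

theorem agree_exec (l : List Cmd) : ∀ σ : Mem,
    Agree (Cmd.block l).regs (Cmd.block l).arrs σ (exec l σ) := by
  induction l with
  | nil => exact fun σ => Agree.refl _ _ σ
  | cons c l ih =>
    intro σ
    have hc : Agree c.regs c.arrs σ (c.det σ) := by
      cases c <;>
        first
          | exact agree_setReg _ _ _
          | exact agree_setArr _ _ _ _
          | exact Agree.refl _ _ _
    exact (hc.mono (by simp [Cmd.block, Cmd.regs]) (by simp [Cmd.block, Cmd.arrs])).trans
      ((ih _).mono (by simp [Cmd.block, Cmd.regs]) (by simp [Cmd.block, Cmd.arrs]))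

/-- The commands `seq` and the final `skip` take a step each, whence the factor `2` and the summand `1`. -/
theorem wp_block (k : ℝ≥0∞) (f : Mem → ℝ≥0∞) (l : List Cmd) : ∀ σ : Mem,
    (l.all Cmd.isDet) = true →
      wp k (Cmd.block l) f σ = k * ((2 * l.length + 1 : ℕ) : ℝ≥0∞) + f (exec l σ) := by
  induction l with
  | nil => intro σ _; simp [Cmd.block, wp, exec]
  | cons c l ih =>
    intro σ h
    simp only [List.all_cons, Bool.and_eq_true] at h
    have hc : ∀ g, wp k c g σ = k + g (c.det σ) := by
      intro g
      cases c <;> simp_all [Cmd.isDet, wp, Cmd.det]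
    simp only [Cmd.block, wp, hc, ih _ h.2, exec, List.length_cons]
    push_cast
    ring

theorem Runs.block {l : List Cmd} {σ : Mem} {Q : Mem → Prop} (hl : (l.all Cmd.isDet) = true)
    (h : Q (exec l σ)) : Runs (Cmd.block l) σ (2 * l.length + 1) Q := by
  intro k f F hf
  rw [wp_block k f l σ hl]
  gcongr
  exact hf _ h

theorem Runs.block_seq {l : List Cmd} {d : Cmd} {σ : Mem} {T : ℕ} {Q : Mem → Prop}
    (hl : (l.all Cmd.isDet) = true) (h : Runs d (exec l σ) T Q) :
    Runs (.seq (Cmd.block l) d) σ (T + (2 * l.length + 2)) Q := by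
  refine (Runs.seq (Runs.block (Q := fun τ => τ = exec l σ) hl rfl)
    (fun τ hτ => hτ ▸ h)).conseq (by omega) fun _ h => h

theorem Runs.skip {σ : Mem} {Q : Mem → Prop} (h : Q σ) : Runs .skip σ 1 Q := by
  intro k f F hf
  simpa [wp] using add_le_add le_rfl (hf _ h)

theorem wp_le_of_runs_seq {k : ℝ≥0∞} {c d : Cmd} {σ : Mem} {T : ℕ} {P : Mem → Prop}
    {f : Mem → ℝ≥0∞} {F : ℝ≥0∞} (h : Runs c σ T P) (h' : ∀ τ, P τ → wp k d f τ ≤ F) :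
    wp k (.seq c d) f σ ≤ k * ((T + 1 : ℕ) : ℝ≥0∞) + F := by
  simp only [wp]
  calc _ ≤ k + (k * T + F) := by gcongr; exact h k _ F h'
    _ = _ := by push_cast; ring

@[simp] theorem reg_setReg (σ : Mem) (x v y : ℕ) :
    (σ.setReg x v).reg y = if y = x then v else σ.reg y := by
  simp [Mem.setReg, Function.update_apply]

@[simp] theorem arr_setReg (σ : Mem) (x v : ℕ) : (σ.setReg x v).arr = σ.arr := rfl

@[simp] theorem reg_setArr (σ : Mem) (a i v : ℕ) : (σ.setArr a i v).reg = σ.reg := rfl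

@[simp] theorem arr_setArr (σ : Mem) (a i v b j : ℕ) :
    (σ.setArr a i v).arr b j = if b = a ∧ j = i then v else σ.arr b j := by
  by_cases h : b = a
  · subst h
    simp [Mem.setArr, Function.update_apply]
  · simp [Mem.setArr, h]

/-- `for R i := 0, …, R N - 1 do c`; register `5` must hold the constant `1`. -/
def forLoop (i N : ℕ) (c : Cmd) : Cmd :=
  .seq (.const i 0) (.loop i N (.seq c (.add i i 5)))

/-- The rule for probabilistic counting loops. The relation `I j a` says that a memory represents
the abstract state `a` before the `j`-th pass, and `V j a` bounds the expected reward from there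
on. -/
theorem wp_forLoop_le {α : Type*} {i N : ℕ} {c : Cmd} {k : ℝ≥0∞} {f : Mem → ℝ≥0∞} {σ : Mem}
    {n t : ℕ} (I : ℕ → α → Mem → Prop) (V : ℕ → α → ℝ≥0∞) (F : ℝ≥0∞)
    (hN : σ.reg N = n) (h5 : σ.reg 5 = 1)
    (hi : i ∉ c.regs) (hNc : N ∉ c.regs) (h5c : 5 ∉ c.regs) (hiN : N ≠ i) (hi5 : 5 ≠ i)
    (hset : ∀ j a τ v, I j a τ → I j a (τ.setReg i v))
    (a₀ : α) (h0 : I 0 a₀ σ)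
    (hstep : ∀ j a τ, j < n → I j a τ → τ.reg i = j → Agree (i :: c.regs) c.arrs σ τ →
      ∀ (B : ℝ≥0∞) (g : Mem → ℝ≥0∞), (∀ a' ρ, I (j + 1) a' ρ → Agree c.regs c.arrs τ ρ →
        g ρ ≤ B + V (j + 1) a') → wp k c g τ ≤ k * t + B + V j a)
    (hend : ∀ a τ, I n a τ → Agree (i :: c.regs) c.arrs σ τ → f τ ≤ F + V n a) :
    wp k (forLoop i N c) f σ ≤ k * ((n * (t + 3) + 3 : ℕ) : ℝ≥0∞) + F + V 0 a₀ := by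
  have hA : ∀ τ ρ, Agree (i :: c.regs) c.arrs σ τ → Agree c.regs c.arrs τ ρ →
      Agree (i :: c.regs) c.arrs σ ρ := fun τ ρ h h' =>
    h.trans (h'.mono (List.subset_cons_self _ _) (List.Subset.refl _))
  have hAs : ∀ τ v, Agree (i :: c.regs) c.arrs σ τ →
      Agree (i :: c.regs) c.arrs σ (τ.setReg i v) := fun τ v h =>
    h.trans ((agree_setReg i v τ).mono (by simp) (by simp))
  have key : ∀ r j, j + r = n → ∀ a τ, I j a τ → τ.reg i = j →
      Agree (i :: c.regs) c.arrs σ τ →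
      wp k (.loop i N (.seq c (.add i i 5))) f τ
        ≤ k * ((r * (t + 3) + 1 : ℕ) : ℝ≥0∞) + F + V j a := by
    intro r
    induction r with
    | zero =>
      intro j hj a τ hI hij hag
      have hNτ : τ.reg N = n := by rw [hag.1 N (by simp [hiN, hNc]), hN]
      rw [wp_loop, if_neg (by omega)]
      obtain rfl : j = n := by omega
      calc k + f τ ≤ k + (F + V j a) := by gcongr; exact hend a τ hI hag
        _ = _ := by simp [add_assoc]
    | succ r ih =>
      intro j hj a τ hI hij hag
      have hNτ : τ.reg N = n := by rw [hag.1 N (by simp [hiN, hNc]), hN]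
      rw [wp_loop, if_pos (by omega)]
      rw [wp_seq, wp_add]
      have := hstep j a τ (by omega) hI hij hag
        (k * ((r * (t + 3) + 2 : ℕ) : ℝ≥0∞) + F)
        (fun σ_1 => k + wp k (.loop i N (.seq c (.add i i 5))) f
          (σ_1.setReg i (σ_1.reg i + σ_1.reg 5))) ?_
      · calc _ ≤ k + (k + (k * t + (k * ((r * (t + 3) + 2 : ℕ) : ℝ≥0∞) + F) + V j a)) := by
              gcongr
          _ ≤ k * (((r + 1) * (t + 3) + 1 : ℕ) : ℝ≥0∞) + F + V j a := by
              apply le_of_eq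
              push_cast
              ring
      · intro a' ρ hI' hρ
        have hag' := hA τ ρ hag hρ
        have e5 : ρ.reg 5 = 1 := by rw [hag'.1 5 (by simp [hi5, h5c]), h5]
        have ei : ρ.reg i = j := by rw [hρ.1 i hi, hij]
        calc _ ≤ k + (k * ((r * (t + 3) + 1 : ℕ) : ℝ≥0∞) + F + V (j + 1) a') := by
              gcongr
              refine ih (j + 1) (by omega) a' _ (hset _ _ _ _ hI') ?_ (hAs _ _ hag')
              simp [ei, e5]
          _ = _ := by push_cast; ring
  rw [_root_.forLoop, wp_seq, wp_const]
  calc _ ≤ k + (k + (k * ((n * (t + 3) + 1 : ℕ) : ℝ≥0∞) + F + V 0 a₀)) := by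
        gcongr
        exact key n 0 (by omega) a₀ _ (hset _ _ _ _ h0) (by simp)
          (hAs _ _ (Agree.refl _ _ _))
    _ = _ := by push_cast; ring

/-- The rule for counting loops whose body has an effect that does not depend on chance. -/
theorem Runs.forLoop {i N : ℕ} {c : Cmd} {σ : Mem} {n t : ℕ} (I : ℕ → Mem → Prop)
    (hN : σ.reg N = n) (h5 : σ.reg 5 = 1)
    (hi : i ∉ c.regs) (hNc : N ∉ c.regs) (h5c : 5 ∉ c.regs) (hiN : N ≠ i) (hi5 : 5 ≠ i)
    (hset : ∀ j τ v, I j τ → I j (τ.setReg i v)) (h0 : I 0 σ)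
    (hstep : ∀ j τ, j < n → I j τ → τ.reg i = j → Agree (i :: c.regs) c.arrs σ τ →
      Runs c τ t (I (j + 1))) :
    Runs (forLoop i N c) σ (n * (t + 3) + 3) (I n) := by
  intro k f F hf
  have := wp_forLoop_le (α := Unit) (k := k) (f := f) (t := t) (fun j _ => I j) (fun _ _ => F) 0
    hN h5 hi hNc h5c hiN hi5 (fun j _ => hset j) () h0 ?_ ?_
  · simpa using this
  · intro j _ τ hj hI hij hag B g hg
    rw [add_assoc]
    exact (hstep j τ hj hI hij hag).frame k g _ fun ρ hρ => hg () ρ hρ.1 hρ.2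
  · intro _ τ hI _
    simpa using hf τ hI

/-! ### Independent arc failures and reachability of a root set -/

/-- A finite directed graph whose arcs fail independently: arc `e` fails with probability `p e`
and survives with probability `q e`. -/
structure FailNet (V A : Type*) where
  tail : A → V
  head : A → V
  p : A → ℝ≥0∞
  q : A → ℝ≥0∞
  p_add_q : ∀ e, p e + q e = 1

/-- The outcome `S`, with the coordinates in `B` replaced by those of `X`. -/
def splice {A : Type*} [DecidableEq A] (B S X : Finset A) : Finset A := (S \ B) ∪ (X ∩ B)

theorem mem_splice {A : Type*} [DecidableEq A] {B S X : Finset A} {e : A} :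
    e ∈ splice B S X ↔ if e ∈ B then e ∈ X else e ∈ S := by
  by_cases h : e ∈ B <;> simp [splice, h]

namespace FailNet

open Relation Finset

variable {V A : Type*} (N : FailNet V A)

/-- `v` has a directed path to `w` along surviving arcs. -/
def Reaches (S : Finset A) : V → V → Prop :=
  ReflTransGen fun u w => ∃ e ∈ S, N.tail e = u ∧ N.head e = w

/-- Every vertex reaches the root set `R` along surviving arcs. -/
def Rooted (R : Finset V) (S : Finset A) : Prop := ∀ v, ∃ w ∈ R, N.Reaches S v w

variable {N}

theorem Reaches.arc {S : Finset A} {e : A} (he : e ∈ S) : N.Reaches S (N.tail e) (N.head e) :=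
  ReflTransGen.single ⟨e, he, rfl, rfl⟩

theorem Rooted.mono {R R' : Finset V} {S : Finset A} (h : N.Rooted R S) (hR : R ⊆ R') :
    N.Rooted R' S := fun v => let ⟨w, hw, hv⟩ := h v; ⟨w, hR hw, hv⟩

/-- Paths that start in a closed set `C` use only the arcs out of `C`. -/
theorem Reaches.congr_of_closed {S S' : Finset A} {C : Finset V} {y z : V}
    (h : N.Reaches S y z) (hy : y ∈ C) (hC : ∀ e ∈ S, N.tail e ∈ C → N.head e ∈ C)
    (hS : ∀ e ∈ S, N.tail e ∈ C → e ∈ S') : N.Reaches S' y z ∧ z ∈ C := by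
  induction h with
  | refl => exact ⟨ReflTransGen.refl, hy⟩
  | tail _ hbc ih =>
    obtain ⟨e, he, rfl, rfl⟩ := hbc
    exact ⟨ih.1.tail ⟨e, hS e he ih.2, rfl, rfl⟩, hC e he ih.2⟩

/-- Whether all vertices reach `R` does not depend on the arcs out of `R`. -/
theorem Rooted.congr {R : Finset V} {S S' : Finset A} (h : N.Rooted R S)
    (hS : ∀ e ∈ S, N.tail e ∉ R → e ∈ S') : N.Rooted R S' := by
  intro v
  obtain ⟨w, hw, hv⟩ := h v
  induction hv using ReflTransGen.head_induction_on with
  | refl => exact ⟨w, hw, ReflTransGen.refl⟩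
  | head hac _ ih =>
    obtain ⟨e, he, rfl, rfl⟩ := hac
    by_cases hR : N.tail e ∈ R
    · exact ⟨_, hR, ReflTransGen.refl⟩
    · obtain ⟨w', hw', h'⟩ := ih
      exact ⟨w', hw', (Reaches.arc (hS e he hR)).trans h'⟩

variable [Fintype V] [Fintype A] [DecidableEq V] [DecidableEq A]

variable (N) in
open Classical in
/-- The set of vertices that `x` reaches. -/
def reach (S : Finset A) (x : V) : Finset V := {y | N.Reaches S x y}

variable (N) in
/-- The arcs whose tail lies in `C`. -/
def outArcs (C : Finset V) : Finset A := {e | N.tail e ∈ C}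

variable (N) in
/-- The probability of the outcome `S`. -/
def pr (S : Finset A) : ℝ≥0∞ := ∏ e, if e ∈ S then N.q e else N.p e

variable (N) in
open Classical in
/-- The expectation of `g`, restricted to the event `P`. -/
def mean (P : Finset A → Prop) (g : Finset A → ℝ≥0∞) : ℝ≥0∞ :=
  ∑ S, if P S then N.pr S * g S else 0

variable (N) in
/-- The probability that every vertex reaches the root set `R`. -/
def Z (R : Finset V) : ℝ≥0∞ := N.mean (N.Rooted R) 1

variable (N) in
/-- The expectation of `Φ` after a fresh sample of the arcs in `B`. -/
def resample (B : Finset A) (Φ : Finset A → ℝ≥0∞) (S : Finset A) : ℝ≥0∞ :=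
  ∑ X, N.pr X * Φ (splice B S X)

@[simp] theorem mem_reach {S : Finset A} {x y : V} : y ∈ N.reach S x ↔ N.Reaches S x y := by
  simp [reach]

@[simp] theorem mem_outArcs {C : Finset V} {e : A} : e ∈ N.outArcs C ↔ N.tail e ∈ C := by
  simp [outArcs]

theorem sum_pr : ∑ S, N.pr S = 1 := by
  have := Fintype.prod_add N.q N.p
  simp only [add_comm (N.q _), N.p_add_q, prod_const_one] at this
  rw [this]
  refine sum_congr rfl fun S _ => ?_
  rw [pr, prod_ite]
  congr 1
  · exact prod_congr (by ext; simp) fun _ _ => rfl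
  · exact prod_congr (by ext; simp) fun _ _ => rfl

/-- The exchange of coordinates in `splice` is measure preserving for two independent outcomes. -/
theorem pr_splice (B S X : Finset A) :
    N.pr (splice B S X) * N.pr (splice B X S) = N.pr S * N.pr X := by
  simp only [pr, ← prod_mul_distrib]
  refine prod_congr rfl fun e _ => ?_
  by_cases h : e ∈ B
  · simp [mem_splice, h, mul_comm]
  · simp [mem_splice, h]

theorem splice_splice (B S X : Finset A) : splice B (splice B S X) (splice B X S) = S := by
  ext e
  by_cases h : e ∈ B <;> simp [mem_splice, h]

/-- Exchanging the coordinates in `B` of two independent outcomes preserves their joint law. -/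
theorem sum_sum_splice (B : Finset A) (F : Finset A → Finset A → ℝ≥0∞) :
    ∑ S, ∑ X, N.pr S * N.pr X * F (splice B S X) (splice B X S)
      = ∑ S, ∑ X, N.pr S * N.pr X * F S X := by
  let s : Finset A × Finset A → Finset A × Finset A :=
    fun x => (splice B x.1 x.2, splice B x.2 x.1)
  have hs : Function.Involutive s := fun x => by simp [s, splice_splice]
  rw [← Fintype.sum_prod_type', ← Fintype.sum_prod_type',
    ← Equiv.sum_comp hs.toPerm (fun x : Finset A × Finset A => N.pr x.1 * N.pr x.2 * F x.1 x.2)]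
  refine sum_congr rfl fun x _ => ?_
  simp [s, pr_splice]

/-- The probability factors into the factor of the arc `e` and the factors of all other arcs. -/
theorem exists_pr_eq (e : A) (S : Finset A) :
    ∃ r, N.pr (insert e S) = N.q e * r ∧ N.pr (S.erase e) = N.p e * r := by
  have h : ∀ T : Finset A, N.pr T = (if e ∈ T then N.q e else N.p e) *
      ∏ a ∈ univ.erase e, if a ∈ T then N.q a else N.p a := fun T =>
    (mul_prod_erase univ (fun a => if a ∈ T then N.q a else N.p a) (mem_univ e)).symm
  refine ⟨∏ a ∈ univ.erase e, if a ∈ S then N.q a else N.p a, ?_, ?_⟩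
  · rw [h, if_pos (mem_insert_self e S)]
    congr 1
    refine prod_congr rfl fun a ha => ?_
    simp [(mem_erase.1 ha).1]
  · rw [h, if_neg (notMem_erase e S)]
    congr 1
    refine prod_congr rfl fun a ha => ?_
    simp [(mem_erase.1 ha).1]

/-- Averaging over a single arc. -/
theorem sum_pr_mul_eq (e : A) (H : Finset A → ℝ≥0∞) :
    ∑ X, N.pr X * H X = ∑ X, N.pr X * (N.p e * H (X.erase e) + N.q e * H (insert e X)) := by
  have hsplit : ∀ g : Finset A → ℝ≥0∞, ∑ X, g X
      = ∑ X ∈ (univ.erase e).powerset, (g X + g (insert e X)) := by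
    intro g
    rw [← powerset_univ, ← insert_erase (mem_univ e), sum_powerset_insert (by simp),
      sum_add_distrib]
    simp
  rw [hsplit, hsplit (fun X => N.pr X * _)]
  refine sum_congr rfl fun X hX => ?_
  have he : e ∉ X := fun h => by simpa using mem_powerset.1 hX h
  obtain ⟨r, h1, h2⟩ := N.exists_pr_eq e X
  rw [erase_eq_of_notMem he] at h2
  rw [erase_eq_of_notMem he, erase_insert he, insert_idem, h1, h2]
  calc _ = r * (N.p e * H X + N.q e * H (insert e X)) := by ring
    _ = (N.p e + N.q e) * (r * (N.p e * H X + N.q e * H (insert e X))) := by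
      rw [N.p_add_q, one_mul]
    _ = _ := by ring

/-- A fresh sample of the arcs in `B ∪ {e}` may begin with the arc `e`. -/
theorem resample_insert {e : A} {B : Finset A} (he : e ∉ B) (Φ : Finset A → ℝ≥0∞)
    (S : Finset A) : N.resample (insert e B) Φ S =
      N.p e * N.resample B Φ (S.erase e) + N.q e * N.resample B Φ (insert e S) := by
  rw [resample, sum_pr_mul_eq e]
  simp only [resample, mul_sum]
  rw [← sum_add_distrib]
  refine sum_congr rfl fun X _ => ?_
  have h1 : splice (insert e B) S (X.erase e) = splice B (S.erase e) X := by
    ext a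
    by_cases hB : a ∈ B
    · have : a ≠ e := fun h => he (h ▸ hB)
      simp [mem_splice, hB, this]
    · by_cases ha : a = e <;> simp [mem_splice, hB, ha]
      simp [he]
  have h2 : splice (insert e B) S (insert e X) = splice B (insert e S) X := by
    ext a
    by_cases hB : a ∈ B
    · have : a ≠ e := fun h => he (h ▸ hB)
      simp [mem_splice, hB, this]
    · by_cases ha : a = e <;> simp [mem_splice, hB, ha]
      simp [he]
  rw [h1, h2]
  ring

theorem resample_empty (Φ : Finset A → ℝ≥0∞) (S : Finset A) : N.resample ∅ Φ S = Φ S := by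
  simp [resample, splice, ← sum_mul, sum_pr]

theorem resample_univ (Φ : Finset A → ℝ≥0∞) (S : Finset A) :
    N.resample univ Φ S = ∑ X, N.pr X * Φ X := by
  have : ∀ X, splice univ S X = X := fun X => by ext; simp [mem_splice]
  simp [resample, this]

theorem resample_one (B S : Finset A) : N.resample B 1 S = 1 := by
  simp [resample, sum_pr]

theorem Z_univ : N.Z univ = 1 := by
  have : ∀ S, N.Rooted univ S := fun S v => ⟨v, mem_univ _, ReflTransGen.refl⟩
  simp [Z, mean, this, sum_pr]

theorem Z_le_one (R : Finset V) : N.Z R ≤ 1 := by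
  rw [← N.sum_pr]
  refine sum_le_sum fun S _ => ?_
  split <;> simp

theorem Z_ne_top (R : Finset V) : N.Z R ≠ ∞ := ((Z_le_one R).trans_lt ENNReal.one_lt_top).ne

theorem Z_ne_zero {R : Finset V} (hR : N.Rooted R univ) (hq : ∀ e, N.q e ≠ 0) : N.Z R ≠ 0 := by
  classical
  have h : N.pr univ ≤ N.Z R := by
    refine le_trans ?_ (single_le_sum (f := fun S => if N.Rooted R S then N.pr S * 1 else 0)
      (fun _ _ => zero_le) (mem_univ univ))
    simp [hR]
  have h' : N.pr univ ≠ 0 := by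
    simp [pr, prod_ne_zero_iff, hq]
  exact fun h0 => h' (le_antisymm (h.trans h0.le) zero_le)

theorem mean_const (R : Finset V) (c : ℝ≥0∞) : N.mean (N.Rooted R) (fun _ => c) = c * N.Z R := by
  simp only [Z, mean, mul_sum]
  refine sum_congr rfl fun S _ => ?_
  split <;> simp [mul_comm]

/-! ### Cluster popping -/

/-- If everything reaches `R`, then everything reaches `R.erase x` as soon as `x` does. -/
theorem rooted_erase_iff {R : Finset V} {S : Finset A} {x : V} (h : N.Rooted R S) :
    N.Rooted (R.erase x) S ↔ ¬ Disjoint (N.reach S x) (R.erase x) := by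
  rw [not_disjoint_iff]
  constructor
  · intro h'
    obtain ⟨w, hw, hx⟩ := h' x
    exact ⟨w, by simpa using hx, hw⟩
  · rintro ⟨w, hx, hw⟩ v
    obtain ⟨y, hy, hv⟩ := h v
    by_cases hyx : y = x
    · exact ⟨w, hw, hv.trans (hyx ▸ mem_reach.1 hx)⟩
    · exact ⟨y, mem_erase.2 ⟨hyx, hy⟩, hv⟩

variable (N) in
/-- The event that `C` is the cluster of `x`: the set of vertices reached by `x` is `C`, and all of
them reach `x`. -/
def IsCluster (x : V) (C : Finset V) (S : Finset A) : Prop :=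
  N.reach S x = C ∧ ∀ y ∈ C, N.Reaches S y x

theorem IsCluster.self_mem {x : V} {C : Finset V} {S : Finset A} (h : N.IsCluster x C S) :
    x ∈ C := h.1 ▸ mem_reach.2 ReflTransGen.refl

/-- Being a cluster depends only on the arcs out of the set. -/
theorem IsCluster.congr {x : V} {C : Finset V} {S S' : Finset A} (h : N.IsCluster x C S)
    (hS : ∀ e, N.tail e ∈ C → (e ∈ S ↔ e ∈ S')) : N.IsCluster x C S' := by
  have hcl : ∀ e ∈ S, N.tail e ∈ C → N.head e ∈ C := by
    intro e he ht
    rw [← h.1, mem_reach] at ht ⊢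
    exact ht.trans (Reaches.arc he)
  refine ⟨?_, fun y hy =>
    ((h.2 y hy).congr_of_closed hy hcl fun e he ht => (hS e ht).1 he).1⟩
  ext y
  rw [mem_reach]
  constructor
  · exact fun hy => (hy.congr_of_closed (S' := S) h.self_mem
      (fun e he ht => hcl e ((hS e ht).2 he) ht) fun e he ht => (hS e ht).2 he).2
  · intro hy
    rw [← h.1, mem_reach] at hy
    exact (hy.congr_of_closed h.self_mem hcl fun e he ht => (hS e ht).1 he).1

/-- The outcomes in which everything reaches `R` but not `R.erase x` are those in which the set `C` of
vertices reached by `x` is a cluster disjoint from the other roots, and everything reaches `R ∪ C`.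
The two last events depend on disjoint sets of arcs. -/
theorem rooted_and_reach_iff {R : Finset V} {S : Finset A} {x : V} {C : Finset V} (hx : x ∈ R) :
    (N.Rooted R S ∧ ¬ N.Rooted (R.erase x) S) ∧ N.reach S x = C ↔
      Disjoint C (R.erase x) ∧ N.IsCluster x C S ∧ N.Rooted (R ∪ C) S := by
  constructor
  · rintro ⟨⟨h, h'⟩, rfl⟩
    rw [rooted_erase_iff h, not_not] at h'
    refine ⟨h', ⟨rfl, fun y hy => ?_⟩, h.mono subset_union_left⟩
    obtain ⟨w, hw, hyw⟩ := h y
    by_cases hwx : w = x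
    · exact hwx ▸ hyw
    · exact absurd (mem_erase.2 ⟨hwx, hw⟩)
        (disjoint_left.1 h' (mem_reach.2 ((mem_reach.1 hy).trans hyw)))
  · rintro ⟨hd, hC, h⟩
    have hR : N.Rooted R S := by
      intro v
      obtain ⟨w, hw, hv⟩ := h v
      rcases mem_union.1 hw with hw | hw
      · exact ⟨w, hw, hv⟩
      · exact ⟨x, hx, hv.trans (hC.2 w hw)⟩
    refine ⟨⟨hR, ?_⟩, hC.1⟩
    rw [rooted_erase_iff hR, not_not, hC.1]
    exact hd

/-- A sample given that `C` is the cluster of `x` and everything reaches `R ∪ C` becomes, after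
fresh samples of the arcs out of `C`, a sample given that everything reaches `R ∪ C`. -/
theorem mean_resample_cluster (R : Finset V) (x : V) (C : Finset V) (G : Finset A → ℝ≥0∞) :
    N.mean (fun S => N.IsCluster x C S ∧ N.Rooted (R ∪ C) S) (N.resample (N.outArcs C) G)
      = N.mean (N.IsCluster x C) 1 * N.mean (N.Rooted (R ∪ C)) G := by
  classical
  let B := N.outArcs C
  have h1 : ∀ S X, (N.IsCluster x C S ∧ N.Rooted (R ∪ C) S) ↔
      (N.IsCluster x C (splice B X S) ∧ N.Rooted (R ∪ C) (splice B S X)) := by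
    intro S X
    refine and_congr ⟨fun h => h.congr fun e he => ?_, fun h => h.congr fun e he => ?_⟩
      ⟨fun h => h.congr fun e he ht => ?_, fun h => h.congr fun e he ht => ?_⟩
    · simp [B, mem_splice, he]
    · simp [B, mem_splice, he]
    · have : e ∉ B := fun hB => ht (mem_union_right _ (mem_outArcs.1 hB))
      simpa [mem_splice, this] using he
    · have : e ∉ B := fun hB => ht (mem_union_right _ (mem_outArcs.1 hB))
      simpa [mem_splice, this] using he
  calc _ = ∑ S, ∑ X, N.pr S * N.pr X * (if N.IsCluster x C (splice B X S) ∧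
          N.Rooted (R ∪ C) (splice B S X) then G (splice B S X) else 0) := by
        refine sum_congr rfl fun S _ => ?_
        simp only [← h1]
        split
        · simp only [resample, mul_sum, mul_assoc]
          rfl
        · simp
    _ = ∑ S, ∑ X, N.pr S * N.pr X * (if N.IsCluster x C X ∧ N.Rooted (R ∪ C) S
          then G S else 0) :=
        sum_sum_splice B fun S X => if N.IsCluster x C X ∧ N.Rooted (R ∪ C) S then G S else 0
    _ = _ := by
        rw [mul_comm]
        simp only [mean, sum_mul_sum]
        refine sum_congr rfl fun S _ => sum_congr rfl fun X _ => ?_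
        by_cases ha : N.IsCluster x C X <;> by_cases hb : N.Rooted (R ∪ C) S <;> simp [ha, hb]
        ring

open Classical in
/-- One popping step, averaged over the outcomes in which everything reaches `R` but not
`R.erase x`. -/
theorem mean_pop {R : Finset V} {x : V} (hx : x ∈ R) (G : Finset V → Finset A → ℝ≥0∞) :
    N.mean (fun S => N.Rooted R S ∧ ¬ N.Rooted (R.erase x) S)
      (fun S => N.resample (N.outArcs (N.reach S x)) (G (N.reach S x)) S)
    = ∑ C : Finset V with Disjoint C (R.erase x),
        N.mean (N.IsCluster x C) 1 * N.mean (N.Rooted (R ∪ C)) (G C) := by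
  rw [sum_filter]
  simp only [← mean_resample_cluster]
  rw [mean]
  calc _ = ∑ S, ∑ C, if (N.Rooted R S ∧ ¬ N.Rooted (R.erase x) S) ∧ N.reach S x = C then
        N.pr S * N.resample (N.outArcs C) (G C) S else 0 := by
        refine sum_congr rfl fun S _ => ?_
        by_cases h : N.Rooted R S ∧ ¬ N.Rooted (R.erase x) S <;> simp [h]
    _ = _ := by
        rw [sum_comm]
        refine sum_congr rfl fun C _ => ?_
        by_cases h : Disjoint C (R.erase x)
        · simp only [h, if_true, mean]
          refine sum_congr rfl fun S _ => ?_
          have hiff := N.rooted_and_reach_iff (S := S) (C := C) hx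
          by_cases hP : N.IsCluster x C S ∧ N.Rooted (R ∪ C) S
          · rw [if_pos (hiff.2 ⟨h, hP⟩), if_pos hP]
          · rw [if_neg fun h' => hP (hiff.1 h').2, if_neg hP]
        · simp only [h, if_false]
          refine sum_eq_zero fun S _ => ?_
          simp [rooted_and_reach_iff hx, h]

theorem mean_split {R : Finset V} (x : V) (f : Finset A → ℝ≥0∞) :
    N.mean (N.Rooted R) f = N.mean (N.Rooted (R.erase x)) f
      + N.mean (fun S => N.Rooted R S ∧ ¬ N.Rooted (R.erase x) S) f := by
  simp only [mean, ← sum_add_distrib]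
  refine sum_congr rfl fun S _ => ?_
  by_cases h : N.Rooted (R.erase x) S
  · simp [h, h.mono (erase_subset x R)]
  · by_cases hR : N.Rooted R S <;> simp [h, hR]

open Classical in
/-- The total probability in `mean_pop`. -/
theorem Z_eq_erase_add {R : Finset V} {x : V} (hx : x ∈ R) :
    N.Z R = N.Z (R.erase x) + ∑ C : Finset V with Disjoint C (R.erase x),
        N.mean (N.IsCluster x C) 1 * N.Z (R ∪ C) := by
  rw [Z, mean_split x]
  have := N.mean_pop hx (fun _ _ => 1)
  simp only [show (fun _ => 1 : Finset A → ℝ≥0∞) = 1 from rfl, resample_one] at this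
  rw [show (1 : Finset A → ℝ≥0∞) = fun _ => 1 from rfl] at *
  rw [this]
  rfl

variable (N) in
open Classical in
/-- The expected reward of cluster popping towards the root set `T`, cut off after `t` iterations:
every iteration costs `c`, and `φ` is the reward of the final outcome. In an iteration with current
root set `R`, a vertex `x = pick R` of `R \ T` is dropped from the root set if it reaches another
root. Otherwise the set `C` of the vertices that `x` reaches is popped: the arcs out of `C` are
sampled afresh, and `C` joins the root set. -/
def popValue (T : Finset V) (pick : Finset V → V) (c : ℝ≥0∞) (φ : Finset A → ℝ≥0∞) :
    ℕ → Finset V → Finset A → ℝ≥0∞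
  | 0, _, _ => 0
  | t + 1, R, S => if R = T then φ S else c +
      if Disjoint (N.reach S (pick R)) (R.erase (pick R)) then
        N.resample (N.outArcs (N.reach S (pick R)))
          (popValue T pick c φ t (R ∪ N.reach S (pick R))) S
      else popValue T pick c φ t (R.erase (pick R)) S

theorem mean_popValue_succ {T R : Finset V} {pick : Finset V → V} (hR : R ≠ T)
    (c : ℝ≥0∞) (φ : Finset A → ℝ≥0∞) (t : ℕ) :
    N.mean (N.Rooted R) (N.popValue T pick c φ (t + 1) R) = c * N.Z R
      + (N.mean (N.Rooted (R.erase (pick R))) (N.popValue T pick c φ t (R.erase (pick R)))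
      + N.mean (fun S => N.Rooted R S ∧ ¬ N.Rooted (R.erase (pick R)) S)
        (fun S => N.resample (N.outArcs (N.reach S (pick R)))
          (N.popValue T pick c φ t (R ∪ N.reach S (pick R))) S)) := by
  classical
  rw [← mean_const]
  simp only [mean, ← sum_add_distrib]
  refine sum_congr rfl fun S _ => ?_
  by_cases h : N.Rooted R S
  · have h' := N.rooted_erase_iff (x := pick R) h
    by_cases hd : Disjoint (N.reach S (pick R)) (R.erase (pick R))
    · simp [h, h', hd, popValue, hR, mul_add]
    · simp [h, h', hd, popValue, hR, mul_add]
  · have : ¬ N.Rooted (R.erase (pick R)) S := fun h' => h (h'.mono (erase_subset _ _))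
    simp [h, this]

/-- Popping from the root set `R` towards `T`, started on a sample given that everything reaches
`R`, ends with a sample given that everything reaches `T`. The expected number of iterations is the
difference of the potential `∑ w ∉ R, Z (R ∪ {w}) / Z R` at `T` and at `R`; a bound `M` for the
potential is enough here. -/
theorem mean_popValue_add_le {T : Finset V} {pick : Finset V → V} {c M φ₀ : ℝ≥0∞}
    {φ : Finset A → ℝ≥0∞} (hpick : ∀ R, T ⊆ R → R ≠ T → pick R ∈ R \ T)
    (hM : ∀ R, T ⊆ R → ∑ w ∈ Rᶜ, N.Z (insert w R) ≤ M * N.Z R)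
    (hφ : N.mean (N.Rooted T) φ ≤ φ₀ * N.Z T) (t : ℕ) : ∀ R, T ⊆ R →
    N.mean (N.Rooted R) (N.popValue T pick c φ t R) + c * ∑ w ∈ Rᶜ, N.Z (insert w R)
      ≤ (φ₀ + c * M) * N.Z R := by
  classical
  induction t with
  | zero =>
    intro R hR
    calc _ = c * ∑ w ∈ Rᶜ, N.Z (insert w R) := by simp [mean, popValue]
      _ ≤ c * (M * N.Z R) := by gcongr; exact hM R hR
      _ ≤ _ := by rw [add_mul, mul_assoc]; exact le_add_self
  | succ t ih =>
    intro R hR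
    by_cases hRT : R = T
    · subst hRT
      calc _ = N.mean (N.Rooted R) φ + c * ∑ w ∈ Rᶜ, N.Z (insert w R) := by
            simp [mean, popValue]
        _ ≤ φ₀ * N.Z R + c * (M * N.Z R) := by gcongr; exact hM R hR
        _ = _ := by ring
    · have hx := hpick R hR hRT
      have hpm := N.mean_popValue_succ (pick := pick) hRT c φ t
      set x := pick R with hxdef
      obtain ⟨hxR, hxT⟩ := mem_sdiff.1 hx
      rw [hpm]
      rw [mean_pop hxR (fun C => N.popValue T pick c φ t (R ∪ C))]
      -- the identity for the potential
      have hpot : N.Z R + ∑ w ∈ Rᶜ, N.Z (insert w R) =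
          ∑ w ∈ (R.erase x)ᶜ, N.Z (insert w (R.erase x))
          + ∑ C : Finset V with Disjoint C (R.erase x), N.mean (N.IsCluster x C) 1
            * ∑ w ∈ (R ∪ C)ᶜ, N.Z (insert w (R ∪ C)) := by
        have hc : (R.erase x)ᶜ = insert x Rᶜ := by
          ext y
          by_cases hy : y = x <;> simp [hy]
        rw [hc, sum_insert (by simpa using hxR), insert_erase hxR, add_assoc]
        congr 1
        have : ∀ w ∈ Rᶜ, N.Z (insert w R) = N.Z (insert w (R.erase x)) +
            ∑ C : Finset V with Disjoint C (R.erase x), if w ∈ C then 0 else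
              N.mean (N.IsCluster x C) 1 * N.Z (insert w (R ∪ C)) := by
          intro w hw
          have hwR : w ∉ R := by simpa using hw
          have hwx : w ≠ x := fun h => hwR (h ▸ hxR)
          rw [Z_eq_erase_add (mem_insert_of_mem hxR (b := w)), erase_insert_of_ne hwx]
          congr 1
          rw [sum_filter, sum_filter]
          refine sum_congr rfl fun C _ => ?_
          simp only [disjoint_insert_right, insert_union]
          by_cases h1 : w ∈ C <;> by_cases h2 : Disjoint C (R.erase x) <;> simp [h1, h2]
        rw [sum_congr rfl this, sum_add_distrib, sum_comm]
        congr 1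
        refine sum_congr rfl fun C _ => ?_
        rw [mul_sum]
        refine (sum_subset_zero_on_sdiff ?_ ?_ ?_).symm
        · intro w
          simp
          tauto
        · intro w hw
          simp at hw
          simp [hw.2]
        · intro w hw
          simp at hw
          simp [hw.2]
      calc _ = N.mean (N.Rooted (R.erase x)) (N.popValue T pick c φ t (R.erase x))
            + (∑ C : Finset V with Disjoint C (R.erase x), N.mean (N.IsCluster x C) 1
              * N.mean (N.Rooted (R ∪ C)) (N.popValue T pick c φ t (R ∪ C)))
            + c * (N.Z R + ∑ w ∈ Rᶜ, N.Z (insert w R)) := by ring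
        _ = (N.mean (N.Rooted (R.erase x)) (N.popValue T pick c φ t (R.erase x))
            + c * ∑ w ∈ (R.erase x)ᶜ, N.Z (insert w (R.erase x)))
            + ∑ C : Finset V with Disjoint C (R.erase x), N.mean (N.IsCluster x C) 1
              * (N.mean (N.Rooted (R ∪ C)) (N.popValue T pick c φ t (R ∪ C))
                + c * ∑ w ∈ (R ∪ C)ᶜ, N.Z (insert w (R ∪ C))) := by
            rw [hpot]
            simp only [mul_add, sum_add_distrib, mul_sum]
            have : ∀ C w, c * (N.mean (N.IsCluster x C) 1 * N.Z (insert w (R ∪ C)))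
              = N.mean (N.IsCluster x C) 1 * (c * N.Z (insert w (R ∪ C))) := fun _ _ => by ring
            simp only [this]
            ring
        _ ≤ (φ₀ + c * M) * N.Z (R.erase x) + ∑ C : Finset V with Disjoint C (R.erase x),
            N.mean (N.IsCluster x C) 1 * ((φ₀ + c * M) * N.Z (R ∪ C)) := by
            gcongr with C hC
            · exact ih _ fun y hy => mem_erase.2 ⟨fun h => hxT (h ▸ hy), hR hy⟩
            · exact ih _ (hR.trans subset_union_left)
        _ = _ := by
            rw [Z_eq_erase_add hxR, mul_add, mul_sum]
            congr 1
            exact sum_congr rfl fun C _ => by ring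

theorem popValue_mono (T : Finset V) (pick : Finset V → V) (c : ℝ≥0∞) (φ : Finset A → ℝ≥0∞)
    (t : ℕ) : ∀ R S, N.popValue T pick c φ t R S ≤ N.popValue T pick c φ (t + 1) R S := by
  induction t with
  | zero => intro R S; simp [popValue]
  | succ t ih =>
    intro R S
    rw [popValue, popValue]
    split
    · exact le_rfl
    · gcongr
      split
      · exact sum_le_sum fun X _ => by gcongr; exact ih _ _
      · exact ih _ _

variable (N) in
/-- The expected reward of cluster popping towards the root set `T`; see `popValue`. -/
def popLimit (T : Finset V) (pick : Finset V → V) (c : ℝ≥0∞) (φ : Finset A → ℝ≥0∞)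
    (R : Finset V) (S : Finset A) : ℝ≥0∞ := ⨆ t, N.popValue T pick c φ t R S

theorem popLimit_self {T : Finset V} {pick : Finset V → V} {c : ℝ≥0∞} {φ : Finset A → ℝ≥0∞}
    (S : Finset A) : φ S ≤ N.popLimit T pick c φ T S :=
  le_trans (by simp [popValue]) (le_iSup (fun t => N.popValue T pick c φ t T S) 1)

theorem popLimit_drop {T R : Finset V} {pick : Finset V → V} {c : ℝ≥0∞} {φ : Finset A → ℝ≥0∞}
    {S : Finset A} (hR : R ≠ T) (hd : ¬ Disjoint (N.reach S (pick R)) (R.erase (pick R))) :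
    c + N.popLimit T pick c φ (R.erase (pick R)) S ≤ N.popLimit T pick c φ R S := by
  rw [popLimit, ENNReal.add_iSup]
  refine iSup_le fun t => le_trans ?_ (le_iSup (fun t => N.popValue T pick c φ t R S) (t + 1))
  simp [popValue, hR, hd]

theorem popLimit_pop {T R : Finset V} {pick : Finset V → V} {c : ℝ≥0∞} {φ : Finset A → ℝ≥0∞}
    {S : Finset A} (hR : R ≠ T) (hd : Disjoint (N.reach S (pick R)) (R.erase (pick R))) :
    c + N.resample (N.outArcs (N.reach S (pick R)))
      (N.popLimit T pick c φ (R ∪ N.reach S (pick R))) S ≤ N.popLimit T pick c φ R S := by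
  simp only [resample, popLimit, ENNReal.mul_iSup]
  rw [ENNReal.finsetSum_iSup_of_monotone (fun X => monotone_nat_of_le_succ fun t => by
    gcongr; exact popValue_mono _ _ _ _ t _ _), ENNReal.add_iSup]
  refine iSup_le fun t => le_trans ?_ (le_iSup (fun t => N.popValue T pick c φ t R S) (t + 1))
  simp [popValue, hR, hd, resample]

/-- Cluster popping, started on a fresh sample of all arcs with all vertices as roots, ends with a
sample given that everything reaches `T`, within `M` iterations on average. -/
theorem resample_popLimit_le {T : Finset V} {pick : Finset V → V} {c M φ₀ : ℝ≥0∞}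
    {φ : Finset A → ℝ≥0∞} (hpick : ∀ R, T ⊆ R → R ≠ T → pick R ∈ R \ T)
    (hM : ∀ R, T ⊆ R → ∑ w ∈ Rᶜ, N.Z (insert w R) ≤ M * N.Z R)
    (hφ : N.mean (N.Rooted T) φ ≤ φ₀ * N.Z T) (S : Finset A) :
    N.resample univ (N.popLimit T pick c φ univ) S ≤ φ₀ + c * M := by
  rw [resample_univ]
  simp only [popLimit, ENNReal.mul_iSup]
  rw [ENNReal.finsetSum_iSup_of_monotone (fun X => monotone_nat_of_le_succ fun t => by
    gcongr; exact popValue_mono _ _ _ _ t _ _)]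
  refine iSup_le fun t => ?_
  have h := mean_popValue_add_le (c := c) hpick hM hφ t univ (subset_univ T)
  have hr : ∀ S, N.Rooted univ S := fun S v => ⟨v, mem_univ _, ReflTransGen.refl⟩
  simpa [Z_univ, mean, hr] using h

theorem resample_const_add (B : Finset A) (a : ℝ≥0∞) (Φ : Finset A → ℝ≥0∞) (S : Finset A) :
    N.resample B (fun X => a + Φ X) S = a + N.resample B Φ S := by
  simp [resample, mul_add, sum_add_distrib, ← sum_mul, sum_pr]

/-- Splitting a sample given that everything reaches `T` according to whether `v` reaches another
vertex of `T`. -/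
theorem mean_rooted_ite (T : Finset V) (v : V) (a F₁ F₀ : ℝ≥0∞) :
    N.mean (N.Rooted T) (fun S => a + if Disjoint (N.reach S v) (T.erase v) then F₀ else F₁)
      = (a + F₁) * N.Z (T.erase v)
        + (a + F₀) * N.mean (fun S => N.Rooted T S ∧ ¬ N.Rooted (T.erase v) S) 1 := by
  rw [mean_split v, ← mean_const]
  congr 1
  · refine sum_congr rfl fun S _ => ?_
    by_cases h : N.Rooted (T.erase v) S
    · have := (rooted_erase_iff (h.mono (erase_subset v T))).1 h
      simp [h, this]
    · simp [h]
  · rw [mean, mean, mul_sum]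
    refine sum_congr rfl fun S _ => ?_
    by_cases h : N.Rooted T S
    · have := rooted_erase_iff (x := v) h
      by_cases h' : Disjoint (N.reach S v) (T.erase v)
      · have h'' : ¬ N.Rooted (T.erase v) S := fun hr => this.1 hr h'
        simp [h, h', h'', mul_comm]
      · simp [h, this.2 h']
    · simp [h]

theorem Z_erase_add (T : Finset V) (v : V) :
    N.Z (T.erase v) + N.mean (fun S => N.Rooted T S ∧ ¬ N.Rooted (T.erase v) S) 1 = N.Z T :=
  (mean_split v 1).symm

variable (N) in
/-- The probability that everything reaches `T.erase v` given that everything reaches `T`. -/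
def dropProb (T : Finset V) (v : V) : ℝ≥0∞ := N.Z (T.erase v) / N.Z T

theorem dropProb_mul {T : Finset V} (v : V) (h0 : N.Z T ≠ 0) :
    N.dropProb T v * N.Z T = N.Z (T.erase v) :=
  ENNReal.div_mul_cancel h0 (Z_ne_top T)

theorem dropProb_le_one (T : Finset V) (v : V) : N.dropProb T v ≤ 1 := by
  refine ENNReal.div_le_of_le_mul ?_
  rw [one_mul, ← N.Z_erase_add T v]
  exact le_self_add

/-- In a sample given that everything reaches `T`, the vertex `v` reaches another vertex of `T` with
probability `dropProb T v`. -/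
theorem mean_rooted_ite_eq {T : Finset V} (v : V) (h0 : N.Z T ≠ 0) (a F₁ F₀ : ℝ≥0∞) :
    N.mean (N.Rooted T) (fun S => a + if Disjoint (N.reach S v) (T.erase v) then F₀ else F₁)
      = (a + (N.dropProb T v * F₁ + (1 - N.dropProb T v) * F₀)) * N.Z T := by
  have h1 := N.Z_erase_add T v
  have h2 : N.mean (fun S => N.Rooted T S ∧ ¬ N.Rooted (T.erase v) S) 1
      = (1 - N.dropProb T v) * N.Z T := by
    rw [ENNReal.sub_mul fun _ _ => Z_ne_top T, one_mul, dropProb_mul v h0]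
    exact ENNReal.eq_sub_of_add_eq (Z_ne_top _) (by rw [add_comm, h1])
  rw [mean_rooted_ite, h2]
  rw [h2] at h1
  calc _ = a * (N.Z (T.erase v) + (1 - N.dropProb T v) * N.Z T) + (N.Z (T.erase v) * F₁
        + (1 - N.dropProb T v) * N.Z T * F₀) := by ring
    _ = _ := by rw [h1, ← dropProb_mul v h0]; ring

/-! ### Bounds on ratios of connection probabilities -/

variable (N) in
/-- The involution `rev` pairs every arc with an anti-parallel arc of the same probabilities. -/
structure IsReversal (rev : A → A) : Prop where
  invol : Function.Involutive rev
  tail_rev : ∀ e, N.tail (rev e) = N.head e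
  p_rev : ∀ e, N.p (rev e) = N.p e
  q_rev : ∀ e, N.q (rev e) = N.q e

theorem IsReversal.head_rev {rev : A → A} (h : N.IsReversal rev) (e : A) :
    N.head (rev e) = N.tail e := by rw [← h.tail_rev, h.invol]

variable (N) in
/-- Reversal of the arcs inside `W`. -/
def flipArc (rev : A → A) (W : Finset V) (e : A) : A :=
  if N.tail e ∈ W ∧ N.head e ∈ W then rev e else e

variable (N) in
/-- The outcome `S` with the arcs inside `W` reversed. -/
def flip (rev : A → A) (W : Finset V) (S : Finset A) : Finset A := {e | N.flipArc rev W e ∈ S}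

theorem IsReversal.flipArc_invol {rev : A → A} (h : N.IsReversal rev) (W : Finset V) :
    Function.Involutive (N.flipArc rev W) := by
  intro e
  by_cases he : N.tail e ∈ W ∧ N.head e ∈ W
  · simp [flipArc, he, h.tail_rev, h.head_rev, h.invol e]
  · simp [flipArc, he]

theorem mem_flip {rev : A → A} {W : Finset V} {S : Finset A} {e : A} :
    e ∈ N.flip rev W S ↔ N.flipArc rev W e ∈ S := by simp [flip]

theorem IsReversal.flip_flip {rev : A → A} (h : N.IsReversal rev) (W : Finset V)
    (S : Finset A) : N.flip rev W (N.flip rev W S) = S := by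
  ext e
  simp [mem_flip, h.flipArc_invol W e]

theorem IsReversal.pr_flip {rev : A → A} (h : N.IsReversal rev) (W : Finset V)
    (S : Finset A) : N.pr (N.flip rev W S) = N.pr S := by
  rw [pr, pr, ← Equiv.prod_comp (h.flipArc_invol W).toPerm]
  refine prod_congr rfl fun e _ => ?_
  simp only [mem_flip, Function.Involutive.coe_toPerm, h.flipArc_invol W e]
  by_cases he : N.tail e ∈ W ∧ N.head e ∈ W <;> simp [flipArc, he, h.p_rev, h.q_rev]

theorem mem_flip_of_tail_notMem {rev : A → A} {W : Finset V} {S : Finset A} {e : A}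
    (he : N.tail e ∉ W) : e ∈ N.flip rev W S ↔ e ∈ S := by simp [mem_flip, flipArc, he]

/-- Reversing the arcs inside the set of vertices reached by `u` reverses the paths inside it. -/
theorem IsReversal.reaches_flip {rev : A → A} (h : N.IsReversal rev) {S : Finset A} {u y z : V}
    (hy : N.Reaches S u y) (hyz : N.Reaches S y z) :
    N.Reaches (N.flip rev (N.reach S u) S) z y := by
  induction hyz with
  | refl => exact ReflTransGen.refl
  | tail hb hbc ih =>
    obtain ⟨e, he, rfl, rfl⟩ := hbc
    refine ReflTransGen.head ⟨rev e, ?_, h.tail_rev e, h.head_rev e⟩ ih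
    have h1 : N.Reaches S u (N.tail e) := hy.trans hb
    have h2 : N.Reaches S u (N.head e) := h1.trans (Reaches.arc he)
    simp [mem_flip, flipArc, h.tail_rev, h.head_rev, h1, h2, h.invol e, he]

/-- If `u` reaches `w` and everything that `u` reaches also reaches `w`, then after the reversal
`w` reaches exactly these vertices. -/
theorem IsReversal.reach_flip {rev : A → A} (h : N.IsReversal rev) {S : Finset A} {u w : V}
    (hw : ∀ y, N.Reaches S u y → N.Reaches S y w) :
    N.reach (N.flip rev (N.reach S u) S) w = N.reach S u := by
  have huw := hw u ReflTransGen.refl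
  ext y
  simp only [mem_reach]
  constructor
  · intro hy
    induction hy with
    | refl => exact huw
    | tail _ hbc ih =>
      obtain ⟨e, he, rfl, rfl⟩ := hbc
      by_contra hh
      have : e ∈ S := by simpa [mem_flip, flipArc, hh] using he
      exact hh (ih.trans (Reaches.arc this))
  · intro hy
    exact h.reaches_flip hy (hw y hy)

theorem pr_le_mul_pr_insert {K : ℝ≥0∞} (hK : ∀ e, N.p e ≤ K * N.q e) {e : A} {X : Finset A}
    (he : e ∉ X) : N.pr X ≤ K * N.pr (insert e X) := by
  obtain ⟨r, h1, h2⟩ := N.exists_pr_eq e X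
  rw [erase_eq_of_notMem he] at h2
  rw [h1, h2, ← mul_assoc]
  gcongr
  exact hK e

/-- Adding one root changes the connection probability by a bounded factor. An outcome `S` in
which everything reaches `R ∪ {w}` but not `R` is repaired by an arc `e` that leads out of the set
of vertices not reaching `R`, after the arcs among the vertices that the tail of `e` reaches have
been reversed. Given `e` and `w`, the outcome `S` can be recovered
from the repaired one. -/
theorem IsReversal.Z_insert_le {rev : A → A} (h : N.IsReversal rev) {K : ℝ≥0∞}
    (hK : ∀ e, N.p e ≤ K * N.q e) {R : Finset V} (hR : N.Rooted R univ) (w : V) :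
    N.Z (insert w R) ≤ (1 + Fintype.card A * K) * N.Z R := by
  classical
  -- `u` does not reach the root set
  let D : Finset A → V → Prop := fun S u => ∀ y ∈ R, ¬ N.Reaches S u y
  let bad : A → Finset A → Prop := fun e S =>
    N.Rooted (insert w R) S ∧ D S (N.tail e) ∧ ¬ D S (N.head e)
  have hD : ∀ {S u y}, D S u → N.Reaches S u y → D S y := fun hu hy z hz hyz =>
    hu z hz (hy.trans hyz)
  have hcross : ∀ S, ¬ N.Rooted R S → ∃ e, D S (N.tail e) ∧ ¬ D S (N.head e) := by
    intro S hS
    obtain ⟨v, hv⟩ : ∃ v, D S v := by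
      by_contra hcon
      refine hS fun v => ?_
      by_contra hv
      exact hcon ⟨v, fun y hy hvy => hv ⟨y, hy, hvy⟩⟩
    obtain ⟨r, hr, hvr⟩ := hR v
    induction hvr using ReflTransGen.head_induction_on with
    | refl => exact absurd ReflTransGen.refl (hv r hr)
    | head hac _ ih =>
      obtain ⟨e, -, rfl, rfl⟩ := hac
      by_cases hh : D S (N.head e)
      · exact ih hh
      · exact ⟨e, hv, hh⟩
  let fix : A → Finset A → Finset A := fun e S =>
    N.flip rev (N.reach S (N.tail e)) S
  have hbad : ∀ e S, bad e S → e ∉ S ∧ e ∉ fix e S ∧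
      (∀ y, N.Reaches S (N.tail e) y → N.Reaches S y w) ∧ N.Rooted R (insert e (fix e S)) := by
    rintro e S ⟨hS, ht, hh⟩
    have heS : e ∉ S := fun he => hh (hD ht (Reaches.arc he))
    have hhW : ¬ N.Reaches S (N.tail e) (N.head e) := fun h' => hh (hD ht h')
    have hmono : ∀ {u v}, N.Reaches (fix e S) u v → N.Reaches (insert e (fix e S)) u v :=
      fun h' => ReflTransGen.mono
        (fun a b ⟨c, hc, h1⟩ => ⟨c, mem_insert_of_mem hc, h1⟩) _ _ h'
    have hyw : ∀ y, N.Reaches S (N.tail e) y → N.Reaches S y w := by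
      intro y hy
      obtain ⟨z, hz, hyz⟩ := hS y
      rcases mem_insert.1 hz with rfl | hz
      · exact hyz
      · exact absurd hyz (hD ht hy z hz)
    have hA : ∀ {v}, ¬ D S v → ∃ r ∈ R, N.Reaches (insert e (fix e S)) v r := by
      intro v hv
      simp only [D, not_forall, not_not] at hv
      obtain ⟨r, hr, hvr⟩ := hv
      refine ⟨r, hr, hmono ?_⟩
      induction hvr using ReflTransGen.head_induction_on with
      | refl => exact ReflTransGen.refl
      | head hac hcr ih =>
        obtain ⟨a, ha, rfl, rfl⟩ := hac
        refine (Reaches.arc ?_).trans ih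
        rw [mem_flip_of_tail_notMem]
        · exact ha
        · rw [mem_reach]
          exact fun hW => hD ht hW r hr ((Reaches.arc ha).trans hcr)
    have hW : ∀ {v}, N.Reaches S (N.tail e) v → ∃ r ∈ R, N.Reaches (insert e (fix e S)) v r := by
      intro v hv
      obtain ⟨r, hr, h'⟩ := hA hh
      exact ⟨r, hr, (hmono (h.reaches_flip ReflTransGen.refl hv)).trans
        ((Reaches.arc (mem_insert_self e _)).trans h')⟩
    refine ⟨heS, by simpa [fix, mem_flip, flipArc, hhW] using heS, hyw, fun v => ?_⟩
    by_cases hv : D S v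
    · obtain ⟨z, hz, hvz⟩ := hS v
      rcases mem_insert.1 hz with rfl | hz
      · -- follow the path from `v` until it enters the reversed part
        induction hvz using ReflTransGen.head_induction_on with
        | refl => exact hW (hyw _ ReflTransGen.refl)
        | head hac _ ih =>
          obtain ⟨a, ha, rfl, rfl⟩ := hac
          by_cases haW : N.Reaches S (N.tail e) (N.tail a)
          · exact hW haW
          · obtain ⟨r, hr, h'⟩ := ih (hD hv (Reaches.arc ha))
            refine ⟨r, hr, (Reaches.arc (mem_insert_of_mem ?_)).trans h'⟩
            rw [mem_flip_of_tail_notMem]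
            · exact ha
            · rwa [mem_reach]
      · exact absurd hvz (hv z hz)
    · exact hA hv
  have hinj : ∀ e S S', bad e S → bad e S' → insert e (fix e S) = insert e (fix e S') →
      S = S' := by
    intro e S S' hS hS' heq
    obtain ⟨-, h1, h2, -⟩ := hbad e S hS
    obtain ⟨-, h1', h2', -⟩ := hbad e S' hS'
    have hfix : fix e S = fix e S' := by
      rw [← erase_insert h1, heq, erase_insert h1']
    have hreach : N.reach S (N.tail e) = N.reach S' (N.tail e) := by
      rw [← h.reach_flip h2, ← h.reach_flip h2']
      exact congrArg (fun X => N.reach X w) hfix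
    rw [← h.flip_flip (N.reach S (N.tail e)) S, ← h.flip_flip (N.reach S' (N.tail e)) S']
    change N.flip rev _ (fix e S) = N.flip rev _ (fix e S')
    rw [hfix, hreach]
  have hsum : ∀ e, ∑ S with bad e S, N.pr S ≤ K * N.Z R := by
    intro e
    calc ∑ S with bad e S, N.pr S ≤ ∑ S with bad e S, K * N.pr (insert e (fix e S)) := by
          refine sum_le_sum fun S hS => ?_
          obtain ⟨-, h1, -, -⟩ := hbad e S (mem_filter.1 hS).2
          calc N.pr S = N.pr (fix e S) := (h.pr_flip _ S).symm
            _ ≤ _ := pr_le_mul_pr_insert hK h1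
      _ = K * ∑ X ∈ (univ.filter (bad e)).image fun S => insert e (fix e S), N.pr X := by
          rw [← mul_sum, sum_image]
          intro S hS S' hS' heq
          exact hinj e S S' (by simpa using hS) (by simpa using hS') heq
      _ ≤ K * ∑ X with N.Rooted R X, N.pr X := by
          gcongr
          refine fun X hX => ?_
          obtain ⟨S, hS, rfl⟩ := mem_image.1 hX
          exact mem_filter.2 ⟨mem_univ _, (hbad e S (mem_filter.1 hS).2).2.2.2⟩
      _ = _ := by simp [Z, mean, sum_filter]
  calc N.Z (insert w R) ≤ N.Z R + ∑ e, ∑ S with bad e S, N.pr S := by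
        simp only [Z, mean, sum_filter]
        rw [sum_comm, ← sum_add_distrib]
        refine sum_le_sum fun S _ => ?_
        by_cases hS : N.Rooted (insert w R) S
        · by_cases hS' : N.Rooted R S
          · simp [hS, hS']
          · obtain ⟨e, he⟩ := hcross S hS'
            simp only [hS, if_true, hS', if_false, zero_add, Pi.one_apply, mul_one]
            exact le_trans (by simp [bad, hS, he]) (single_le_sum
              (f := fun e => if bad e S then N.pr S else 0) (fun _ _ => zero_le) (mem_univ e))
        · simp [hS]
    _ ≤ N.Z R + ∑ _e : A, K * N.Z R := by gcongr with e; exact hsum e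
    _ = _ := by simp; ring

/-- A bound for the potential that governs the number of iterations of cluster popping. -/
theorem IsReversal.sum_Z_insert_le {rev : A → A} (h : N.IsReversal rev) {K : ℝ≥0∞}
    (hK : ∀ e, N.p e ≤ K * N.q e) {R : Finset V} (hR : N.Rooted R univ) :
    ∑ w ∈ Rᶜ, N.Z (insert w R)
      ≤ Fintype.card V * (1 + Fintype.card A * K) * N.Z R := by
  calc _ ≤ ∑ _w : V, (1 + Fintype.card A * K) * N.Z R :=
        (sum_le_sum fun w _ => h.Z_insert_le hK hR w).trans
          (sum_le_sum_of_subset (subset_univ _))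
    _ = _ := by simp; ring

/-- A root with an arc to another root can be dropped at the cost of the survival probability of
that arc. -/
theorem q_mul_Z_le_Z_erase {T : Finset V} {e : A}
    (hh : N.head e ∈ T.erase (N.tail e)) : N.q e * N.Z T ≤ N.Z (T.erase (N.tail e)) := by
  classical
  have hZ : ∀ R, N.Z R = ∑ S, N.pr S * if N.Rooted R S then 1 else 0 := fun R => by
    simp [Z, mean]
  rw [hZ, hZ, sum_pr_mul_eq e (fun S => if N.Rooted (T.erase _) S then 1 else 0), mul_sum]
  refine sum_le_sum fun S _ => ?_
  by_cases hS : N.Rooted T S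
  · have hS' : N.Rooted T (insert e S) := hS.congr fun a ha _ => mem_insert_of_mem ha
    have : N.Rooted (T.erase (N.tail e)) (insert e S) := by
      rw [rooted_erase_iff hS', not_disjoint_iff]
      exact ⟨_, mem_reach.2 (Reaches.arc (mem_insert_self e S)), hh⟩
    simp only [hS, this, if_true, mul_one, mul_add]
    rw [mul_comm]
    exact le_add_self
  · simp [hS]

end FailNet

/-! ### The program -/

/-! Registers: `0`–`4` input; `5` the constant `1`; `6` the constant `0`; `7` a bound `K` for the
numbers `1 / (1 - p e)`; `8` the rounded-up inverse of the accuracy; `9` the number of samples per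
level; `10`, `11` numerator and denominator of the estimate; `12`, `13` the current level and its
vertex; `14` the number of successful samples; `15` the sample counter; `16` the start vertex of a
search; `17` the outcome of an attempt; `18` a loop counter; `19`, `20` the ends of the search queue;
`21`–`25` scratch; `26`, `27` the level counter and its bound.

Arrays: `0`–`3` input; `4` and `5` the lists of the arcs out of a vertex; `6` the failed arcs; `7` the
vertices found by the last search; `8` the search queue; `9` the current roots; `10` the target
roots; `11` the order in which the vertices are made non-roots. -/

namespace Prog

/-- Linked lists of the arcs out of each vertex, with arc numbers shifted by one. -/
def buildLists : Cmd :=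
  forLoop 18 1 (.block [.load 21 0 18, .load 22 4 21, .store 5 18 22, .add 23 18 5, .store 4 21 23])

/-- `R x := ⌈R a / R d⌉`, by repeated addition. -/
def divCeil (x a d : ℕ) : Cmd :=
  .seq (.block [.const 23 0, .const x 0]) (.loop 23 a (.block [.add 23 23 d, .add x x 5]))

/-- `R x := R y * R z`, by repeated addition. -/
def mul (x y z : ℕ) : Cmd :=
  .seq (.block [.const 23 0]) (.seq (forLoop 24 z (.block [.add 23 23 y])) (.block [.add x 23 6]))

/-- `R 7 := max 1 (max_e ⌈1 / (1 - p e)⌉)`. -/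
def oddsBound : Cmd :=
  .seq (.block [.const 7 1]) (forLoop 18 1
    (.seq (.block [.load 21 3 18, .load 22 2 18, .sub 22 21 22])
      (.seq (divCeil 25 21 22) (.branch 7 25 (.block [.add 7 25 6]) .skip))))

/-- The inspection of the arc `R 22 - 1`, out of a vertex that has been found. -/
def scanArc : Cmd :=
  .seq (.block [.sub 22 22 5, .load 23 6 22])
    (.seq (.branch 23 5
      (.seq (.block [.load 23 1 22, .load 24 7 23])
        (.branch 24 5 (.block [.store 7 23 5, .store 8 20 23, .add 20 20 5]) .skip)) .skip)
    (.block [.load 22 5 22]))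

/-- Removal of the first vertex from the search queue, and inspection of the arcs out of it. -/
def scanVertex : Cmd :=
  .seq (.block [.load 21 8 19, .add 19 19 5, .load 22 4 21]) (.loop 6 22 scanArc)

/-- Breadth-first search along surviving arcs from vertex `R 16`. -/
def search : Cmd :=
  .seq (forLoop 18 0 (.block [.store 7 18 6]))
    (.seq (.block [.store 7 16 5, .store 8 6 16, .const 19 0, .const 20 1])
      (.loop 19 20 scanVertex))

/-- A fresh sample of the arcs out of the vertices in array `7`. -/
def resample : Cmd :=
  forLoop 18 1 (.seq (.block [.load 21 0 18, .load 22 7 21])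
    (.branch 6 22 (.seq (.block [.load 23 2 18, .load 24 3 18])
      (.seq (.coin 23 23 24) (.block [.store 6 18 23]))) .skip))

/-- `R 16` becomes the last root that is not a target root, or `n` if there is none. -/
def pick : Cmd :=
  .seq (.block [.add 16 0 6]) (forLoop 18 0 (.seq (.block [.load 21 9 18, .load 22 10 18])
    (.branch 22 21 (.block [.add 16 18 6]) .skip)))

/-- Vertex `R 16` is dropped from the roots, and `R 17` tells if it reaches another root. -/
def attempt : Cmd :=
  .seq (.block [.store 9 16 6]) (.seq search (.seq (.block [.const 17 0])
    (forLoop 18 0 (.seq (.block [.load 21 7 18, .load 22 9 18])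
      (.branch 6 21 (.branch 6 22 (.block [.add 17 5 6]) .skip) .skip)))))

/-- One iteration of cluster popping. -/
def popStep : Cmd :=
  .seq attempt (.branch 17 5 (.seq resample (forLoop 18 0 (.seq (.block [.load 21 7 18])
    (.branch 6 21 (.block [.store 9 18 5]) .skip)))) .skip)

/-- Cluster popping towards the target roots. -/
def popping : Cmd :=
  .seq (forLoop 18 0 (.block [.store 7 18 5, .store 9 18 5]))
    (.seq resample (.seq pick (.loop 16 0 (.seq popStep pick))))

/-- One sample, and the test whether vertex `R 13` reaches another target root. -/
def trial : Cmd :=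
  .seq popping (.seq (.block [.add 16 13 6]) (.seq attempt (.block [.add 14 14 17])))

/-- One factor of the product estimator. -/
def level : Cmd :=
  .seq (.block [.sub 12 27 26, .load 13 11 12, .const 14 0])
    (.seq (forLoop 15 9 trial)
      (.seq (.block [.store 10 13 6]) (.seq (mul 10 10 14) (mul 11 11 9))))

/-- The computation of the number `8 n k² K` of samples per level. -/
def sampleCount : Cmd :=
  .seq oddsBound (.seq (divCeil 8 4 3) (.seq (.block [.const 9 8]) (.seq (mul 9 9 0)
    (.seq (mul 9 9 8) (.seq (mul 9 9 8) (mul 9 9 7))))))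

/-- The product estimator, for a graph in which the root is connected with every vertex. -/
def estimate : Cmd :=
  .seq (forLoop 18 0 (.block [.load 21 8 18, .store 11 18 21, .store 10 18 5]))
    (.seq (.block [.const 10 1, .const 11 1, .sub 27 0 5])
      (.seq (forLoop 26 27 level) (.block [.add 0 10 6, .add 1 11 6])))

/-- The approximation algorithm for reachability in bi-directed graphs. -/
def main : Cmd :=
  .seq (.block [.const 5 1]) (.seq buildLists (.seq sampleCount (.seq (.block [.add 16 2 6])
    (.seq search (.branch 20 0 (.block [.const 0 0, .const 1 1]) estimate)))))

end Prog

/-! ### Representation of graphs and sets in memory -/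

namespace ReachInstance

variable (G : ReachInstance)

/-- The graph with its failure probabilities as extended nonnegative reals. -/
def net : FailNet (Fin G.n) (Fin G.m) where
  tail := G.tail
  head := G.head
  p e := ENNReal.ofReal (G.p e)
  q e := ENNReal.ofReal (1 - G.p e)
  p_add_q e := by
    rw [← ENNReal.ofReal_add]
    · simp
    · exact_mod_cast (G.p_pos e).le
    · have : (G.p e : ℝ) < 1 := by exact_mod_cast G.p_lt_one e
      linarith

/-- One plus the number of the last arc out of `u` among the first `j` arcs, or `0`. -/
def lastArc (u : Fin G.n) : ℕ → ℕ
  | 0 => 0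
  | j + 1 => if ∃ h : j < G.m, G.tail ⟨j, h⟩ = u then j + 1 else lastArc u j

/-- The number of arcs out of `u` among the first `j` arcs. -/
def outCount (u : Fin G.n) (j : ℕ) : ℕ :=
  (Finset.univ.filter fun e : Fin G.m => (e : ℕ) < j ∧ G.tail e = u).card

variable {G}

theorem lastArc_eq_zero {u : Fin G.n} {j : ℕ} (h : G.lastArc u j = 0) (e : Fin G.m)
    (he : (e : ℕ) < j) : G.tail e ≠ u := by
  induction j with
  | zero => omega
  | succ j ih =>
    rw [lastArc] at h
    split at h
    · omega
    · rename_i hj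
      by_cases hej : (e : ℕ) = j
      · subst hej
        exact fun h' => hj ⟨e.2, h'⟩
      · exact ih h (by omega)

/-- A nonzero list entry points to an arc out of `u`, and no arc out of `u` is skipped. -/
theorem lastArc_eq_succ {u : Fin G.n} {j i : ℕ} (h : G.lastArc u j = i + 1) :
    ∃ hi : i < G.m, i < j ∧ G.tail ⟨i, hi⟩ = u ∧
      ∀ e : Fin G.m, i < e → (e : ℕ) < j → G.tail e ≠ u := by
  induction j with
  | zero => simp [lastArc] at h
  | succ j ih =>
    rw [lastArc] at h
    split at h
    · rename_i hj
      obtain rfl : j = i := by omega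
      obtain ⟨h1, h2⟩ := hj
      exact ⟨h1, by omega, h2, fun e h3 h4 => by omega⟩
    · rename_i hj
      obtain ⟨h1, h2, h3, h4⟩ := ih h
      refine ⟨h1, by omega, h3, fun e h5 h6 => ?_⟩
      by_cases hej : (e : ℕ) = j
      · subst hej
        exact fun h' => hj ⟨e.2, h'⟩
      · exact h4 e h5 (by omega)

theorem outCount_lt {u : Fin G.n} {e : Fin G.m} {j : ℕ} (he : (e : ℕ) < j) (hu : G.tail e = u) :
    G.outCount u e + 1 ≤ G.outCount u j := by
  rw [outCount, outCount, Nat.succ_le_iff]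
  refine Finset.card_lt_card ⟨fun a ha => ?_, fun h => ?_⟩
  · simp only [Finset.mem_filter, Finset.mem_univ, true_and] at ha ⊢
    exact ⟨by omega, ha.2⟩
  · have := h (show e ∈ _ by simp [he, hu])
    simp at this

variable (G) in
/-- The memory holds the graph, its arc lists, and the constants `0` and `1`. -/
structure Loaded (σ : Mem) : Prop where
  n_eq : σ.reg 0 = G.n
  m_eq : σ.reg 1 = G.m
  one_eq : σ.reg 5 = 1
  zero_eq : σ.reg 6 = 0
  tail_eq : ∀ e : Fin G.m, σ.arr 0 e = G.tail e
  head_eq : ∀ e : Fin G.m, σ.arr 1 e = G.head e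
  num_eq : ∀ e : Fin G.m, σ.arr 2 e = (G.p e).num.toNat
  den_eq : ∀ e : Fin G.m, σ.arr 3 e = (G.p e).den
  first_eq : ∀ u : Fin G.n, σ.arr 4 u = G.lastArc u G.m
  next_eq : ∀ e : Fin G.m, σ.arr 5 e = G.lastArc (G.tail e) e

theorem Loaded.agree {σ τ : Mem} {R A : List ℕ} (h : G.Loaded σ) (hA : Agree R A σ τ)
    (hR : ∀ r ∈ [0, 1, 5, 6], r ∉ R) (hA' : ∀ a ∈ [0, 1, 2, 3, 4, 5], a ∉ A) : G.Loaded τ := by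
  have e0 := hA.1 0 (hR 0 (by simp))
  have e1 := hA.1 1 (hR 1 (by simp))
  have e5 := hA.1 5 (hR 5 (by simp))
  have e6 := hA.1 6 (hR 6 (by simp))
  have a0 := hA.2 0 (hA' 0 (by simp))
  have a1 := hA.2 1 (hA' 1 (by simp))
  have a2 := hA.2 2 (hA' 2 (by simp))
  have a3 := hA.2 3 (hA' 3 (by simp))
  have a4 := hA.2 4 (hA' 4 (by simp))
  have a5 := hA.2 5 (hA' 5 (by simp))
  exact ⟨by rw [e0, h.n_eq], by rw [e1, h.m_eq], by rw [e5, h.one_eq], by rw [e6, h.zero_eq],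
    by rw [a0]; exact h.tail_eq, by rw [a1]; exact h.head_eq, by rw [a2]; exact h.num_eq,
    by rw [a3]; exact h.den_eq, by rw [a4]; exact h.first_eq, by rw [a5]; exact h.next_eq⟩

variable (G) in
/-- Array `a` holds the indicator function of the vertex set `M`. -/
def HoldsSet (a : ℕ) (M : Finset (Fin G.n)) (σ : Mem) : Prop :=
  ∀ u : Fin G.n, σ.arr a u = if u ∈ M then 1 else 0

variable (G) in
/-- Array `6` holds the indicator function of the arcs outside `S`, the set of surviving arcs. -/
def HoldsArcs (S : Finset (Fin G.m)) (σ : Mem) : Prop :=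
  ∀ e : Fin G.m, σ.arr 6 e = if e ∈ S then 0 else 1

theorem HoldsSet.agree {a : ℕ} {M : Finset (Fin G.n)} {σ τ : Mem} {R A : List ℕ}
    (h : G.HoldsSet a M σ) (hA : Agree R A σ τ) (ha : a ∉ A) : G.HoldsSet a M τ := by
  intro u
  rw [hA.2 a ha]
  exact h u

theorem HoldsArcs.agree {S : Finset (Fin G.m)} {σ τ : Mem} {R A : List ℕ}
    (h : G.HoldsArcs S σ) (hA : Agree R A σ τ) (ha : 6 ∉ A) : G.HoldsArcs S τ := by
  intro u
  rw [hA.2 6 ha]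
  exact h u

/-! ### Breadth-first search -/

variable (G) in
/-- The vertices `Q 0, …, Q (h - 1)` are distinct, the first is `x`, and each other one is entered
by an arc in `S` from an earlier one. -/
structure SearchOrder (S : Finset (Fin G.m)) (x : Fin G.n) (h : ℕ) (Q : ℕ → Fin G.n) : Prop where
  pos : 0 < h
  zero : Q 0 = x
  inj : ∀ i < h, ∀ j < h, Q i = Q j → i = j
  parent : ∀ j < h, 0 < j → ∃ i < j, ∃ e ∈ S, G.tail e = Q i ∧ G.head e = Q j

/-- A vertex entered from the queue and not yet found may be appended. -/
theorem SearchOrder.push {S : Finset (Fin G.m)} {x : Fin G.n} {h : ℕ} {Q : ℕ → Fin G.n}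
    (hQ : G.SearchOrder S x h Q) {i : ℕ} (hi : i < h) {e : Fin G.m} (he : e ∈ S)
    (ht : G.tail e = Q i) (hh : ∀ j < h, Q j ≠ G.head e) :
    G.SearchOrder S x (h + 1) (Function.update Q h (G.head e)) := by
  have hlt : ∀ j < h, Function.update Q h (G.head e) j = Q j := fun j hj =>
    Function.update_of_ne (by omega) _ _
  refine ⟨by omega, by rw [hlt 0 hQ.pos, hQ.zero], fun a ha b hb hab => ?_, fun j hj h0 => ?_⟩
  · rcases Nat.lt_succ_iff_lt_or_eq.1 ha with ha | rfl <;>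
      rcases Nat.lt_succ_iff_lt_or_eq.1 hb with hb | rfl
    · rw [hlt a ha, hlt b hb] at hab
      exact hQ.inj a ha b hb hab
    · rw [hlt a ha, Function.update_self] at hab
      exact absurd hab (hh a ha)
    · rw [hlt b hb, Function.update_self] at hab
      exact absurd hab.symm (hh b hb)
    · rfl
  · rcases Nat.lt_succ_iff_lt_or_eq.1 hj with hj | rfl
    · obtain ⟨i', hi', e', he', h1, h2⟩ := hQ.parent j hj h0
      exact ⟨i', hi', e', he', by rw [hlt i' (by omega), h1], by rw [hlt j hj, h2]⟩
    · exact ⟨i, hi, e, he, by rw [hlt i hi, ht], by rw [Function.update_self]⟩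

theorem SearchOrder.card {S : Finset (Fin G.m)} {x : Fin G.n} {h : ℕ} {Q : ℕ → Fin G.n}
    (hQ : G.SearchOrder S x h Q) : ((Finset.range h).image Q).card = h := by
  rw [Finset.card_image_of_injOn, Finset.card_range]
  intro a ha b hb
  exact hQ.inj a (by simpa using ha) b (by simpa using hb)

theorem SearchOrder.le {S : Finset (Fin G.m)} {x : Fin G.n} {h : ℕ} {Q : ℕ → Fin G.n}
    (hQ : G.SearchOrder S x h Q) : h ≤ G.n := by
  rw [← hQ.card]
  simpa using Finset.card_le_univ ((Finset.range h).image Q)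

theorem SearchOrder.reaches {S : Finset (Fin G.m)} {x : Fin G.n} {h : ℕ} {Q : ℕ → Fin G.n}
    (hQ : G.SearchOrder S x h Q) (j : ℕ) (hj : j < h) : G.net.Reaches S x (Q j) := by
  induction j using Nat.strong_induction_on with
  | _ j ih =>
    rcases Nat.eq_zero_or_pos j with rfl | h0
    · rw [hQ.zero]
      exact Relation.ReflTransGen.refl
    · obtain ⟨i, hi, e, he, h1, h2⟩ := hQ.parent j hj h0
      exact (ih i hi (by omega)).tail ⟨e, he, h1, h2⟩

/-- A search whose set of vertices is closed under surviving arcs is complete. -/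
theorem SearchOrder.image_eq_reach {S : Finset (Fin G.m)} {x : Fin G.n} {h : ℕ}
    {Q : ℕ → Fin G.n} (hQ : G.SearchOrder S x h Q)
    (hcl : ∀ e ∈ S, G.tail e ∈ (Finset.range h).image Q → G.head e ∈ (Finset.range h).image Q) :
    (Finset.range h).image Q = G.net.reach S x := by
  ext y
  rw [FailNet.mem_reach]
  constructor
  · intro hy
    obtain ⟨j, hj, rfl⟩ := Finset.mem_image.1 hy
    exact hQ.reaches j (by simpa using hj)
  · intro hy
    refine (hy.congr_of_closed (S' := S) ?_ hcl fun e he _ => he).2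
    exact Finset.mem_image.2 ⟨0, by simpa using hQ.pos, hQ.zero⟩

variable (G) in
/-- The state of a search from `x`: the queue holds `Q 0, …, Q (h - 1)`, and the heads of the
surviving arcs in `D` have been found. -/
structure Searching (S : Finset (Fin G.m)) (x : Fin G.n) (D : Fin G.m → Prop) (h : ℕ)
    (Q : ℕ → Fin G.n) (σ : Mem) : Prop where
  loaded : G.Loaded σ
  arcs : G.HoldsArcs S σ
  order : G.SearchOrder S x h Q
  found : G.HoldsSet 7 ((Finset.range h).image Q) σ
  queue : ∀ i < h, σ.arr 8 i = Q i
  reg_eq : σ.reg 20 = h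
  done : ∀ e ∈ S, D e → G.head e ∈ (Finset.range h).image Q

theorem Searching.agree {S : Finset (Fin G.m)} {x : Fin G.n} {D : Fin G.m → Prop} {h : ℕ}
    {Q : ℕ → Fin G.n} {σ τ : Mem} {R A : List ℕ} (hs : G.Searching S x D h Q σ)
    (hA : Agree R A σ τ) (hR : ∀ r ∈ [0, 1, 5, 6, 20], r ∉ R)
    (hA' : ∀ a ∈ [0, 1, 2, 3, 4, 5, 6, 7, 8], a ∉ A) : G.Searching S x D h Q τ := by
  refine ⟨hs.loaded.agree hA (fun r hr => hR r (by simp at hr ⊢; omega))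
    (fun a ha => hA' a (by simp at ha ⊢; omega)), hs.arcs.agree hA (hA' 6 (by simp)), hs.order,
    hs.found.agree hA (hA' 7 (by simp)), ?_, ?_, hs.done⟩
  · rw [hA.2 8 (hA' 8 (by simp))]
    exact hs.queue
  · rw [hA.1 20 (hR 20 (by simp)), hs.reg_eq]

theorem scanArc_runs {S : Finset (Fin G.m)} {x : Fin G.n} {D : Fin G.m → Prop} {h : ℕ}
    {Q : ℕ → Fin G.n} {σ : Mem} (hs : G.Searching S x D h Q σ) (e : Fin G.m)
    (he : σ.reg 22 = e + 1) {i : ℕ} (hi : i < h) (ht : G.tail e = Q i) :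
    Runs Prog.scanArc σ 30 fun τ => (∃ h' Q', h ≤ h' ∧ (∀ j < h, Q' j = Q j) ∧
      G.Searching S x (fun a => D a ∨ a = e) h' Q' τ) ∧
      τ.reg 22 = G.lastArc (G.tail e) e := by
  have h0 := hs.loaded
  have hn : ∀ τ : Mem, G.Loaded τ → τ.reg 22 = e →
      Runs (.block [.load 22 5 22]) τ 3 fun ρ => ρ = τ.setReg 22 (G.lastArc (G.tail e) e) := by
    intro τ hτ h22
    refine Runs.block rfl ?_
    simp [exec, Cmd.det, h22, hτ.next_eq]
  have hag : ∀ (τ : Mem) (v : ℕ), Agree [22] [] τ (τ.setReg 22 v) := fun τ v => agree_setReg _ _ _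
  refine (Runs.block_seq rfl (Runs.seq (T₁ := 16) (P := fun τ => (∃ h' Q', h ≤ h' ∧
    (∀ j < h, Q' j = Q j) ∧ G.Searching S x (fun a => D a ∨ a = e) h' Q' τ) ∧ τ.reg 22 = e)
    (T₂ := 3) ?_ ?_)).conseq (by simp) fun _ h => h
  · set σ₁ := exec [.sub 22 22 5, .load 23 6 22] σ with hσ₁
    have hreg22 : σ₁.reg 22 = e := by simp [hσ₁, exec, Cmd.det, he, h0.one_eq]
    have hreg23 : σ₁.reg 23 = if e ∈ S then 0 else 1 := by
      simp [hσ₁, exec, Cmd.det, he, h0.one_eq, hs.arcs e]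
    have hs₁ := hs.agree (agree_exec [.sub 22 22 5, .load 23 6 22] σ) (by decide) (by decide)
    rw [← hσ₁] at hs₁
    refine (Runs.branch (T := 15) (fun hlt => ?_) fun hlt => ?_)
    · have heS : e ∈ S := by
        by_contra hcon
        rw [hreg23, hs₁.loaded.one_eq, if_neg hcon] at hlt
        omega
      refine (Runs.block_seq (T := 9) rfl ?_).conseq (by simp) fun _ h => h
      set σ₂ := exec [.load 23 1 22, .load 24 7 23] σ₁ with hσ₂
      have hreg22' : σ₂.reg 22 = e := by simp [hσ₂, exec, Cmd.det, hreg22]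
      have hreg23' : σ₂.reg 23 = G.head e := by
        simp [hσ₂, exec, Cmd.det, hreg22, hs₁.loaded.head_eq]
      have hreg24 : σ₂.reg 24 = if G.head e ∈ (Finset.range h).image Q then 1 else 0 := by
        rw [← hs₁.found (G.head e)]
        simp [hσ₂, exec, Cmd.det, hreg22, hs₁.loaded.head_eq]
      have hs₂ := hs₁.agree (agree_exec [.load 23 1 22, .load 24 7 23] σ₁) (by decide) (by decide)
      rw [← hσ₂] at hs₂
      have h1 := hs₂.loaded.one_eq
      refine (Runs.branch (T := 8) (fun hlt' => ?_) fun hlt' => ?_)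
      · have hnew : G.head e ∉ (Finset.range h).image Q := by
          intro hcon
          rw [hreg24, h1, if_pos hcon] at hlt'
          omega
        have hne : ∀ j < h, Q j ≠ G.head e := fun j hj hj' =>
          hnew (Finset.mem_image.2 ⟨j, by simpa using hj, hj'⟩)
        have himg : (Finset.range (h + 1)).image (Function.update Q h (G.head e))
            = insert (G.head e) ((Finset.range h).image Q) := by
          rw [Finset.range_add_one, Finset.image_insert, Function.update_self]
          congr 1
          refine Finset.image_congr fun j hj => Function.update_of_ne ?_ _ _
          simp at hj
          omega
        refine (Runs.block rfl ?_).conseq (by simp) fun _ h => h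
        refine ⟨⟨h + 1, Function.update Q h (G.head e), by omega,
          fun j hj => Function.update_of_ne (by omega) _ _,
          ⟨?_, ?_, hs.order.push hi heS ht hne, ?_, ?_, ?_, ?_⟩⟩, ?_⟩
        · exact hs₂.loaded.agree (agree_exec _ _) (by decide) (by decide)
        · intro a
          simpa [exec, Cmd.det] using hs₂.arcs a
        · intro u
          rw [himg]
          have := hs₂.found u
          by_cases hu : u = G.head e
          · simp [exec, Cmd.det, hreg23', h1, hu]
          · have hu' : (u : ℕ) ≠ G.head e := fun h' => hu (Fin.ext h')
            simp only [exec, Cmd.det, arr_setArr, arr_setReg, reg_setArr, hreg23', h1,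
              Finset.mem_insert, hu, hu', false_or]
            simpa using this
        · intro j hj
          rcases Nat.lt_succ_iff_lt_or_eq.1 hj with hj | rfl
          · have hjh : j ≠ h := by omega
            simp [exec, Cmd.det, hs₂.reg_eq, hjh, hs₂.queue j hj, Function.update_of_ne]
          · simp [exec, Cmd.det, hs₂.reg_eq, hreg23']
        · simp [exec, Cmd.det, hs₂.reg_eq, h1]
        · intro a ha hD
          rw [himg]
          rcases hD with hD | rfl
          · exact Finset.mem_insert_of_mem (hs.done a ha hD)
          · exact Finset.mem_insert_self _ _
        · simp [exec, Cmd.det, hreg22']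
      · have hold : G.head e ∈ (Finset.range h).image Q := by
          by_contra hcon
          rw [hreg24, h1, if_neg hcon] at hlt'
          omega
        refine (Runs.skip ?_).conseq (by omega) fun _ h => h
        refine ⟨⟨h, Q, le_rfl, fun _ _ => rfl, { hs₂ with done := ?_ }⟩, hreg22'⟩
        rintro a ha (hD | rfl)
        · exact hs.done a ha hD
        · exact hold
    · have heS : e ∉ S := by
        intro hcon
        rw [hreg23, hs₁.loaded.one_eq, if_pos hcon] at hlt
        omega
      refine (Runs.skip ?_).conseq (by omega) fun _ h => h
      refine ⟨⟨h, Q, le_rfl, fun _ _ => rfl, { hs₁ with done := ?_ }⟩, hreg22⟩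
      rintro a ha (hD | rfl)
      · exact hs.done a ha hD
      · exact absurd ha heS
  · rintro τ ⟨⟨h', Q', hle, hQ', hs'⟩, h22⟩
    refine (hn τ hs'.loaded h22).conseq le_rfl ?_
    rintro ρ rfl
    refine ⟨⟨h', Q', hle, hQ', hs'.agree (hag τ _) (by decide) (by decide)⟩, by simp⟩

/-- The inspection of the arcs out of the vertex `Q l`, from position `j` of its arc list on. -/
theorem scanArc_loop_runs {S : Finset (Fin G.m)} {x : Fin G.n} {D : Fin G.m → Prop} {l h₀ : ℕ}
    {Q₀ : ℕ → Fin G.n} (hl : l < h₀) : ∀ (b : ℕ) (σ : Mem),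
    (∃ j h Q, b = 32 * G.outCount (Q₀ l) j + 1 ∧ σ.reg 22 = G.lastArc (Q₀ l) j ∧ h₀ ≤ h ∧
      (∀ i < h₀, Q i = Q₀ i) ∧
      G.Searching S x (fun a => D a ∨ (G.tail a = Q₀ l ∧ j ≤ a)) h Q σ) →
    Runs (.loop 6 22 Prog.scanArc) σ b fun τ => ∃ h Q, h₀ ≤ h ∧ (∀ i < h₀, Q i = Q₀ i) ∧
      G.Searching S x (fun a => D a ∨ G.tail a = Q₀ l) h Q τ := by
  refine Runs.loop (fun b σ => ∃ j h Q, b = 32 * G.outCount (Q₀ l) j + 1 ∧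
    σ.reg 22 = G.lastArc (Q₀ l) j ∧ h₀ ≤ h ∧ (∀ i < h₀, Q i = Q₀ i) ∧
    G.Searching S x (fun a => D a ∨ (G.tail a = Q₀ l ∧ j ≤ a)) h Q σ) ?_ ?_
  · rintro b σ ⟨j, h, Q, rfl, h22, hle, hQ, hs⟩ hg
    rw [hs.loaded.zero_eq, h22] at hg
    obtain ⟨e, he⟩ := Nat.exists_eq_succ_of_ne_zero hg.ne'
    obtain ⟨hem, hej, het, hgap⟩ := lastArc_eq_succ he
    have hcnt : G.outCount (Q₀ l) e + 1 ≤ G.outCount (Q₀ l) j :=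
      outCount_lt (e := ⟨e, hem⟩) hej het
    refine ⟨30, by omega, (scanArc_runs hs ⟨e, hem⟩ (by rw [h22, he]) (i := l) (by omega)
      (by rw [het, hQ l hl])).conseq le_rfl ?_⟩
    rintro τ ⟨⟨h', Q', hle', hQ', hs'⟩, h22'⟩
    refine ⟨32 * G.outCount (Q₀ l) e + 1, by omega, e, h', Q', rfl, by rw [h22', het], by omega,
      fun i hi => by rw [hQ' i (by omega), hQ i hi], { hs' with done := fun a ha hD => ?_ }⟩
    refine hs'.done a ha ?_
    rcases hD with hD | ⟨hat, hea⟩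
    · exact Or.inl (Or.inl hD)
    · by_cases hae : a = ⟨e, hem⟩
      · exact Or.inr hae
      · refine Or.inl (Or.inr ⟨hat, ?_⟩)
        by_contra hlt
        refine hgap a (lt_of_le_of_ne hea fun h' => hae (Fin.ext h'.symm)) (by omega) hat
  · rintro b σ ⟨j, h, Q, rfl, h22, hle, hQ, hs⟩ hg
    rw [hs.loaded.zero_eq, h22] at hg
    refine ⟨by omega, h, Q, hle, hQ, { hs with done := fun a ha hD => ?_ }⟩
    refine hs.done a ha ?_
    rcases hD with hD | hat
    · exact Or.inl hD
    · refine Or.inr ⟨hat, ?_⟩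
      by_contra hlt
      exact lastArc_eq_zero (u := Q₀ l) (j := j) (by omega) a (by omega) hat

theorem scanVertex_runs {S : Finset (Fin G.m)} {x : Fin G.n} {D : Fin G.m → Prop} {l h : ℕ}
    {Q : ℕ → Fin G.n} {σ : Mem} (hs : G.Searching S x D h Q σ) (hl : l < h)
    (h19 : σ.reg 19 = l) :
    Runs Prog.scanVertex σ (32 * G.outCount (Q l) G.m + 9) fun τ => τ.reg 19 = l + 1 ∧
      ∃ h' Q', h ≤ h' ∧ (∀ i < h, Q' i = Q i) ∧
        G.Searching S x (fun a => D a ∨ G.tail a = Q l) h' Q' τ := by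
  set σ₁ := exec [.load 21 8 19, .add 19 19 5, .load 22 4 21] σ with hσ₁
  have hs₁ := hs.agree (agree_exec [.load 21 8 19, .add 19 19 5, .load 22 4 21] σ)
    (by decide) (by decide)
  rw [← hσ₁] at hs₁
  have h19' : σ₁.reg 19 = l + 1 := by simp [hσ₁, exec, Cmd.det, h19, hs.loaded.one_eq]
  have h22 : σ₁.reg 22 = G.lastArc (Q l) G.m := by
    simp [hσ₁, exec, Cmd.det, h19, hs.queue l hl, hs.loaded.first_eq]
  refine (Runs.block_seq rfl (Runs.frame (scanArc_loop_runs (D := D) (Q₀ := Q) hl _ σ₁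
    ⟨G.m, h, Q, rfl, h22, le_rfl, fun _ _ => rfl, { hs₁ with done := ?_ }⟩))).conseq (by simp) ?_
  · rintro a ha (hD | ⟨-, hm⟩)
    · exact hs.done a ha hD
    · omega
  · rintro τ ⟨hτ, hag⟩
    exact ⟨by rw [hag.1 19 (by decide), h19'], hτ⟩

variable (G) in
/-- The number of arcs out of vertices that have not yet been removed from the queue. -/
def pendingArcs (Q : ℕ → Fin G.n) (l : ℕ) : ℕ :=
  (Finset.univ.filter fun e : Fin G.m => ∀ i < l, G.tail e ≠ Q i).card

theorem SearchOrder.pendingArcs_succ {S : Finset (Fin G.m)} {x : Fin G.n} {h : ℕ}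
    {Q : ℕ → Fin G.n} (hQ : G.SearchOrder S x h Q) {l : ℕ} (hl : l < h) :
    G.pendingArcs Q (l + 1) + G.outCount (Q l) G.m ≤ G.pendingArcs Q l := by
  rw [pendingArcs, pendingArcs, outCount, ← Finset.card_union_of_disjoint]
  · refine Finset.card_le_card fun e he => ?_
    simp only [Finset.mem_union, Finset.mem_filter, Finset.mem_univ, true_and] at he ⊢
    rcases he with he | ⟨-, he⟩
    · exact fun i hi => he i (by omega)
    · intro i hi h'
      have := hQ.inj l hl i (by omega) (he.symm.trans h')
      omega
  · rw [Finset.disjoint_left]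
    intro e he he'
    simp only [Finset.mem_filter, Finset.mem_univ, true_and] at he he'
    exact he l (by omega) he'.2

theorem pendingArcs_le (Q : ℕ → Fin G.n) (l : ℕ) : G.pendingArcs Q l ≤ G.m := by
  rw [pendingArcs]
  simpa using Finset.card_filter_le (Finset.univ : Finset (Fin G.m)) _

theorem pendingArcs_congr {Q Q' : ℕ → Fin G.n} {l : ℕ} (h : ∀ i < l, Q' i = Q i) :
    G.pendingArcs Q' l = G.pendingArcs Q l := by
  rw [pendingArcs, pendingArcs]
  congr 1
  refine Finset.filter_congr fun e _ => ?_
  exact ⟨fun h' i hi => by rw [← h i hi]; exact h' i hi,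
    fun h' i hi => by rw [h i hi]; exact h' i hi⟩

/-- The search finds the vertices that `x` reaches, in an order in which every vertex but the first is
entered from an earlier one. The time is linear because every arc list is read at most once. -/
theorem search_runs {S : Finset (Fin G.m)} {x : Fin G.n} {σ : Mem} (h0 : G.Loaded σ)
    (hS : G.HoldsArcs S σ) (hx : σ.reg 16 = x) :
    Runs Prog.search σ (50 * (G.n + G.m + 1)) fun τ => G.HoldsSet 7 (G.net.reach S x) τ ∧
      ∃ Q, G.SearchOrder S x (τ.reg 20) Q ∧ (∀ i < τ.reg 20, τ.arr 8 i = Q i) ∧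
        τ.reg 20 = (G.net.reach S x).card := by
  refine (Runs.seq (T₁ := G.n * 6 + 3) (P := fun τ => G.Loaded τ ∧ G.HoldsArcs S τ ∧
    τ.reg 16 = x ∧ G.HoldsSet 7 ∅ τ) ?_ ?_ (T₂ := 11 + 30 * G.n + 32 * G.m)).conseq (by omega)
    fun _ h => h
  · refine ((Runs.forLoop (t := 3) (fun j τ => ∀ u : Fin G.n, (u : ℕ) < j → τ.arr 7 u = 0)
      h0.n_eq h0.one_eq (by decide) (by decide) (by decide) (by decide) (by decide)
      (fun _ _ _ h => h) (fun u hu => by omega) ?_).frame).conseq le_rfl ?_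
    · intro j τ hj hI h18 hag
      refine Runs.block rfl fun u hu => ?_
      have h6 : τ.reg 6 = 0 := by rw [hag.1 6 (by decide), h0.zero_eq]
      by_cases huj : (u : ℕ) = j
      · simp [exec, Cmd.det, h18, huj, h6]
      · simpa [exec, Cmd.det, h18, huj] using hI u (by omega)
    · rintro τ ⟨hτ, hag⟩
      exact ⟨h0.agree hag (by decide) (by decide), hS.agree hag (by decide),
        by rw [hag.1 16 (by decide), hx], fun u => by simpa using hτ u u.2⟩
  · rintro τ ⟨h0, hS, hx, h7⟩
    refine (Runs.block_seq (T := 1 + 30 * G.n + 32 * G.m) rfl ?_).conseq (by simp; omega)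
      fun _ h => h
    set σ₁ := exec [.store 7 16 5, .store 8 6 16, .const 19 0, .const 20 1] τ with hσ₁
    have hs : G.Searching S x (fun _ => False) 1 (fun _ => x) σ₁ := by
      refine ⟨h0.agree (agree_exec _ _) (by decide) (by decide),
        hS.agree (agree_exec _ _) (by decide), ⟨one_pos, rfl, fun i hi j hj _ => by omega,
        fun j hj h => by omega⟩, fun u => ?_, fun i hi => ?_, ?_, fun _ _ h => h.elim⟩
      · by_cases hu : u = x
        · simp [hσ₁, exec, Cmd.det, hx, hu, h0.one_eq]
        · have hu' : (u : ℕ) ≠ x := fun h => hu (Fin.ext h)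
          simpa [hσ₁, exec, Cmd.det, hx, hu, hu'] using h7 u
      · obtain rfl : i = 0 := by omega
        simp [hσ₁, exec, Cmd.det, hx, h0.zero_eq]
      · simp [hσ₁, exec, Cmd.det]
    have h19 : σ₁.reg 19 = 0 := by simp [hσ₁, exec, Cmd.det]
    refine (Runs.loop (fun b ρ => ∃ l h Q, b = 30 * (G.n - l) + 32 * G.pendingArcs Q l + 1 ∧
      l ≤ h ∧ ρ.reg 19 = l ∧ G.Searching S x (fun a => ∃ i < l, G.tail a = Q i) h Q ρ)
      ?_ ?_ _ σ₁ ⟨0, 1, fun _ => x, rfl, by omega, h19, { hs with done := by simp }⟩).conseq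
      ?_ fun _ h => h
    · rintro b ρ ⟨l, h, Q, rfl, hle, h19, hs⟩ hg
      rw [h19, hs.reg_eq] at hg
      have hn := hs.order.le
      have hp := hs.order.pendingArcs_succ hg
      refine ⟨_, ?_, (scanVertex_runs hs hg h19).conseq le_rfl ?_⟩
      · omega
      · rintro ρ' ⟨h19', h', Q', hle', hQ', hs'⟩
        refine ⟨_, ?_, l + 1, h', Q', rfl, by omega, h19', { hs' with done := ?_ }⟩
        · rw [pendingArcs_congr (Q := Q) (fun i hi => hQ' i (by omega))]
          omega
        · rintro a ha ⟨i, hi, hai⟩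
          refine hs'.done a ha ?_
          rw [hQ' i (by omega)] at hai
          rcases Nat.lt_succ_iff_lt_or_eq.1 hi with hi | rfl
          · exact Or.inl ⟨i, hi, hai⟩
          · exact Or.inr hai
    · rintro b ρ ⟨l, h, Q, rfl, hle, h19, hs⟩ hg
      rw [h19, hs.reg_eq] at hg
      obtain rfl : l = h := by omega
      have himg := hs.order.image_eq_reach fun e he ht => hs.done e he (by
        obtain ⟨i, hi, h'⟩ := Finset.mem_image.1 ht
        exact ⟨i, by simpa using hi, h'.symm⟩)
      refine ⟨by omega, himg ▸ hs.found, Q, ?_, ?_, ?_⟩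
      · rw [hs.reg_eq]
        exact hs.order
      · rw [hs.reg_eq]
        exact hs.queue
      · rw [hs.reg_eq, ← himg, hs.order.card]
    · have := pendingArcs_le (G := G) (fun _ => x) 0
      omega

end ReachInstance

namespace ReachInstance

variable {G : ReachInstance}

/-! ### Sampling by cluster popping -/

/-- The coin with bias numerator over denominator decides the failure of an arc. -/
theorem coinBias_p (e : Fin G.m) :
    coinBias (G.p e).num.toNat (G.p e).den = G.net.p e := by
  have hp : (0 : ℝ) ≤ G.p e := by exact_mod_cast (G.p_pos e).le
  have hp1 : (G.p e : ℝ) ≤ 1 := by exact_mod_cast (G.p_lt_one e).le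
  have hnum : (((G.p e).num.toNat : ℕ) : ℝ) = ((G.p e).num : ℝ) := by
    have : (((G.p e).num.toNat : ℕ) : ℤ) = (G.p e).num :=
      Int.toNat_of_nonneg (Rat.num_nonneg.2 (G.p_pos e).le)
    exact_mod_cast this
  change ((min _ _ : NNReal) : ℝ≥0∞) = ((Real.toNNReal (G.p e) : NNReal) : ℝ≥0∞)
  congr 1
  apply NNReal.eq
  rw [Real.coe_toNNReal _ hp, NNReal.coe_min, NNReal.coe_div, NNReal.coe_natCast,
    NNReal.coe_natCast, hnum, ← Rat.cast_def, NNReal.coe_one, min_eq_left hp1]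

theorem one_sub_p (e : Fin G.m) : 1 - G.net.p e = G.net.q e := by
  refine ENNReal.sub_eq_of_eq_add_rev ?_ (G.net.p_add_q e).symm
  simp [net]

/-- The arcs out of `C` are sampled one by one, in the order of their numbers. -/
theorem wp_resample_le {k : ℝ≥0∞} {S : Finset (Fin G.m)} {C : Finset (Fin G.n)} {σ : Mem}
    {f : Mem → ℝ≥0∞} {Φ : Finset (Fin G.m) → ℝ≥0∞} (h0 : G.Loaded σ) (hS : G.HoldsArcs S σ)
    (hC : G.HoldsSet 7 C σ)
    (hf : ∀ S' τ, G.HoldsArcs S' τ → Agree Prog.resample.regs Prog.resample.arrs σ τ →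
      f τ ≤ Φ S') :
    wp k Prog.resample f σ
      ≤ k * ((G.m * 23 + 3 : ℕ) : ℝ≥0∞) + G.net.resample (G.net.outArcs C) Φ S := by
  -- the arcs that remain to be sampled before the `j`-th pass
  let B : ℕ → Finset (Fin G.m) := fun j => (G.net.outArcs C).filter fun e => j ≤ e
  have hB0 : B 0 = G.net.outArcs C := by simp [B]
  have hBm : B G.m = ∅ := by
    ext e
    simp [B, e.2]
  have key := wp_forLoop_le (k := k) (f := f) (t := 20) (σ := σ) (n := G.m) (i := 18) (N := 1)
    (c := .seq (.block [.load 21 0 18, .load 22 7 21])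
    (.branch 6 22 (.seq (.block [.load 23 2 18, .load 24 3 18])
      (.seq (.coin 23 23 24) (.block [.store 6 18 23]))) .skip))
    (fun _ X => G.HoldsArcs X) (fun j X => G.net.resample (B j) Φ X) 0
    h0.m_eq h0.one_eq (by decide) (by decide) (by decide) (by decide) (by decide)
    (fun _ _ _ _ h => h) S hS ?_ ?_
  · simpa [hB0, Prog.resample] using key
  · intro j X τ hj hX h18 hag D g hg
    let e : Fin G.m := ⟨j, hj⟩
    have h0τ : G.Loaded τ := h0.agree hag (by decide) (by decide)
    have hCτ : G.HoldsSet 7 C τ := hC.agree hag (by decide)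
    rw [wp_seq, wp_block _ _ _ _ rfl, wp_branch]
    set τ₁ := exec [.load 21 0 18, .load 22 7 21] τ with hτ₁
    have h18₁ : τ₁.reg 18 = e := by simp [hτ₁, exec, Cmd.det, h18, e]
    have h22 : τ₁.reg 22 = if G.tail e ∈ C then 1 else 0 := by
      rw [← hCτ]
      have := h0τ.tail_eq e
      simp only [e] at this
      simp [hτ₁, exec, Cmd.det, h18, this, e]
    have hag₁ : Agree [18, 21, 22, 23, 24] [6] τ τ₁ :=
      (agree_exec [.load 21 0 18, .load 22 7 21] τ).mono (by decide) (by decide)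
    have h0₁ : G.Loaded τ₁ := h0τ.agree hag₁ (by decide) (by decide)
    have hX₁ : G.HoldsArcs X τ₁ := hX
    rw [h0₁.zero_eq, h22]
    have hBs : ∀ a, a ∈ B j ↔ a ∈ B (j + 1) ∨ (a = e ∧ G.tail e ∈ C) := by
      intro a
      simp only [B, Finset.mem_filter, FailNet.mem_outArcs]
      constructor
      · rintro ⟨h1, h2⟩
        by_cases ha : a = e
        · exact Or.inr ⟨ha, ha ▸ h1⟩
        · have : (a : ℕ) ≠ j := fun h => ha (Fin.ext h)
          exact Or.inl ⟨h1, by omega⟩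
      · rintro (⟨h1, h2⟩ | ⟨rfl, h2⟩)
        · exact ⟨h1, by omega⟩
        · exact ⟨h2, le_rfl⟩
    by_cases ht : G.tail e ∈ C
    · have hBj : B j = insert e (B (j + 1)) := by
        ext a
        rw [hBs]
        simp [ht, or_comm]
      have heB : e ∉ B (j + 1) := by simp [B, e]
      rw [if_pos ht, if_pos one_pos, wp_seq, wp_block _ _ _ _ rfl, wp_seq, wp_coin]
      set τ₂ := exec [.load 23 2 18, .load 24 3 18] τ₁ with hτ₂
      have h23 : τ₂.reg 23 = (G.p e).num.toNat := by
        simp [hτ₂, exec, Cmd.det, h18₁, h0₁.num_eq]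
      have h24 : τ₂.reg 24 = (G.p e).den := by
        simp [hτ₂, exec, Cmd.det, h18₁, h0₁.den_eq]
      have h18₂ : τ₂.reg 18 = e := by simp [hτ₂, exec, Cmd.det, h18₁]
      have hX₂ : G.HoldsArcs X τ₂ := hX
      rw [h23, h24, coinBias_p, one_sub_p, wp_block _ _ _ _ rfl, wp_block _ _ _ _ rfl]
      have hag₂ : Agree [18, 21, 22, 23, 24] [6] τ₁ τ₂ :=
        (agree_exec [.load 23 2 18, .load 24 3 18] τ₁).mono (by decide) (by decide)
      have hag₃ : ∀ v, Agree [21, 22, 23, 24] [6] τ (exec [.store 6 18 23] (τ₂.setReg 23 v)) := by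
        intro v
        refine (((agree_exec [.load 21 0 18, .load 22 7 21] τ).mono (by decide) (by decide)).trans
          ((agree_exec [.load 23 2 18, .load 24 3 18] τ₁).mono (by decide) (by decide))).trans
          (((agree_setReg 23 v τ₂).mono (by decide) (by decide)).trans
            ((agree_exec _ _).mono (by decide) (by decide)))
      have hg1 := hg (X.erase e) (exec [.store 6 18 23] (τ₂.setReg 23 1)) (by
        intro a
        by_cases ha : a = e
        · simp [exec, Cmd.det, h18₂, ha]
        · have ha' : (a : ℕ) ≠ e := fun h => ha (Fin.ext h)
          simpa [exec, Cmd.det, h18₂, ha, ha'] using hX₂ a)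
        ((hag₃ 1).mono (by decide) (by decide))
      have hg2 := hg (insert e X) (exec [.store 6 18 23] (τ₂.setReg 23 0)) (by
        intro a
        by_cases ha : a = e
        · simp [exec, Cmd.det, h18₂, ha]
        · have ha' : (a : ℕ) ≠ e := fun h => ha (Fin.ext h)
          simpa [exec, Cmd.det, h18₂, ha, ha'] using hX₂ a)
        ((hag₃ 0).mono (by decide) (by decide))
      rw [hBj, FailNet.resample_insert heB]
      set p := G.net.p e
      set q := G.net.q e
      have hpq : p + q = 1 := G.net.p_add_q e
      set V1 := G.net.resample (B (j + 1)) Φ (X.erase e)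
      set V0 := G.net.resample (B (j + 1)) Φ (insert e X)
      simp only [List.length_cons, List.length_nil]
      calc _ ≤ k + (k * ((2 * 2 + 1 : ℕ) : ℝ≥0∞) + (k + (k + (k * ((2 * 2 + 1 : ℕ) : ℝ≥0∞)
            + (k + (k + (p * (k * ((2 * 1 + 1 : ℕ) : ℝ≥0∞) + (D + V1))
              + q * (k * ((2 * 1 + 1 : ℕ) : ℝ≥0∞) + (D + V0))))))))) := by
            gcongr
        _ = 15 * k + (p + q) * (k * 3 + D) + (p * V1 + q * V0) := by push_cast; ring
        _ = k * ((18 : ℕ) : ℝ≥0∞) + D + (p * V1 + q * V0) := by rw [hpq]; push_cast; ring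
        _ ≤ _ := by gcongr; simp
    · have hBj : B j = B (j + 1) := by
        ext a
        rw [hBs]
        simp [ht]
      rw [if_neg ht, if_neg (lt_irrefl _), wp_skip]
      have hg1 := hg X τ₁ hX₁ ((agree_exec [.load 21 0 18, .load 22 7 21] τ).mono
        (by decide) (by decide))
      rw [hBj]
      simp only [List.length_cons, List.length_nil]
      calc _ ≤ k + (k * ((2 * 2 + 1 : ℕ) : ℝ≥0∞) + (k + (k + (D +
            G.net.resample (B (j + 1)) Φ X)))) := by gcongr
        _ = k * ((8 : ℕ) : ℝ≥0∞) + D + G.net.resample (B (j + 1)) Φ X := by push_cast; ring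
        _ ≤ _ := by gcongr; simp
  · intro X τ hX hag
    rw [hBm, FailNet.resample_empty, zero_add]
    exact hf X τ hX (hag.mono (by decide) (by decide))

/-- The last vertex of `R \ T` among the first `j` vertices, or `n`. -/
def pickIndex (T R : Finset (Fin G.n)) : ℕ → ℕ
  | 0 => G.n
  | j + 1 => if ∃ h : j < G.n, (⟨j, h⟩ : Fin G.n) ∈ R \ T then j else pickIndex T R j

/-- The last vertex of `R \ T`; the root is a default value. -/
def pickVertex (T R : Finset (Fin G.n)) : Fin G.n :=
  if h : pickIndex T R G.n < G.n then ⟨_, h⟩ else G.root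

theorem pickIndex_cases (T R : Finset (Fin G.n)) (j : ℕ) :
    (∃ u ∈ R \ T, pickIndex T R j = u) ∨
      (pickIndex T R j = G.n ∧ ∀ u ∈ R \ T, ¬ (u : ℕ) < j) := by
  induction j with
  | zero => right; simp [pickIndex]
  | succ j ih =>
    rw [pickIndex]
    split
    · rename_i h
      obtain ⟨hj, h⟩ := h
      exact Or.inl ⟨⟨j, hj⟩, h, rfl⟩
    · rename_i h
      rcases ih with h' | ⟨h1, h2⟩
      · exact Or.inl h'
      · refine Or.inr ⟨h1, fun u hu hlt => ?_⟩
        by_cases huj : (u : ℕ) = j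
        · subst huj
          exact h ⟨u.2, hu⟩
        · exact h2 u hu (by omega)

/-- As long as `T` is not reached, the index found by `pick` is a vertex of `R \ T`. -/
theorem pickVertex_mem {T R : Finset (Fin G.n)} (hT : T ⊆ R) (hR : R ≠ T) :
    pickVertex T R ∈ R \ T ∧ pickIndex T R G.n = pickVertex T R := by
  rcases pickIndex_cases T R G.n with ⟨u, hu, h⟩ | ⟨-, h⟩
  · have : pickVertex T R = u := by
      rw [pickVertex, dif_pos (by rw [h]; exact u.2)]
      exact Fin.ext h
    rw [this]
    exact ⟨hu, h⟩
  · refine absurd (Finset.Subset.antisymm (fun u hu => ?_) hT) hR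
    by_contra huT
    exact h u (Finset.mem_sdiff.2 ⟨hu, huT⟩) u.2

theorem pickIndex_self (T : Finset (Fin G.n)) : pickIndex T T G.n = G.n := by
  rcases pickIndex_cases T T G.n with ⟨u, hu, -⟩ | ⟨h, -⟩
  · simp at hu
  · exact h

theorem pick_runs {T R : Finset (Fin G.n)} {σ : Mem} (h0 : G.Loaded σ) (hR : G.HoldsSet 9 R σ)
    (hT : G.HoldsSet 10 T σ) :
    Runs Prog.pick σ (G.n * 13 + 7) fun τ => τ.reg 16 = pickIndex T R G.n := by
  have hb : exec [.add 16 0 6] σ = σ.setReg 16 G.n := by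
    simp [exec, Cmd.det, h0.n_eq, h0.zero_eq]
  refine (Runs.block_seq rfl ?_ (T := G.n * 13 + 3)).conseq (by simp) fun _ h => h
  rw [hb]
  refine Runs.forLoop (t := 10) (fun j τ => τ.reg 16 = pickIndex T R j) (by simp [h0.n_eq])
    (by simp [h0.one_eq]) (by decide) (by decide) (by decide) (by decide) (by decide)
    (fun j τ v h => by simpa using h) (by simp [pickIndex]) ?_
  intro j τ hj hI h18 hag
  have hag' : Agree [16, 18, 21, 22] [] σ τ :=
    ((agree_setReg 16 G.n σ).mono (by decide) (by decide)).trans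
      (hag.mono (by decide) (by decide))
  have h0τ := h0.agree hag' (by decide) (by decide)
  have h9 := hR.agree hag' (by decide) ⟨j, hj⟩
  have h10 := hT.agree hag' (by decide) ⟨j, hj⟩
  simp only at h9 h10
  refine (Runs.block_seq rfl (Runs.branch (T := 3) (fun hlt => ?_) fun hlt => ?_)).conseq
    (by simp) fun _ h => h
  · simp only [exec, Cmd.det, reg_setReg, arr_setReg, h18] at hlt
    have hmem : (⟨j, hj⟩ : Fin G.n) ∈ R \ T := by
      rw [Finset.mem_sdiff]
      by_cases a : (⟨j, hj⟩ : Fin G.n) ∈ R <;> by_cases b : (⟨j, hj⟩ : Fin G.n) ∈ T <;>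
        simp [h9, h10, a, b] at hlt ⊢
    refine Runs.block rfl ?_
    rw [pickIndex, if_pos ⟨hj, hmem⟩]
    simp [exec, Cmd.det, h18, h0τ.zero_eq]
  · simp only [exec, Cmd.det, reg_setReg, arr_setReg, h18] at hlt
    have hmem : ¬ (⟨j, hj⟩ : Fin G.n) ∈ R \ T := by
      rw [Finset.mem_sdiff]
      by_cases a : (⟨j, hj⟩ : Fin G.n) ∈ R <;> by_cases b : (⟨j, hj⟩ : Fin G.n) ∈ T <;>
        simp [h9, h10, a, b] at hlt ⊢
    refine (Runs.skip ?_).conseq (by omega) fun _ h => h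
    rw [pickIndex, if_neg (fun h => hmem h.2)]
    simpa [exec, Cmd.det] using hI

/-- Given the surviving arcs, an attempt is deterministic. -/
theorem attempt_runs {S : Finset (Fin G.m)} {R : Finset (Fin G.n)} {x : Fin G.n} {σ : Mem}
    (h0 : G.Loaded σ) (hS : G.HoldsArcs S σ) (hR : G.HoldsSet 9 R σ) (hx : σ.reg 16 = x) :
    Runs Prog.attempt σ (80 * (G.n + G.m + 1)) fun τ =>
      G.HoldsSet 9 (R.erase x) τ ∧ G.HoldsSet 7 (G.net.reach S x) τ ∧
        τ.reg 17 = if Disjoint (G.net.reach S x) (R.erase x) then 0 else 1 := by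
  refine (Runs.block_seq rfl ?_ (T := 60 + 70 * G.n + 50 * G.m)).conseq
    (by simp; omega) fun _ h => h
  set σ₁ := exec [.store 9 16 6] σ with hσ₁
  have hag₁ := agree_exec [.store 9 16 6] σ
  rw [← hσ₁] at hag₁
  have h0₁ := h0.agree hag₁ (by decide) (by decide)
  have hS₁ := hS.agree hag₁ (by decide)
  have hx₁ : σ₁.reg 16 = x := by simp [hσ₁, exec, Cmd.det, hx]
  have hR₁ : G.HoldsSet 9 (R.erase x) σ₁ := by
    intro u
    by_cases hu : u = x
    · simp [hσ₁, exec, Cmd.det, hx, hu, h0.zero_eq]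
    · have hu' : (u : ℕ) ≠ x := fun h => hu (Fin.ext h)
      simpa [hσ₁, exec, Cmd.det, hx, hu, hu'] using hR u
  refine (Runs.seq (search_runs h0₁ hS₁ hx₁).frame (T₂ := 9 + 15 * G.n) ?_).conseq
    (by omega) fun _ h => h
  rintro τ ⟨⟨h7, -⟩, hag⟩
  refine (Runs.block_seq rfl ?_ (T := 3 + 15 * G.n)).conseq (by simp; omega) fun _ h => h
  set τ₁ := exec [.const 17 0] τ with hτ₁
  have hag₂ := agree_exec [.const 17 0] τ
  rw [← hτ₁] at hag₂
  have h0τ := (h0₁.agree hag (by decide) (by decide)).agree hag₂ (by decide) (by decide)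
  have hRτ := (hR₁.agree hag (by decide)).agree hag₂ (by decide)
  have h7τ := h7.agree hag₂ (by decide)
  refine ((Runs.forLoop (n := G.n) (t := 11) (fun j ρ => ρ.reg 17 = if
    ∃ u ∈ G.net.reach S x, u ∈ R.erase x ∧ (u : ℕ) < j then 1 else 0) h0τ.n_eq h0τ.one_eq
    (by decide) (by decide) (by decide) (by decide) (by decide)
    (fun j τ v h => by simpa using h) (by simp [hτ₁, exec, Cmd.det]) ?_).frame).conseq
    (by omega) ?_
  · intro j ρ hj hI h18 hag₃
    have h0ρ := h0τ.agree hag₃ (by decide) (by decide)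
    have h9 := hRτ.agree hag₃ (by decide) ⟨j, hj⟩
    have h7' := h7τ.agree hag₃ (by decide) ⟨j, hj⟩
    simp only at h9 h7'
    have hnot : (¬ ((⟨j, hj⟩ : Fin G.n) ∈ G.net.reach S x ∧ (⟨j, hj⟩ : Fin G.n) ∈ R.erase x)) →
        ((∃ u ∈ G.net.reach S x, u ∈ R.erase x ∧ (u : ℕ) < j + 1) ↔
          ∃ u ∈ G.net.reach S x, u ∈ R.erase x ∧ (u : ℕ) < j) := by
      intro hn
      constructor
      · rintro ⟨u, h1, h2, h3⟩
        refine ⟨u, h1, h2, ?_⟩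
        by_contra hlt
        have : u = ⟨j, hj⟩ := Fin.ext (by simp; omega)
        exact hn (this ▸ ⟨h1, h2⟩)
      · rintro ⟨u, h1, h2, h3⟩
        exact ⟨u, h1, h2, by omega⟩
    have hr17 : (exec [.load 21 7 18, .load 22 9 18] ρ).reg 17 = ρ.reg 17 := by
      simp [exec, Cmd.det]
    have hr6 : (exec [.load 21 7 18, .load 22 9 18] ρ).reg 6 = 0 := by
      simp [exec, Cmd.det, h0ρ.zero_eq]
    have hr5 : (exec [.load 21 7 18, .load 22 9 18] ρ).reg 5 = 1 := by
      simp [exec, Cmd.det, h0ρ.one_eq]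
    have hr21 : (exec [.load 21 7 18, .load 22 9 18] ρ).reg 21
        = if (⟨j, hj⟩ : Fin G.n) ∈ G.net.reach S x then 1 else 0 := by
      simp [exec, Cmd.det, h18, h7']
    have hr22 : (exec [.load 21 7 18, .load 22 9 18] ρ).reg 22
        = if (⟨j, hj⟩ : Fin G.n) ∈ R.erase x then 1 else 0 := by
      simp only [exec, Cmd.det, h18, reg_setReg, arr_setReg]
      simpa using h9
    have hskip : (¬ ((⟨j, hj⟩ : Fin G.n) ∈ G.net.reach S x ∧
        (⟨j, hj⟩ : Fin G.n) ∈ R.erase x)) → (exec [.load 21 7 18, .load 22 9 18] ρ).reg 17 =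
        if ∃ u ∈ G.net.reach S x, u ∈ R.erase x ∧ (u : ℕ) < j + 1 then 1 else 0 := by
      intro hn
      rw [hr17, hI]
      simp only [hnot hn]
    refine (Runs.block_seq rfl (Runs.branch (T := 4) (fun hlt => ?_) fun hlt => ?_)).conseq
      (by simp) fun _ h => h
    · refine Runs.branch (T := 3) (fun hlt' => ?_) fun hlt' => ?_
      · rw [hr6, hr21] at hlt
        rw [hr6, hr22] at hlt'
        have h1 : (⟨j, hj⟩ : Fin G.n) ∈ G.net.reach S x := by
          by_contra h; simp [h] at hlt
        have h2 : (⟨j, hj⟩ : Fin G.n) ∈ R.erase x := by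
          by_contra h; rw [if_neg h] at hlt'; omega
        refine Runs.block rfl ?_
        rw [if_pos ⟨_, h1, h2, Nat.lt_succ_self j⟩]
        simp [exec, Cmd.det, h0ρ.one_eq, h0ρ.zero_eq]
      · refine (Runs.skip (hskip fun hn => ?_)).conseq (by omega) fun _ h => h
        rw [hr6, hr22, if_pos hn.2] at hlt'
        omega
    · refine (Runs.skip (hskip fun hn => ?_)).conseq (by omega) fun _ h => h
      rw [hr6, hr21, if_pos hn.1] at hlt
      omega
  · rintro ρ ⟨h17, hag₃⟩
    refine ⟨hRτ.agree hag₃ (by decide), h7τ.agree hag₃ (by decide), ?_⟩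
    rw [h17]
    by_cases hd : Disjoint (G.net.reach S x) (R.erase x)
    · rw [if_pos hd, if_neg]
      rintro ⟨u, h1, h2, -⟩
      exact Finset.disjoint_left.1 hd h1 h2
    · rw [if_neg hd, if_pos]
      obtain ⟨u, h1, h2⟩ := Finset.not_disjoint_iff.1 hd
      exact ⟨u, h1, h2, u.2⟩

theorem popStep_branch_le {k : ℝ≥0∞} {S : Finset (Fin G.m)} {R C : Finset (Fin G.n)}
    {σ : Mem} {f : Mem → ℝ≥0∞} {Φ : Finset (Fin G.m) → ℝ≥0∞} (h0 : G.Loaded σ)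
    (hS : G.HoldsArcs S σ) (hR : G.HoldsSet 9 R σ) (hC : G.HoldsSet 7 C σ)
    (hf : ∀ S' τ, G.HoldsArcs S' τ → G.HoldsSet 9 (R ∪ C) τ → f τ ≤ Φ S') :
    wp k (.seq Prog.resample (forLoop 18 0 (.seq (.block [.load 21 7 18])
      (.branch 6 21 (.block [.store 9 18 5]) .skip)))) f σ
      ≤ k * ((23 * G.m + 15 * G.n + 8 : ℕ) : ℝ≥0∞) + G.net.resample (G.net.outArcs C) Φ S := by
  rw [wp_seq]
  have := wp_resample_le (k := k) (f := wp k (forLoop 18 0 (.seq (.block [.load 21 7 18])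
      (.branch 6 21 (.block [.store 9 18 5]) .skip))) f)
      (Φ := fun S' => k * ((G.n * 13 + 3 : ℕ) : ℝ≥0∞) + Φ S') h0 hS hC ?_
  · rw [FailNet.resample_const_add] at this
    calc _ ≤ k + (k * ((G.m * 23 + 3 : ℕ) : ℝ≥0∞) + (k * ((G.n * 13 + 3 : ℕ) : ℝ≥0∞)
          + G.net.resample (G.net.outArcs C) Φ S)) := by gcongr
      _ = k * ((G.m * 23 + G.n * 13 + 7 : ℕ) : ℝ≥0∞)
          + G.net.resample (G.net.outArcs C) Φ S := by push_cast; ring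
      _ ≤ _ := steps_le (by omega)
  · intro S' τ hS' hag
    have h0τ := h0.agree hag (by decide) (by decide)
    have hRτ := hR.agree hag (by decide)
    have hCτ := hC.agree hag (by decide)
    refine (Runs.forLoop (n := G.n) (t := 10) (fun j ρ => ∀ u : Fin G.n, ρ.arr 9 u =
      if u ∈ R ∨ (u ∈ C ∧ (u : ℕ) < j) then 1 else 0) h0τ.n_eq h0τ.one_eq
      (by decide) (by decide) (by decide) (by decide) (by decide)
      (fun j τ v h => h) (fun u => by simpa using hRτ u) ?_).frame k f _ ?_
    · intro j ρ hj hI h18 hag'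
      have h0ρ := h0τ.agree hag' (by decide) (by decide)
      have h7 := hCτ.agree hag' (by decide) ⟨j, hj⟩
      simp only at h7
      have hlt_iff : ∀ u : Fin G.n, u ≠ ⟨j, hj⟩ → ((u : ℕ) < j + 1 ↔ (u : ℕ) < j) := by
        intro u hu
        have : (u : ℕ) ≠ j := fun h => hu (Fin.ext h)
        omega
      refine (Runs.block_seq rfl (Runs.branch (T := 3) (fun hlt => ?_) fun hlt => ?_)).conseq
        (by simp) fun _ h => h
      · simp only [exec, Cmd.det, reg_setReg, h18, h7, h0ρ.zero_eq] at hlt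
        have hmem : (⟨j, hj⟩ : Fin G.n) ∈ C := by
          by_contra h
          simp [h] at hlt
        refine Runs.block rfl fun u => ?_
        by_cases hu : u = ⟨j, hj⟩
        · simp [exec, Cmd.det, h18, hu, hmem, h0ρ.one_eq]
        · have hu' : (u : ℕ) ≠ j := fun h => hu (Fin.ext h)
          simpa [exec, Cmd.det, h18, hu', hlt_iff u hu] using hI u
      · simp only [exec, Cmd.det, reg_setReg, h18, h7, h0ρ.zero_eq] at hlt
        have hmem : (⟨j, hj⟩ : Fin G.n) ∉ C := by
          intro h
          simp [h] at hlt
        refine (Runs.skip fun u => ?_).conseq (by omega) fun _ h => h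
        by_cases hu : u = ⟨j, hj⟩
        · simpa [exec, Cmd.det, hu, hmem] using hI u
        · simpa [exec, Cmd.det, hlt_iff u hu] using hI u
    · rintro ρ ⟨hρ, hag'⟩
      exact hf S' ρ (hS'.agree hag' (by decide)) fun u => by
        rw [hρ u]
        simp

/-- One iteration has the effect of one unfolding of `popValue`. -/
theorem wp_popStep_le {k : ℝ≥0∞} {S : Finset (Fin G.m)} {R : Finset (Fin G.n)} {x : Fin G.n}
    {σ : Mem} {f : Mem → ℝ≥0∞} {F : Finset (Fin G.n) → Finset (Fin G.m) → ℝ≥0∞}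
    (h0 : G.Loaded σ) (hS : G.HoldsArcs S σ) (hR : G.HoldsSet 9 R σ) (hx : σ.reg 16 = x)
    (hpop : ∀ S' τ, G.HoldsArcs S' τ → G.HoldsSet 9 (R ∪ G.net.reach S x) τ →
      Agree Prog.popStep.regs Prog.popStep.arrs σ τ → f τ ≤ F (R ∪ G.net.reach S x) S')
    (hdrop : ∀ τ, G.HoldsArcs S τ → G.HoldsSet 9 (R.erase x) τ →
      Agree Prog.popStep.regs Prog.popStep.arrs σ τ → f τ ≤ F (R.erase x) S) :
    wp k Prog.popStep f σ ≤ k * ((110 * (G.n + G.m + 1) : ℕ) : ℝ≥0∞) +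
      if Disjoint (G.net.reach S x) (R.erase x) then
        G.net.resample (G.net.outArcs (G.net.reach S x)) (F (R ∪ G.net.reach S x)) S
      else F (R.erase x) S := by
  refine wp_frame fun g hgf hg0 => ?_
  have hle : ∀ τ X, (Agree Prog.popStep.regs Prog.popStep.arrs σ τ → f τ ≤ X) → g τ ≤ X := by
    intro τ X h
    by_cases hag : Agree Prog.popStep.regs Prog.popStep.arrs σ τ
    · exact (hgf τ).trans (h hag)
    · rw [hg0 τ hag]
      exact zero_le
  set Y := if Disjoint (G.net.reach S x) (R.erase x) then
        G.net.resample (G.net.outArcs (G.net.reach S x)) (F (R ∪ G.net.reach S x)) S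
      else F (R.erase x) S with hY
  refine (wp_le_of_runs_seq (F := k * ((23 * G.m + 15 * G.n + 9 : ℕ) : ℝ≥0∞) + Y)
    (attempt_runs h0 hS hR hx).frame ?_).trans ?_
  · rintro τ ⟨⟨h9, h7, h17⟩, hag⟩
    have h0τ := h0.agree hag (by decide) (by decide)
    have hSτ := hS.agree hag (by decide)
    rw [wp_branch, h17, h0τ.one_eq]
    by_cases hd : Disjoint (G.net.reach S x) (R.erase x)
    · rw [if_pos hd, if_pos one_pos, hY, if_pos hd]
      refine (add_le_add le_rfl (popStep_branch_le h0τ hSτ h9 h7 (Φ := F (R ∪ G.net.reach S x))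
        fun S' ρ hS' h9' => ?_)).trans ?_
      · have hun : R.erase x ∪ G.net.reach S x = R ∪ G.net.reach S x := by
          ext y
          have : x ∈ G.net.reach S x := FailNet.mem_reach.2 Relation.ReflTransGen.refl
          by_cases hy : y = x
          · simp [hy, FailNet.mem_reach.1 this]
          · simp [hy]
        exact hle _ _ (hpop S' ρ hS' (hun ▸ h9'))
      · apply le_of_eq
        push_cast
        ring
    · rw [if_neg hd, if_neg (lt_irrefl _), wp_skip, hY, if_neg hd]
      calc _ ≤ k + (k + F (R.erase x) S) := by
            gcongr
            exact hle _ _ (hdrop τ hSτ h9)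
        _ = k * ((2 : ℕ) : ℝ≥0∞) + F (R.erase x) S := by push_cast; ring
        _ ≤ _ := steps_le (by omega)
  · calc _ = k * ((80 * (G.n + G.m + 1) + 1 + (23 * G.m + 15 * G.n + 9) : ℕ) : ℝ≥0∞) + Y := by
          push_cast; ring
      _ ≤ _ := steps_le (by omega)

/-- The number of elementary steps of one iteration of cluster popping is at most this. -/
def popCost (G : ReachInstance) : ℕ := 130 * (G.n + G.m + 1)

/-- The loop of cluster popping is bounded by `popLimit`, with the cost of an iteration as the cost
`c`. -/
theorem wp_popping_loop_le {k : ℝ≥0∞} {T : Finset (Fin G.n)} {f : Mem → ℝ≥0∞}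
    {Φ : Finset (Fin G.m) → ℝ≥0∞}
    (hf : ∀ S τ, G.Loaded τ → G.HoldsArcs S τ → G.HoldsSet 9 T τ → G.HoldsSet 10 T τ → f τ ≤ Φ S)
    {S : Finset (Fin G.m)} {R : Finset (Fin G.n)} {σ : Mem} (h0 : G.Loaded σ)
    (hS : G.HoldsArcs S σ) (hR : G.HoldsSet 9 R σ) (hT : G.HoldsSet 10 T σ) (hTR : T ⊆ R)
    (h16 : σ.reg 16 = pickIndex T R G.n) :
    wp k (.loop 16 0 (.seq Prog.popStep Prog.pick)) f σ
      ≤ G.net.popLimit T (pickVertex T) (k * (G.popCost : ℝ≥0∞)) (fun S => k + Φ S) R S := by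
  let P := G.net.popLimit T (pickVertex T) (k * (G.popCost : ℝ≥0∞)) (fun S => k + Φ S)
  let Rep : Finset (Fin G.n) → Finset (Fin G.m) → Mem → Prop := fun R S τ =>
    G.Loaded τ ∧ G.HoldsArcs S τ ∧ G.HoldsSet 9 R τ ∧ G.HoldsSet 10 T τ ∧ T ⊆ R ∧
      τ.reg 16 = pickIndex T R G.n
  let I : Mem → ℝ≥0∞ := fun τ => ⨅ R, ⨅ S, ⨅ _ : Rep R S τ, P R S
  have hI : ∀ {R S τ}, Rep R S τ → I τ ≤ P R S := fun {R S τ} h =>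
    iInf_le_of_le R (iInf_le_of_le S (iInf_le_of_le h le_rfl))
  refine (wp_loop_le (I := I) (fun τ => ?_) σ).trans (hI ⟨h0, hS, hR, hT, hTR, h16⟩)
  refine le_iInf fun R => le_iInf fun S => le_iInf fun ⟨h0, hS, hR, hT, hTR, h16⟩ => ?_
  rw [h0.n_eq, h16]
  by_cases hRT : R = T
  · subst hRT
    rw [pickIndex_self, if_neg (lt_irrefl _)]
    refine le_trans ?_ (FailNet.popLimit_self S)
    gcongr
    exact hf S τ h0 hS hR hT
  · obtain ⟨hx, hxi⟩ := pickVertex_mem hTR hRT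
    rw [hxi, if_pos (pickVertex T R).2, wp_seq]
    -- the choice of the next vertex, after the roots and the arcs have changed
    have hpick : ∀ R' S' ρ, T ⊆ R' → G.HoldsArcs S' ρ → G.HoldsSet 9 R' ρ →
        Agree Prog.popStep.regs Prog.popStep.arrs τ ρ →
        wp k Prog.pick I ρ ≤ k * ((G.n * 13 + 7 : ℕ) : ℝ≥0∞) + P R' S' := by
      intro R' S' ρ hTR' hS' hR' hag
      have h0ρ := h0.agree hag (by decide) (by decide)
      have hTρ := hT.agree hag (by decide)
      refine (pick_runs h0ρ hR' hTρ).frame k I _ ?_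
      rintro μ ⟨hμ, hagμ⟩
      exact hI ⟨h0ρ.agree hagμ (by decide) (by decide), hS'.agree hagμ (by decide),
        hR'.agree hagμ (by decide), hTρ.agree hagμ (by decide), hTR', hμ⟩
    have hTe : T ⊆ R.erase (pickVertex T R) := fun y hy =>
      Finset.mem_erase.2 ⟨fun h => (Finset.mem_sdiff.1 hx).2 (h ▸ hy), hTR hy⟩
    have hstep := wp_popStep_le (k := k) (f := wp k Prog.pick I)
      (F := fun R' S' => k * ((G.n * 13 + 7 : ℕ) : ℝ≥0∞) + P R' S')
      h0 hS hR (x := pickVertex T R) (by rw [h16, hxi])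
      (fun S' ρ hS' hR' hag => hpick _ S' ρ (hTR.trans Finset.subset_union_left) hS' hR' hag)
      (fun ρ hS' hR' hag => hpick _ S ρ hTe hS' hR' hag)
    refine (add_le_add le_rfl (add_le_add le_rfl hstep)).trans ?_
    have hcost : k + (k + (k * ((110 * (G.n + G.m + 1) : ℕ) : ℝ≥0∞)
        + k * ((G.n * 13 + 7 : ℕ) : ℝ≥0∞))) ≤ k * (G.popCost : ℝ≥0∞) := by
      calc _ = k * ((110 * (G.n + G.m + 1) + (G.n * 13 + 7) + 2 : ℕ) : ℝ≥0∞) := by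
            push_cast; ring
        _ ≤ _ := by rw [popCost]; gcongr; omega
    by_cases hd : Disjoint (G.net.reach S (pickVertex T R)) (R.erase (pickVertex T R))
    · rw [if_pos hd, FailNet.resample_const_add]
      refine le_trans (le_trans (le_of_eq ?_) (add_le_add hcost le_rfl))
        (FailNet.popLimit_pop hRT hd)
      ring
    · rw [if_neg hd]
      refine le_trans (le_trans (le_of_eq ?_) (add_le_add hcost le_rfl))
        (FailNet.popLimit_drop hRT hd)
      ring

/-- The program `popping` produces a sample given that everything reaches `T`, in an expected
number of steps that is governed by the bound `M` for the potential. -/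
theorem wp_popping_le {k M φ₀ : ℝ≥0∞} {T : Finset (Fin G.n)} {f : Mem → ℝ≥0∞}
    {Φ : Finset (Fin G.m) → ℝ≥0∞} {S : Finset (Fin G.m)} {σ : Mem} (h0 : G.Loaded σ)
    (hS : G.HoldsArcs S σ) (hT : G.HoldsSet 10 T σ)
    (hM : ∀ R, T ⊆ R → ∑ w ∈ Rᶜ, G.net.Z (insert w R) ≤ M * G.net.Z R)
    (hΦ : G.net.mean (G.net.Rooted T) (fun S => k + Φ S) ≤ φ₀ * G.net.Z T)
    (hf : ∀ S τ, G.Loaded τ → G.HoldsArcs S τ → G.HoldsSet 9 T τ → G.HoldsSet 10 T τ →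
      Agree Prog.popping.regs Prog.popping.arrs σ τ → f τ ≤ Φ S) :
    wp k Prog.popping f σ ≤ k * (G.popCost : ℝ≥0∞) + (φ₀ + k * (G.popCost : ℝ≥0∞) * M) := by
  refine wp_frame fun g hgf hg0 => ?_
  replace hf : ∀ S τ, G.Loaded τ → G.HoldsArcs S τ → G.HoldsSet 9 T τ → G.HoldsSet 10 T τ →
      g τ ≤ Φ S := by
    intro S τ h1 h2 h3 h4
    by_cases hag : Agree Prog.popping.regs Prog.popping.arrs σ τ
    · exact (hgf τ).trans (hf S τ h1 h2 h3 h4 hag)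
    · rw [hg0 τ hag]
      exact zero_le
  have hloop : Runs (forLoop 18 0 (.block [.store 7 18 5, .store 9 18 5])) σ (G.n * 8 + 3)
      fun τ => G.HoldsSet 7 Finset.univ τ ∧ G.HoldsSet 9 Finset.univ τ := by
    refine (Runs.forLoop (n := G.n) (t := 5) (fun j τ => ∀ u : Fin G.n, (u : ℕ) < j →
      τ.arr 7 u = 1 ∧ τ.arr 9 u = 1) h0.n_eq h0.one_eq (by decide) (by decide) (by decide)
      (by decide) (by decide) (fun _ _ _ h => h) (fun u hu => by omega) ?_).conseq le_rfl ?_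
    · intro j τ hj hI h18 hag
      have h0τ := h0.agree hag (by decide) (by decide)
      refine Runs.block rfl fun u hu => ?_
      by_cases huj : (u : ℕ) = j
      · simp [exec, Cmd.det, h18, huj, h0τ.one_eq]
      · simpa [exec, Cmd.det, h18, huj] using hI u (by omega)
    · intro τ hτ
      exact ⟨fun u => by simpa using (hτ u u.2).1, fun u => by simpa using (hτ u u.2).2⟩
  have hout : G.net.outArcs Finset.univ = Finset.univ := by ext; simp
  let P := G.net.popLimit T (pickVertex T) (k * (G.popCost : ℝ≥0∞)) (fun S => k + Φ S)
  refine (wp_le_of_runs_seq hloop.frame (F := k * ((23 * G.m + 13 * G.n + 20 : ℕ) : ℝ≥0∞)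
    + (φ₀ + k * (G.popCost : ℝ≥0∞) * M)) ?_).trans ?_
  · rintro τ ⟨⟨h7, h9⟩, hag⟩
    have h0τ := h0.agree hag (by decide) (by decide)
    have hSτ := hS.agree hag (by decide)
    have hTτ := hT.agree hag (by decide)
    rw [wp_seq]
    have hres := wp_resample_le (k := k) (f := wp k (.seq Prog.pick (.loop 16 0
      (.seq Prog.popStep Prog.pick))) g) (Φ := fun S' => k * ((G.n * 13 + 7 + 1 : ℕ) : ℝ≥0∞)
        + P Finset.univ S') h0τ hSτ h7 ?_
    · rw [FailNet.resample_const_add, hout] at hres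
      have hlim := FailNet.resample_popLimit_le (N := G.net) (c := k * (G.popCost : ℝ≥0∞))
        (pick := pickVertex T) (fun R hTR hRT => (pickVertex_mem hTR hRT).1) hM hΦ S
      calc _ ≤ k + (k * ((G.m * 23 + 3 : ℕ) : ℝ≥0∞) + (k * ((G.n * 13 + 7 + 1 : ℕ) : ℝ≥0∞)
            + (φ₀ + k * (G.popCost : ℝ≥0∞) * M))) :=
            add_le_add le_rfl (hres.trans (add_le_add le_rfl (add_le_add le_rfl hlim)))
        _ = k * ((G.m * 23 + G.n * 13 + 12 : ℕ) : ℝ≥0∞)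
            + (φ₀ + k * (G.popCost : ℝ≥0∞) * M) := by push_cast; ring
        _ ≤ _ := steps_le (by omega)
    · intro S' ρ hS' hagρ
      have h0ρ := h0τ.agree hagρ (by decide) (by decide)
      have h9ρ := h9.agree hagρ (by decide)
      have hTρ := hTτ.agree hagρ (by decide)
      refine wp_le_of_runs_seq (pick_runs h0ρ h9ρ hTρ).frame ?_
      rintro μ ⟨hμ, hagμ⟩
      exact wp_popping_loop_le hf (h0ρ.agree hagμ (by decide) (by decide))
        (hS'.agree hagμ (by decide)) (h9ρ.agree hagμ (by decide)) (hTρ.agree hagμ (by decide))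
        (Finset.subset_univ T) hμ
  · calc _ = k * ((G.n * 8 + 3 + 1 + (23 * G.m + 13 * G.n + 20) : ℕ) : ℝ≥0∞)
          + (φ₀ + k * (G.popCost : ℝ≥0∞) * M) := by push_cast; ring
      _ ≤ _ := steps_le (by rw [popCost]; omega)

end ReachInstance

/-! ### Expectations of the product estimator -/

/-- The expectation of `Φ (c + X)` for a binomial random variable `X` with `r` trials of success
probability `w`. -/
def binExp (w : ℝ≥0∞) : ℕ → (ℕ → ℝ≥0∞) → ℕ → ℝ≥0∞
  | 0, Φ, c => Φ c
  | r + 1, Φ, c => w * binExp w r Φ (c + 1) + (1 - w) * binExp w r Φ c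

theorem binExp_const_add {w : ℝ≥0∞} (hw : w ≤ 1) (r : ℕ) (B : ℝ≥0∞) (Φ : ℕ → ℝ≥0∞) (c : ℕ) :
    binExp w r (fun c => B + Φ c) c = B + binExp w r Φ c := by
  induction r generalizing c with
  | zero => rfl
  | succ r ih =>
    have h1 : w + (1 - w) = 1 := add_tsub_cancel_of_le hw
    rw [binExp, binExp, ih, ih]
    calc _ = (w + (1 - w)) * B + (w * binExp w r Φ (c + 1) + (1 - w) * binExp w r Φ c) := by ring
      _ = _ := by rw [h1, one_mul]

/-- The expectation of `Φ (a * X (r - 1) * ⋯ * X 0)` for independent binomial random variables `X i`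
with `s` trials of success probability `w i`. -/
def prodExp (w : ℕ → ℝ≥0∞) (s : ℕ) (Φ : ℕ → ℝ≥0∞) : ℕ → ℕ → ℝ≥0∞
  | 0, a => Φ a
  | r + 1, a => binExp (w r) s (fun c => prodExp w s Φ r (a * c)) 0

namespace ReachInstance

variable {G : ReachInstance}

/-! ### One factor of the estimator -/

/-- The set `T` is reached with positive probability, and `M` bounds the potential of cluster
popping at all root sets that contain `T`. So `M` bounds the expected number of iterations of cluster
popping towards `T`. -/
def PopBound (G : ReachInstance) (M : ℕ) (T : Finset (Fin G.n)) : Prop :=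
  G.net.Z T ≠ 0 ∧ ∀ R, T ⊆ R → ∑ w ∈ Rᶜ, G.net.Z (insert w R) ≤ M * G.net.Z R

/-- A trial increases the counter of successes with probability `dropProb T v`. The rewards `F₁` and
`F₀` after success and failure must not depend on the outcome that is left in memory. -/
theorem wp_trial_le {k F₁ F₀ : ℝ≥0∞} {M : ℕ} {T : Finset (Fin G.n)} {v : Fin G.n}
    {f : Mem → ℝ≥0∞} {S : Finset (Fin G.m)} {σ : Mem} (h0 : G.Loaded σ)
    (hS : G.HoldsArcs S σ) (hT : G.HoldsSet 10 T σ) (h13 : σ.reg 13 = v) (hM : G.PopBound M T)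
    (hf₁ : ∀ S' τ, G.HoldsArcs S' τ → τ.reg 14 = σ.reg 14 + 1 →
      Agree Prog.trial.regs Prog.trial.arrs σ τ → f τ ≤ F₁)
    (hf₀ : ∀ S' τ, G.HoldsArcs S' τ → τ.reg 14 = σ.reg 14 →
      Agree Prog.trial.regs Prog.trial.arrs σ τ → f τ ≤ F₀) :
    wp k Prog.trial f σ ≤ k * ((G.popCost * (M + 2) : ℕ) : ℝ≥0∞)
      + (G.net.dropProb T v * F₁ + (1 - G.net.dropProb T v) * F₀) := by
  refine wp_frame fun g hgf hg0 => ?_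
  replace hf₁ : ∀ S' τ, G.HoldsArcs S' τ → τ.reg 14 = σ.reg 14 + 1 → g τ ≤ F₁ := by
    intro S' τ h1 h2
    by_cases hag : Agree Prog.trial.regs Prog.trial.arrs σ τ
    · exact (hgf τ).trans (hf₁ S' τ h1 h2 hag)
    · rw [hg0 τ hag]
      exact zero_le
  replace hf₀ : ∀ S' τ, G.HoldsArcs S' τ → τ.reg 14 = σ.reg 14 → g τ ≤ F₀ := by
    intro S' τ h1 h2
    by_cases hag : Agree Prog.trial.regs Prog.trial.arrs σ τ
    · exact (hgf τ).trans (hf₀ S' τ h1 h2 hag)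
    · rw [hg0 τ hag]
      exact zero_le
  set W := G.net.dropProb T v * F₁ + (1 - G.net.dropProb T v) * F₀
  let A : ℕ := 90 * (G.n + G.m + 1)
  have hpop := wp_popping_le (k := k) (M := M) (φ₀ := k + k * (A : ℝ≥0∞) + W)
    (f := wp k (.seq (.block [.add 16 13 6]) (.seq Prog.attempt (.block [.add 14 14 17]))) g)
    (Φ := fun S => k * (A : ℝ≥0∞) + if Disjoint (G.net.reach S v) (T.erase v) then F₀ else F₁)
    h0 hS hT hM.2 ?_ ?_
  · rw [Prog.trial, wp_seq]
    calc _ ≤ k + (k * (G.popCost : ℝ≥0∞) + (k + k * (A : ℝ≥0∞) + W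
          + k * (G.popCost : ℝ≥0∞) * M)) := by gcongr
      _ = k * ((G.popCost * (M + 1) + (A + 2) : ℕ) : ℝ≥0∞) + W := by push_cast; ring
      _ ≤ _ := steps_le (by
        have : A + 2 ≤ G.popCost := by simp only [A, popCost]; omega
        calc _ ≤ G.popCost * (M + 1) + G.popCost := by omega
          _ = _ := by ring)
  · simp only [← add_assoc]
    rw [FailNet.mean_rooted_ite_eq v hM.1]
  · intro S' τ h0τ hSτ h9 h10 hag
    have hb : exec [.add 16 13 6] τ = τ.setReg 16 v := by
      simp [exec, Cmd.det, h0τ.zero_eq, hag.1 13 (by decide), h13]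
    have hag' := agree_setReg 16 v τ
    have hatt := (attempt_runs (h0τ.agree hag' (by decide) (by decide))
      (hSτ.agree hag' (by decide)) (h9.agree hag' (by decide)) (x := v) (by simp)).frame
    have hrun : Runs (.seq (.block [.add 16 13 6]) (.seq Prog.attempt (.block [.add 14 14 17]))) τ
        A fun ρ => G.HoldsArcs S' ρ ∧ ρ.reg 14 = σ.reg 14
          + if Disjoint (G.net.reach S' v) (T.erase v) then 0 else 1 := by
      refine (Runs.block_seq rfl ?_ (T := 80 * (G.n + G.m + 1) + 3 + 1)).conseq
        (by simp [A]; omega) fun _ h => h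
      rw [hb]
      refine Runs.seq hatt ?_
      rintro ρ ⟨⟨-, -, h17⟩, hagρ⟩
      refine Runs.block rfl ⟨?_, ?_⟩
      · exact (((hSτ.agree hag' (by decide)).agree hagρ (by decide)).agree (agree_exec _ _)
          (by decide))
      · have h14 : ρ.reg 14 = σ.reg 14 := by
          rw [hagρ.1 14 (by decide), hag'.1 14 (by decide), hag.1 14 (by decide)]
        simp [exec, Cmd.det, h14, h17]
    refine hrun k g _ ?_
    rintro ρ ⟨h1, h2⟩
    by_cases hd : Disjoint (G.net.reach S' v) (T.erase v)
    · rw [if_pos hd]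
      exact hf₀ S' ρ h1 (by simpa [hd] using h2)
    · rw [if_neg hd]
      exact hf₁ S' ρ h1 (by simpa [hd] using h2)

end ReachInstance

theorem mul_runs {x y z a b : ℕ} {σ : Mem} (h5 : σ.reg 5 = 1) (h6 : σ.reg 6 = 0)
    (hy : σ.reg y = a) (hz : σ.reg z = b) (hy1 : y ≠ 23) (hy2 : y ≠ 24) (hz1 : z ≠ 23)
    (hz2 : z ≠ 24) : Runs (Prog.mul x y z) σ (6 * b + 12) fun τ => τ.reg x = a * b := by
  refine (Runs.block_seq rfl (Runs.seq (T₁ := b * 6 + 3) (P := fun τ => τ.reg 23 = b * a ∧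
    τ.reg 6 = 0) ?_ ?_ (T₂ := 3))).conseq (by simp; omega) fun _ h => h
  · have hb : exec [.const 23 0] σ = σ.setReg 23 0 := rfl
    rw [hb]
    refine (Runs.forLoop (t := 3) (fun j τ => τ.reg 23 = j * a) (by simp [hz1, hz])
      (by simp [h5]) (by simp [Cmd.regs, Cmd.block])
      (by simpa [Cmd.regs, Cmd.block] using hz1) (by simp [Cmd.regs, Cmd.block])
      hz2 (by decide) (fun j τ v h => by simpa using h) (by simp) ?_).frame.conseq le_rfl ?_
    · intro j τ hj hI h24 hag
      refine Runs.block rfl ?_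
      have : τ.reg y = a := by
        rw [hag.1 y (by simp [Cmd.regs, Cmd.block, hy1, hy2])]
        simp [hy1, hy]
      simp [exec, Cmd.det, hI, this]
      ring
    · rintro τ ⟨h1, hag⟩
      refine ⟨h1, ?_⟩
      rw [hag.1 6 (by simp [forLoop, Cmd.regs, Cmd.block])]
      simp [h6]
  · rintro τ ⟨h1, h2⟩
    refine Runs.block rfl ?_
    simp [exec, Cmd.det, h1, h2, mul_comm]

namespace ReachInstance

variable {G : ReachInstance}

/-- One level removes `v` from the target roots and multiplies the numerator and the denominator of
the estimate by the number of successes and by the number of trials. -/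
theorem wp_level_le {k : ℝ≥0∞} {M s a d j : ℕ} {T : Finset (Fin G.n)} {v : Fin G.n}
    {f : Mem → ℝ≥0∞} {Φ : ℕ → ℝ≥0∞} {σ : Mem} (h0 : G.Loaded σ)
    (hS : ∃ S, G.HoldsArcs S σ) (hT : G.HoldsSet 10 T σ) (h27 : σ.reg 27 - σ.reg 26 = j)
    (hv : σ.arr 11 j = v) (h9 : σ.reg 9 = s) (h10 : σ.reg 10 = a) (h11 : σ.reg 11 = d)
    (hM : G.PopBound M T)
    (hf : ∀ c τ, (∃ S, G.HoldsArcs S τ) → G.HoldsSet 10 (T.erase v) τ → τ.reg 10 = a * c →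
      τ.reg 11 = d * s → Agree Prog.level.regs Prog.level.arrs σ τ → f τ ≤ Φ c) :
    wp k Prog.level f σ ≤ k * ((s * (G.popCost * (M + 2) + 20) + 60 : ℕ) : ℝ≥0∞)
      + binExp (G.net.dropProb T v) s Φ 0 := by
  refine wp_frame fun g hgf hg0 => ?_
  replace hf : ∀ c τ, (∃ S, G.HoldsArcs S τ) → G.HoldsSet 10 (T.erase v) τ →
      τ.reg 10 = a * c → τ.reg 11 = d * s → g τ ≤ Φ c := by
    intro c τ h1 h2 h3 h4
    by_cases hag : Agree Prog.level.regs Prog.level.arrs σ τ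
    · exact (hgf τ).trans (hf c τ h1 h2 h3 h4 hag)
    · rw [hg0 τ hag]
      exact zero_le
  rw [Prog.level, wp_seq, wp_block _ _ _ _ rfl, wp_seq]
  set σ₁ := exec [.sub 12 27 26, .load 13 11 12, .const 14 0] σ with hσ₁
  have hag₁ := agree_exec [.sub 12 27 26, .load 13 11 12, .const 14 0] σ
  rw [← hσ₁] at hag₁
  have h0₁ := h0.agree hag₁ (by decide) (by decide)
  have hS₁ : ∃ S, G.HoldsArcs S σ₁ := hS.imp fun S h => h.agree hag₁ (by decide)
  have hT₁ := hT.agree hag₁ (by decide)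
  have h9₁ : σ₁.reg 9 = s := by rw [hag₁.1 9 (by decide), h9]
  have h10₁ : σ₁.reg 10 = a := by rw [hag₁.1 10 (by decide), h10]
  have h11₁ : σ₁.reg 11 = d := by rw [hag₁.1 11 (by decide), h11]
  have h13₁ : σ₁.reg 13 = v := by simp [hσ₁, exec, Cmd.det, h27, hv]
  have h14₁ : σ₁.reg 14 = 0 := by simp [hσ₁, exec, Cmd.det]
  have key := wp_forLoop_le (k := k) (σ := σ₁) (n := s) (t := G.popCost * (M + 2)) (i := 15)
    (N := 9) (c := Prog.trial)
    (f := wp k (.seq (.block [.store 10 13 6]) (.seq (Prog.mul 10 10 14) (Prog.mul 11 11 9))) g)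
    (fun j (c : ℕ) τ => c ≤ j ∧ τ.reg 14 = c ∧ ∃ S, G.HoldsArcs S τ)
    (fun j c => binExp (G.net.dropProb T v) (s - j) Φ c) (k * ((12 * s + 30 : ℕ) : ℝ≥0∞))
    h9₁ h0₁.one_eq (by decide) (by decide) (by decide) (by decide) (by decide)
    (fun j c τ v h => ⟨h.1, by simpa using h.2.1, h.2.2⟩) 0 ⟨le_rfl, h14₁, hS₁⟩ ?_ ?_
  · rw [Nat.sub_zero] at key
    calc _ ≤ k + (k * ((2 * 3 + 1 : ℕ) : ℝ≥0∞) + (k + (k * ((s * (G.popCost * (M + 2) + 3) + 3 : ℕ)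
          : ℝ≥0∞) + k * ((12 * s + 30 : ℕ) : ℝ≥0∞)
          + binExp (G.net.dropProb T v) s Φ 0))) := by
          refine add_le_add le_rfl (add_le_add ?_ (add_le_add le_rfl key))
          simp
      _ = k * ((s * (G.popCost * (M + 2) + 15) + 42 : ℕ) : ℝ≥0∞)
          + binExp (G.net.dropProb T v) s Φ 0 := by push_cast; ring
      _ ≤ _ := steps_le (by gcongr <;> omega)
  · rintro j c τ hj ⟨hcj, h14, S, hSτ⟩ h15 hag B h hh
    have hsj : s - j = (s - (j + 1)) + 1 := by omega
    have h0τ := h0₁.agree hag (by decide) (by decide)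
    have hTτ := hT₁.agree hag (by decide)
    have := wp_trial_le (k := k) (F₁ := B + binExp (G.net.dropProb T v) (s - (j + 1)) Φ (c + 1))
      (F₀ := B + binExp (G.net.dropProb T v) (s - (j + 1)) Φ c) h0τ hSτ hTτ
      (by rw [hag.1 13 (by decide), h13₁]) hM
      (fun S' ρ h1 h2 h3 => hh (c + 1) ρ ⟨by omega, by rw [h2, h14], S', h1⟩ h3)
      (fun S' ρ h1 h2 h3 => hh c ρ ⟨by omega, by rw [h2, h14], S', h1⟩ h3)
    refine this.trans (le_of_eq ?_)
    rw [hsj, binExp]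
    have hw : G.net.dropProb T v ≤ 1 := G.net.dropProb_le_one T v
    set w := G.net.dropProb T v
    have h1 : w + (1 - w) = 1 := add_tsub_cancel_of_le hw
    set b1 := binExp w (s - (j + 1)) Φ (c + 1)
    set b0 := binExp w (s - (j + 1)) Φ c
    calc _ = k * ((G.popCost * (M + 2) : ℕ) : ℝ≥0∞) + ((w + (1 - w)) * B
          + (w * b1 + (1 - w) * b0)) := by ring
      _ = _ := by rw [h1]; ring
  · rintro c τ ⟨hcs, h14, hSτ⟩ hag
    rw [Nat.sub_self, binExp]
    have h0τ := h0₁.agree hag (by decide) (by decide)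
    have hTτ := hT₁.agree hag (by decide)
    have hrun : Runs (.seq (.block [.store 10 13 6]) (.seq (Prog.mul 10 10 14)
        (Prog.mul 11 11 9))) τ (12 * s + 30) fun ρ => (∃ S, G.HoldsArcs S ρ) ∧
        G.HoldsSet 10 (T.erase v) ρ ∧ ρ.reg 10 = a * c ∧ ρ.reg 11 = d * s := by
      refine (Runs.block_seq rfl (Runs.seq (Runs.frame (mul_runs (a := a) (b := c) ?_ ?_ ?_ ?_
        (by decide) (by decide) (by decide) (by decide))) ?_ (T₂ := 6 * s + 12))).conseq
        (by simp; omega) fun _ h => h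
      · simp [exec, Cmd.det, h0τ.one_eq]
      · simp [exec, Cmd.det, h0τ.zero_eq]
      · simp [exec, Cmd.det, hag.1 10 (by decide), h10₁]
      · simp [exec, Cmd.det, h14]
      · rintro ρ ⟨hρ, hagρ⟩
        have hag₂ := agree_exec [.store 10 13 6] τ
        have h0ρ := (h0τ.agree hag₂ (by decide) (by decide)).agree hagρ (by decide) (by decide)
        refine (mul_runs (a := d) (b := s) h0ρ.one_eq h0ρ.zero_eq ?_ ?_ (by decide) (by decide)
          (by decide) (by decide)).frame.conseq le_rfl ?_
        · rw [hagρ.1 11 (by decide), hag₂.1 11 (by decide), hag.1 11 (by decide), h11₁]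
        · rw [hagρ.1 9 (by decide), hag₂.1 9 (by decide), hag.1 9 (by decide), h9₁]
        · rintro μ ⟨hμ, hagμ⟩
          refine ⟨hSτ.imp fun S h => ((h.agree hag₂ (by decide)).agree hagρ (by decide)).agree
            hagμ (by decide), ?_, by rw [hagμ.1 10 (by decide), hρ], hμ⟩
          refine HoldsSet.agree (HoldsSet.agree ?_ hagρ (by decide)) hagμ (by decide)
          intro u
          have h13 : τ.reg 13 = v := by rw [hag.1 13 (by decide), h13₁]
          by_cases hu : u = v
          · simp [exec, Cmd.det, h13, hu, h0τ.zero_eq]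
          · have hu' : (u : ℕ) ≠ v := fun h => hu (Fin.ext h)
            simpa [exec, Cmd.det, h13, hu, hu'] using hTτ u
    exact hrun k g _ fun ρ ⟨h1, h2, h3, h4⟩ => hf c ρ h1 h2 h3 h4

end ReachInstance

/-! ### Arc lists, rounding and the number of samples -/

/-- The quotient `B` is characterized by a Galois connection, to avoid division in `ℕ`. -/
theorem divCeil_runs {x a d A D B : ℕ} {σ : Mem} (h5 : σ.reg 5 = 1) (ha : σ.reg a = A)
    (hd : σ.reg d = D) (hx : x ≠ 23) (ha1 : a ≠ 23) (ha2 : a ≠ x) (hd1 : d ≠ 23) (hd2 : d ≠ x)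
    (hx5 : x ≠ 5) (hB : ∀ k, A ≤ k * D ↔ B ≤ k) :
    Runs (Prog.divCeil x a d) σ (6 * B + 10) fun τ => τ.reg x = B := by
  refine (Runs.block_seq rfl (Runs.loop (fun b τ => ∃ k, b = 6 * (B - k) + 1 ∧ k ≤ B ∧
    τ.reg 23 = k * D ∧ τ.reg x = k ∧ τ.reg a = A ∧ τ.reg d = D ∧ τ.reg 5 = 1) ?_ ?_ _ _
    ⟨0, rfl, ?_⟩)).conseq (by simp) fun _ h => h
  · rintro b τ ⟨k, rfl, hk, h23, hxk, haA, hdD, h5⟩ hg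
    rw [h23, haA] at hg
    have hkB : k < B := by
      by_contra h
      exact absurd ((hB k).2 (by omega)) (by omega)
    refine ⟨5, by omega, Runs.block rfl ⟨_, ?_, k + 1, rfl, by omega, ?_, ?_, ?_, ?_, ?_⟩⟩
    · omega
    · simp [exec, Cmd.det, h23, hdD, hx.symm, add_mul]
    · simp [exec, Cmd.det, hx, hxk, h5]
    · simp [exec, Cmd.det, ha1, ha2, haA]
    · simp [exec, Cmd.det, hd1, hd2, hdD]
    · simp [exec, Cmd.det, hx5.symm, h5]
  · rintro b τ ⟨k, rfl, hk, h23, hxk, haA, hdD, h5⟩ hg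
    rw [h23, haA] at hg
    have := (hB k).1 (by omega)
    exact ⟨by omega, by omega⟩
  · simp [exec, Cmd.det, hx.symm, ha1, ha2, hd1, hd2, hx5.symm, h5, ha, hd]

namespace ReachInstance

variable (G : ReachInstance)

/-- The least natural number that is at least `1` and at least `1 / (1 - p e)` for the first `j` arcs `e`. -/
def oddsUpTo : ℕ → ℕ
  | 0 => 1
  | j + 1 => if h : j < G.m then max (oddsUpTo j) ⌈(1 - G.p ⟨j, h⟩)⁻¹⌉₊ else oddsUpTo j

/-- The least natural number that is at least `1` and at least `1 / (1 - p e)` for all arcs `e`. -/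
def odds : ℕ := G.oddsUpTo G.m

variable {G}

theorem one_le_oddsUpTo (j : ℕ) : 1 ≤ G.oddsUpTo j := by
  induction j with
  | zero => exact le_rfl
  | succ j ih =>
    rw [oddsUpTo]
    split
    · exact ih.trans (le_max_left _ _)
    · exact ih

theorem ceil_le_oddsUpTo (e : Fin G.m) (j : ℕ) (he : (e : ℕ) < j) :
    ⌈(1 - G.p e)⁻¹⌉₊ ≤ G.oddsUpTo j := by
  induction j with
  | zero => omega
  | succ j ih =>
    rw [oddsUpTo]
    by_cases hej : (e : ℕ) = j
    · subst hej
      rw [dif_pos e.2]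
      exact le_max_right _ _
    · split
      · exact (ih (by omega)).trans (le_max_left _ _)
      · exact ih (by omega)

theorem ceil_le_odds (e : Fin G.m) : ⌈(1 - G.p e)⁻¹⌉₊ ≤ G.odds := ceil_le_oddsUpTo e G.m e.2

theorem oddsUpTo_cases (j : ℕ) :
    G.oddsUpTo j = 1 ∨ ∃ e, G.oddsUpTo j = ⌈(1 - G.p e)⁻¹⌉₊ := by
  induction j with
  | zero => exact Or.inl rfl
  | succ j ih =>
    rw [oddsUpTo]
    split
    · rename_i h
      rcases max_choice (G.oddsUpTo j) ⌈(1 - G.p ⟨j, h⟩)⁻¹⌉₊ with h' | h'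
      · rw [h']
        exact ih
      · rw [h']
        exact Or.inr ⟨_, rfl⟩
    · exact ih

theorem natCast_num_toNat {x : ℚ} (hx : 0 ≤ x) : ((x.num.toNat : ℕ) : ℚ) = x * x.den := by
  have : ((x.num.toNat : ℕ) : ℤ) = x.num := Int.toNat_of_nonneg (Rat.num_nonneg.2 hx)
  rw [Rat.mul_den_eq_num]
  exact_mod_cast this

theorem den_le_mul_iff (e : Fin G.m) (k : ℕ) :
    (G.p e).den ≤ k * ((G.p e).den - (G.p e).num.toNat) ↔ ⌈(1 - G.p e)⁻¹⌉₊ ≤ k := by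
  have hp := G.p_pos e
  have hp1 : 0 < 1 - G.p e := sub_pos.2 (G.p_lt_one e)
  have hden : (0 : ℚ) < (G.p e).den := by exact_mod_cast (G.p e).den_pos
  have hnum := natCast_num_toNat hp.le
  have hle : (G.p e).num.toNat ≤ (G.p e).den := by
    have : (((G.p e).num.toNat : ℕ) : ℚ) ≤ (G.p e).den := by
      rw [hnum]
      nlinarith
    exact_mod_cast this
  rw [Nat.ceil_le, inv_le_iff_one_le_mul₀ hp1, ← @Nat.cast_le ℚ, Nat.cast_mul, Nat.cast_sub hle,
    hnum]
  constructor
  · intro h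
    have : (1 : ℚ) * (G.p e).den ≤ k * (1 - G.p e) * (G.p e).den := by linarith
    exact le_of_mul_le_mul_right this hden
  · intro h
    nlinarith

theorem oddsBound_runs {σ : Mem} (h0 : G.Loaded σ) :
    Runs Prog.oddsBound σ (G.m * (6 * G.odds + 40) + 10) fun τ => τ.reg 7 = G.odds := by
  refine (Runs.block_seq rfl (Runs.forLoop (n := G.m) (t := 6 * G.odds + 30)
    (fun j τ => τ.reg 7 = G.oddsUpTo j) (by simp [exec, Cmd.det, h0.m_eq])
    (by simp [exec, Cmd.det, h0.one_eq]) (by decide) (by decide) (by decide) (by decide)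
    (by decide) (fun j τ v h => by simpa using h) (by simp [exec, Cmd.det, oddsUpTo]) ?_)).conseq
    (by simp; nlinarith) fun _ h => h
  intro j τ hj hI h18 hag
  have hag₀ := (agree_exec [.const 7 1] σ)
  have h0τ := (h0.agree hag₀ (by decide) (by decide)).agree hag (by decide) (by decide)
  let e : Fin G.m := ⟨j, hj⟩
  have hnum : τ.arr 2 j = _ := h0τ.num_eq e
  have hden : τ.arr 3 j = _ := h0τ.den_eq e
  have hK := ceil_le_odds e
  set τ₁ := exec [.load 21 3 18, .load 22 2 18, .sub 22 21 22] τ with hτ₁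
  refine (Runs.block_seq rfl (Runs.seq (divCeil_runs (A := (G.p e).den)
    (D := (G.p e).den - (G.p e).num.toNat) (B := ⌈(1 - G.p e)⁻¹⌉₊) ?_ ?_ ?_ (by decide) (by decide)
    (by decide) (by decide) (by decide) (by decide) (den_le_mul_iff e)).frame ?_
    (T₂ := 4))).conseq (by simp; omega) fun _ h => h
  · simp [exec, Cmd.det, h0τ.one_eq]
  · simp [exec, Cmd.det, h18, hden]
  · simp [exec, Cmd.det, h18, hden, hnum]
  · rintro ρ ⟨h25, hagρ⟩
    have h7 : ρ.reg 7 = G.oddsUpTo j := by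
      rw [hagρ.1 7 (by decide)]
      simpa [exec, Cmd.det] using hI
    have h6 : ρ.reg 6 = 0 := by
      rw [hagρ.1 6 (by decide)]
      simp [exec, Cmd.det, h0τ.zero_eq]
    have hs : G.oddsUpTo (j + 1) = max (G.oddsUpTo j) ⌈(1 - G.p e)⁻¹⌉₊ := by
      rw [oddsUpTo, dif_pos hj]
    refine Runs.branch (T := 3) (fun hlt => Runs.block rfl ?_) fun hlt =>
      (Runs.skip ?_).conseq (by omega) fun _ h => h
    · rw [h7, h25] at hlt
      rw [hs, max_eq_right hlt.le]
      simp [exec, Cmd.det, h6, h25]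
    · rw [h7, h25] at hlt
      rw [hs, max_eq_left (by omega), h7]

theorem buildLists_runs {σ : Mem} (hn : σ.reg 0 = G.n) (hm : σ.reg 1 = G.m) (h5 : σ.reg 5 = 1)
    (h6 : σ.reg 6 = 0) (ht : ∀ e : Fin G.m, σ.arr 0 e = G.tail e)
    (hh : ∀ e : Fin G.m, σ.arr 1 e = G.head e)
    (hnum : ∀ e : Fin G.m, σ.arr 2 e = (G.p e).num.toNat)
    (hden : ∀ e : Fin G.m, σ.arr 3 e = (G.p e).den) (h4 : ∀ i, σ.arr 4 i = 0) :
    Runs Prog.buildLists σ (G.m * 14 + 3) G.Loaded := by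
  refine (Runs.forLoop (n := G.m) (t := 11) (fun j τ => (∀ u : Fin G.n,
    τ.arr 4 u = G.lastArc u j) ∧ ∀ e : Fin G.m, (e : ℕ) < j → τ.arr 5 e = G.lastArc (G.tail e) e)
    hm h5 (by decide) (by decide) (by decide) (by decide) (by decide) (fun _ _ _ h => h)
    ⟨fun u => by rw [h4]; rfl, fun e he => by omega⟩ ?_).frame.conseq le_rfl ?_
  · rintro j τ hj ⟨hf, hx⟩ h18 hag
    let e : Fin G.m := ⟨j, hj⟩
    have hte : τ.arr 0 j = G.tail e := by rw [hag.2 0 (by decide)]; exact ht e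
    have h5τ : τ.reg 5 = 1 := by rw [hag.1 5 (by decide), h5]
    refine Runs.block rfl ⟨fun u => ?_, fun a ha => ?_⟩
    · rw [lastArc]
      by_cases hu : G.tail e = u
      · rw [if_pos ⟨hj, hu⟩]
        simp [exec, Cmd.det, h18, hte, hu, h5τ]
      · rw [if_neg fun h => hu h.2]
        have hu' : (u : ℕ) ≠ G.tail e := fun h => hu (Fin.ext h.symm)
        simpa [exec, Cmd.det, h18, hte, hu'] using hf u
    · by_cases haj : (a : ℕ) = j
      · obtain rfl : a = e := Fin.ext haj
        simp [exec, Cmd.det, h18, hte, hf, e]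
      · simpa [exec, Cmd.det, h18, haj] using hx a (by omega)
  · rintro τ ⟨⟨hf, hx⟩, hag⟩
    refine ⟨by rw [hag.1 0 (by decide), hn], by rw [hag.1 1 (by decide), hm],
      by rw [hag.1 5 (by decide), h5], by rw [hag.1 6 (by decide), h6],
      by rw [hag.2 0 (by decide)]; exact ht, by rw [hag.2 1 (by decide)]; exact hh,
      by rw [hag.2 2 (by decide)]; exact hnum, by rw [hag.2 3 (by decide)]; exact hden,
      hf, fun e => hx e e.2⟩

variable (G) in
/-- The number of samples per level, for accuracy `ε`. The success probability of a sample being at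
least `1 / odds`, the relative variance of one factor is at most `odds / samples ≤ ε ^ 2 / (8 * n)`. -/
def samples (ε : ℚ) : ℕ := 8 * G.n * ⌈ε⁻¹⌉₊ * ⌈ε⁻¹⌉₊ * G.odds

theorem sampleCount_runs {σ : Mem} {ε : ℚ} (hε : 0 < ε) (h0 : G.Loaded σ)
    (h3 : σ.reg 3 = ε.num.toNat) (h4 : σ.reg 4 = ε.den) :
    Runs Prog.sampleCount σ
      (G.m * (6 * G.odds + 40) + 6 * G.n + 18 * ⌈ε⁻¹⌉₊ + 6 * G.odds + 100)
      fun τ => τ.reg 9 = G.samples ε := by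
  have hdiv : ∀ k, ε.den ≤ k * ε.num.toNat ↔ ⌈ε⁻¹⌉₊ ≤ k := by
    intro k
    have hden : (0 : ℚ) < ε.den := by exact_mod_cast ε.den_pos
    rw [Nat.ceil_le, inv_le_iff_one_le_mul₀ hε, ← @Nat.cast_le ℚ, Nat.cast_mul,
      natCast_num_toNat hε.le]
    constructor
    · intro h
      have : (1 : ℚ) * ε.den ≤ k * ε * ε.den := by linarith
      exact le_of_mul_le_mul_right this hden
    · intro h
      nlinarith
  set B := ⌈ε⁻¹⌉₊
  refine (Runs.seq (oddsBound_runs h0).frame (T₂ := 6 * G.n + 18 * B + 6 * G.odds + 80)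
    ?_).conseq (by omega) fun _ h => h
  rintro τ₁ ⟨e7, hag₁⟩
  have h0₁ := h0.agree hag₁ (by decide) (by decide)
  refine (Runs.seq (divCeil_runs (B := B) (x := 8) (a := 4) (d := 3) h0₁.one_eq
    (by rw [hag₁.1 4 (by decide), h4]) (by rw [hag₁.1 3 (by decide), h3]) (by decide) (by decide)
    (by decide) (by decide) (by decide) (by decide) hdiv).frame
    (T₂ := 6 * G.n + 12 * B + 6 * G.odds + 60) ?_).conseq (by omega) fun _ h => h
  rintro τ₂ ⟨e8, hag₂⟩
  have h0₂ := h0₁.agree hag₂ (by decide) (by decide)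
  have e7₂ : τ₂.reg 7 = G.odds := by rw [hag₂.1 7 (by decide), e7]
  refine (Runs.block_seq rfl (T := 6 * G.n + 12 * B + 6 * G.odds + 56) ?_).conseq
    (by simp) fun _ h => h
  have hag₃ := agree_exec [.const 9 8] τ₂
  have h0₃ := h0₂.agree hag₃ (by decide) (by decide)
  refine (Runs.seq (mul_runs (a := 8) (b := G.n) h0₃.one_eq h0₃.zero_eq
    (by simp [exec, Cmd.det]) h0₃.n_eq (by decide) (by decide) (by decide) (by decide)).frame
    (T₂ := 12 * B + 6 * G.odds + 40) ?_).conseq (by omega) fun _ h => h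
  rintro τ₄ ⟨e9, hag₄⟩
  have h0₄ := h0₃.agree hag₄ (by decide) (by decide)
  have e8₄ : τ₄.reg 8 = B := by rw [hag₄.1 8 (by decide), hag₃.1 8 (by decide), e8]
  have e7₄ : τ₄.reg 7 = G.odds := by rw [hag₄.1 7 (by decide), hag₃.1 7 (by decide), e7₂]
  refine (Runs.seq (mul_runs h0₄.one_eq h0₄.zero_eq e9 e8₄ (by decide) (by decide) (by decide)
    (by decide)).frame (T₂ := 6 * B + 6 * G.odds + 26) ?_).conseq (by omega) fun _ h => h
  rintro τ₅ ⟨e9, hag₅⟩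
  have h0₅ := h0₄.agree hag₅ (by decide) (by decide)
  have e8₅ : τ₅.reg 8 = B := by rw [hag₅.1 8 (by decide), e8₄]
  have e7₅ : τ₅.reg 7 = G.odds := by rw [hag₅.1 7 (by decide), e7₄]
  refine (Runs.seq (mul_runs h0₅.one_eq h0₅.zero_eq e9 e8₅ (by decide) (by decide) (by decide)
    (by decide)).frame (T₂ := 6 * G.odds + 12) ?_).conseq (by omega) fun _ h => h
  rintro τ₆ ⟨e9, hag₆⟩
  have h0₆ := h0₅.agree hag₆ (by decide) (by decide)
  exact mul_runs h0₆.one_eq h0₆.zero_eq e9 (by rw [hag₆.1 7 (by decide), e7₅]) (by decide)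
    (by decide) (by decide) (by decide)

/-! ### The whole program -/

variable (G) in
/-- The ratio of connection probabilities that the level of the vertex `Q (r + 1)` estimates. -/
def levelProb (Q : ℕ → Fin G.n) (r : ℕ) : ℝ≥0∞ :=
  G.net.dropProb ((Finset.range (r + 2)).image Q) (Q (r + 1))

/-- The last vertex of an initial segment of the search order is removed. -/
theorem SearchOrder.image_erase {S : Finset (Fin G.m)} {x : Fin G.n} {h : ℕ} {Q : ℕ → Fin G.n}
    (hQ : G.SearchOrder S x h Q) {r : ℕ} (hr : r < h) :
    ((Finset.range (r + 1)).image Q).erase (Q r) = (Finset.range r).image Q := by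
  rw [Finset.range_add_one, Finset.image_insert, Finset.erase_insert]
  intro hmem
  obtain ⟨i, hi, hir⟩ := Finset.mem_image.1 hmem
  have := hQ.inj i (by simp at hi; omega) r hr hir
  simp at hi
  omega

/-- The levels run through the search order backwards: before the `i`-th pass the target roots are the
first `n - i` vertices, and the denominator is `s ^ i`. -/
theorem wp_estimate_le {k : ℝ≥0∞} {M s : ℕ} {S₀ : Finset (Fin G.m)} {Q : ℕ → Fin G.n}
    {f : Mem → ℝ≥0∞} {Φ : ℕ → ℝ≥0∞} {σ : Mem} (h0 : G.Loaded σ) (hS : ∃ S, G.HoldsArcs S σ)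
    (hQ : G.SearchOrder S₀ G.root G.n Q) (hq : ∀ i < G.n, σ.arr 8 i = Q i) (h9 : σ.reg 9 = s)
    (hM : ∀ T, G.root ∈ T → G.PopBound M T)
    (hf : ∀ a τ, τ.reg 0 = a → τ.reg 1 = s ^ (G.n - 1) → f τ ≤ Φ a) :
    wp k Prog.estimate f σ
      ≤ k * ((G.n * (s * (G.popCost * (M + 2) + 20) + 100) + 40 : ℕ) : ℝ≥0∞)
        + prodExp (G.levelProb Q) s Φ (G.n - 1) 1 := by
  have hn : 0 < G.n := hQ.pos
  have hcopy : Runs (forLoop 18 0 (.block [.load 21 8 18, .store 11 18 21, .store 10 18 5])) σ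
      (G.n * 10 + 3) fun τ => (∀ i < G.n, τ.arr 11 i = Q i) ∧ G.HoldsSet 10 Finset.univ τ := by
    refine (Runs.forLoop (n := G.n) (t := 7) (fun j τ => ∀ i < j, τ.arr 11 i = Q i ∧
      τ.arr 10 i = 1) h0.n_eq h0.one_eq (by decide) (by decide) (by decide) (by decide) (by decide)
      (fun _ _ _ h => h) (fun i hi => by omega) ?_).conseq le_rfl fun τ hτ => ?_
    · intro j τ hj hI h18 hag
      have h0τ := h0.agree hag (by decide) (by decide)
      have h8 : τ.arr 8 j = Q j := by rw [hag.2 8 (by decide), hq j hj]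
      refine Runs.block rfl fun i hi => ?_
      by_cases hij : i = j
      · simp [exec, Cmd.det, h18, hij, h8, h0τ.one_eq]
      · simpa [exec, Cmd.det, h18, hij] using hI i (by omega)
    · exact ⟨fun i hi => (hτ i hi).1, fun u => by simpa using (hτ u u.2).2⟩
  let t : ℕ := s * (G.popCost * (M + 2) + 20) + 60
  refine (wp_le_of_runs_seq hcopy.frame (F := k * (((G.n - 1) * (t + 3) + 30 : ℕ) : ℝ≥0∞)
    + prodExp (G.levelProb Q) s Φ (G.n - 1) 1) ?_).trans ?_
  · rintro τ ⟨⟨h11, h10⟩, hag⟩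
    have h0τ := h0.agree hag (by decide) (by decide)
    have hSτ : ∃ S, G.HoldsArcs S τ := hS.imp fun S h => h.agree hag (by decide)
    rw [wp_seq, wp_block _ _ _ _ rfl, wp_seq]
    set τ₁ := exec [.const 10 1, .const 11 1, .sub 27 0 5] τ with hτ₁
    have hag₁ := agree_exec [.const 10 1, .const 11 1, .sub 27 0 5] τ
    rw [← hτ₁] at hag₁
    have h0₁ := h0τ.agree hag₁ (by decide) (by decide)
    have h27 : τ₁.reg 27 = G.n - 1 := by
      simp [hτ₁, exec, Cmd.det, h0τ.n_eq, h0τ.one_eq]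
    have h9₁ : τ₁.reg 9 = s := by rw [hag₁.1 9 (by decide), hag.1 9 (by decide), h9]
    have huniv : (Finset.range G.n).image Q = Finset.univ := by
      rw [← Finset.card_eq_iff_eq_univ, hQ.card, Fintype.card_fin]
    have key := wp_forLoop_le (k := k) (σ := τ₁) (n := G.n - 1) (t := t) (i := 26) (N := 27)
      (c := Prog.level) (f := wp k (.block [.add 0 10 6, .add 1 11 6]) f)
      (fun i (a : ℕ) ρ => (∃ S, G.HoldsArcs S ρ) ∧
        G.HoldsSet 10 ((Finset.range (G.n - i)).image Q) ρ ∧ ρ.reg 10 = a ∧ ρ.reg 11 = s ^ i)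
      (fun i a => prodExp (G.levelProb Q) s Φ (G.n - 1 - i) a) (k * ((5 : ℕ) : ℝ≥0∞))
      h27 h0₁.one_eq (by decide) (by decide) (by decide) (by decide) (by decide)
      (fun i a ρ v h => ⟨h.1, h.2.1, by simpa using h.2.2.1, by simpa using h.2.2.2⟩) 1
      ⟨hSτ.imp fun S h => h.agree hag₁ (by decide), ?_, by simp [hτ₁, exec, Cmd.det],
        by simp [hτ₁, exec, Cmd.det]⟩ ?_ ?_
    · rw [Nat.sub_zero] at key
      calc _ ≤ k + (k * ((2 * 3 + 1 : ℕ) : ℝ≥0∞) + (k + (k * (((G.n - 1) * (t + 3) + 3 : ℕ)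
            : ℝ≥0∞) + k * ((5 : ℕ) : ℝ≥0∞) + prodExp (G.levelProb Q) s Φ (G.n - 1) 1))) := by
            refine add_le_add le_rfl (add_le_add ?_ (add_le_add le_rfl key))
            simp
        _ = k * (((G.n - 1) * (t + 3) + 17 : ℕ) : ℝ≥0∞)
            + prodExp (G.levelProb Q) s Φ (G.n - 1) 1 := by push_cast; ring
        _ ≤ _ := steps_le (by omega)
    · rw [Nat.sub_zero, huniv]
      exact h10.agree hag₁ (by decide)
    · rintro i a ρ hi ⟨hSρ, hTρ, e10, e11⟩ h26 hagρ B g hg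
      obtain ⟨r, hr⟩ : ∃ r, G.n - 1 - i = r + 1 := ⟨G.n - 1 - i - 1, by omega⟩
      have hr1 : G.n - 1 - (i + 1) = r := by omega
      have hr2 : G.n - i = r + 2 := by omega
      have hr3 : G.n - (i + 1) = r + 1 := by omega
      rw [hr2] at hTρ
      have h0ρ := h0₁.agree hagρ (by decide) (by decide)
      have hlev := wp_level_le (k := k) (M := M) (s := s) (a := a) (d := s ^ i) (j := r + 1)
        (v := Q (r + 1)) (f := g) (Φ := fun c => B + prodExp (G.levelProb Q) s Φ r (a * c))
        h0ρ hSρ hTρ (by rw [hagρ.1 27 (by decide), h27, h26, hr])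
        (by rw [hagρ.2 11 (by decide), hag₁.2 11 (by decide), h11 _ (by omega)])
        (by rw [hagρ.1 9 (by decide), h9₁]) e10 e11
        (hM _ (Finset.mem_image.2 ⟨0, by simp, hQ.zero⟩)) ?_
      · rw [binExp_const_add (G.net.dropProb_le_one _ _)] at hlev
        rw [hr, prodExp, add_assoc]
        exact hlev
      · intro c μ h1 h2 h3 h4 h5
        rw [hQ.image_erase (by omega)] at h2
        have := hg (a * c) μ ⟨h1, by rwa [hr3], h3, by rw [h4, pow_succ]⟩ h5
        rwa [hr1] at this
    · rintro a ρ ⟨-, -, e10, e11⟩ hagρ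
      have h0ρ := h0₁.agree hagρ (by decide) (by decide)
      rw [wp_block _ _ _ _ rfl, Nat.sub_self, prodExp]
      refine add_le_add (by simp) (hf a _ ?_ ?_)
      · simp [exec, Cmd.det, e10, h0ρ.zero_eq]
      · simp [exec, Cmd.det, e11, h0ρ.zero_eq]
  · calc _ = k * ((G.n * 10 + 3 + 1 + ((G.n - 1) * (t + 3) + 30) : ℕ) : ℝ≥0∞)
          + prodExp (G.levelProb Q) s Φ (G.n - 1) 1 := by push_cast; ring
      _ ≤ _ := steps_le (by
        have h1 : (G.n - 1) * (t + 3) ≤ G.n * (t + 3) := Nat.mul_le_mul_right _ (by omega)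
        have h2 : G.n * (t + 3) + G.n * 37 = G.n * (s * (G.popCost * (M + 2) + 20) + 100) := by
          simp only [t]; ring
        omega)

end ReachInstance

namespace ReachInstance

variable {G : ReachInstance}

variable (G) in
/-- A bound for the running time up to the decision whether the graph is connected. -/
def prepTime (ε : ℚ) : ℕ :=
  G.m * (6 * G.odds + 54) + 6 * G.n + 18 * ⌈ε⁻¹⌉₊ + 6 * G.odds + 50 * (G.n + G.m + 1) + 130

/-- Up to the decision whether the root reaches all vertices. No sample has been taken by then: the
array of failed arcs is still zero, so that the search uses all arcs. -/
theorem wp_main_le {k F : ℝ≥0∞} {ε : ℚ} {f : Mem → ℝ≥0∞} (hε : 0 < ε)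
    (h : ∀ τ, G.Loaded τ → G.HoldsArcs Finset.univ τ → τ.reg 9 = G.samples ε →
      τ.reg 20 = (G.net.reach Finset.univ G.root).card →
      (∃ Q, G.SearchOrder Finset.univ G.root (τ.reg 20) Q ∧ ∀ i < τ.reg 20, τ.arr 8 i = Q i) →
      wp k (.branch 20 0 (.block [.const 0 0, .const 1 1]) Prog.estimate) f τ ≤ F) :
    wp k Prog.main f (G.encode ε) ≤ k * (G.prepTime ε : ℝ≥0∞) + F := by
  have e5 : ∀ e : Fin G.m, (G.encode ε).arr 0 e = G.tail e := fun e => by simp [encode]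
  have e6 : ∀ i, (G.encode ε).arr 6 i = 0 := fun i => by simp [encode]
  rw [Prog.main, wp_seq, wp_block _ _ _ _ rfl]
  have hag₀ := agree_exec [.const 5 1] (G.encode ε)
  set σ₀ := exec [.const 5 1] (G.encode ε) with hσ₀
  have hlists : Runs Prog.buildLists σ₀ (G.m * 14 + 3) G.Loaded := by
    refine buildLists_runs ?_ ?_ ?_ ?_ ?_ ?_ ?_ ?_ ?_ <;>
      simp [hσ₀, exec, Cmd.det, encode]
  let t₁ := G.m * (6 * G.odds + 40) + 6 * G.n + 18 * ⌈ε⁻¹⌉₊ + 6 * G.odds + 100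
  let t₂ := 50 * (G.n + G.m + 1)
  calc _ ≤ k + (k * ((2 * 1 + 1 : ℕ) : ℝ≥0∞) + (k * ((G.m * 14 + 3 + 1 : ℕ) : ℝ≥0∞)
        + (k * ((t₁ + 1 : ℕ) : ℝ≥0∞) + (k + (k * ((2 * 1 + 1 : ℕ) : ℝ≥0∞)
        + (k * ((t₂ + 1 : ℕ) : ℝ≥0∞) + F)))))) := ?_
    _ = k * ((G.m * 14 + t₁ + t₂ + 14 : ℕ) : ℝ≥0∞) + F := by push_cast; ring
    _ ≤ _ := steps_le (by
        have : G.m * (6 * G.odds + 54) = G.m * 14 + G.m * (6 * G.odds + 40) := by ring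
        simp only [t₁, t₂, prepTime]
        omega)
  refine add_le_add le_rfl (add_le_add (by simp) (wp_le_of_runs_seq hlists.frame ?_))
  rintro τ₁ ⟨h0₁, hag₁⟩
  have e3 : τ₁.reg 3 = ε.num.toNat := by
    rw [hag₁.1 3 (by decide), hag₀.1 3 (by decide)]; simp only [encode]
  have e4 : τ₁.reg 4 = ε.den := by
    rw [hag₁.1 4 (by decide), hag₀.1 4 (by decide)]; simp only [encode]
  refine wp_le_of_runs_seq (sampleCount_runs hε h0₁ e3 e4).frame ?_
  rintro τ₂ ⟨e9, hag₂⟩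
  have h0₂ := h0₁.agree hag₂ (by decide) (by decide)
  rw [wp_seq, wp_block _ _ _ _ rfl]
  have hag₃ := agree_exec [.add 16 2 6] τ₂
  set τ₃ := exec [.add 16 2 6] τ₂ with hτ₃
  have h0₃ := h0₂.agree hag₃ (by decide) (by decide)
  have hS₃ : G.HoldsArcs Finset.univ τ₃ := by
    intro e
    rw [hag₃.2 6 (by decide), hag₂.2 6 (by decide), hag₁.2 6 (by decide), hag₀.2 6 (by decide), e6]
    simp
  have h16 : τ₃.reg 16 = G.root := by
    have : τ₂.reg 2 = G.root := by
      rw [hag₂.1 2 (by decide), hag₁.1 2 (by decide), hag₀.1 2 (by decide)]; simp only [encode]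
    simp [hτ₃, exec, Cmd.det, this, h0₂.zero_eq]
  refine add_le_add le_rfl (add_le_add (by simp) (wp_le_of_runs_seq
    (search_runs h0₃ hS₃ h16).frame ?_))
  rintro τ ⟨⟨-, Q, hQ, hq, h20⟩, hag⟩
  exact h τ (h0₃.agree hag (by decide) (by decide)) (hS₃.agree hag (by decide))
    (by rw [hag.1 9 (by decide), hag₃.1 9 (by decide), e9]) h20 ⟨Q, hQ, hq⟩

theorem wp_main_le_of_not_connected {k F : ℝ≥0∞} {ε : ℚ} {f : Mem → ℝ≥0∞} (hε : 0 < ε)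
    (hG : G.net.reach Finset.univ G.root ≠ Finset.univ)
    (hf : ∀ τ, τ.reg 0 = 0 → τ.reg 1 = 1 → f τ ≤ F) :
    wp k Prog.main f (G.encode ε) ≤ k * ((G.prepTime ε + 10 : ℕ) : ℝ≥0∞) + F := by
  refine (wp_main_le (F := k * ((6 : ℕ) : ℝ≥0∞) + F) hε ?_).trans ?_
  · intro τ h0 hS h9 h20 hQ
    have hlt : τ.reg 20 < τ.reg 0 := by
      rw [h20, h0.n_eq]
      simpa using (Finset.card_lt_iff_ne_univ _).2 hG
    rw [wp_branch, if_pos hlt, wp_block _ _ _ _ rfl]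
    calc _ ≤ k + (k * ((2 * 2 + 1 : ℕ) : ℝ≥0∞) + F) := by
          refine add_le_add le_rfl (add_le_add (by simp) (hf _ ?_ ?_)) <;>
            simp [exec, Cmd.det]
      _ = _ := by push_cast; ring
  · calc _ = k * ((G.prepTime ε + 6 : ℕ) : ℝ≥0∞) + F := by push_cast; ring
      _ ≤ _ := steps_le (by omega)

theorem wp_main_le_of_connected {k F : ℝ≥0∞} {ε : ℚ} {f : Mem → ℝ≥0∞} {Φ : ℕ → ℝ≥0∞} {M : ℕ}
    (hε : 0 < ε) (hG : G.net.reach Finset.univ G.root = Finset.univ)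
    (hM : ∀ T, G.root ∈ T → G.PopBound M T)
    (hf : ∀ a τ, τ.reg 0 = a → τ.reg 1 = G.samples ε ^ (G.n - 1) → f τ ≤ Φ a)
    (hΦ : ∀ Q, G.SearchOrder Finset.univ G.root G.n Q →
      prodExp (G.levelProb Q) (G.samples ε) Φ (G.n - 1) 1 ≤ F) :
    wp k Prog.main f (G.encode ε) ≤ k * ((G.prepTime ε
      + G.n * (G.samples ε * (G.popCost * (M + 2) + 20) + 100) + 50 : ℕ) : ℝ≥0∞) + F := by
  let t := G.n * (G.samples ε * (G.popCost * (M + 2) + 20) + 100) + 40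
  refine (wp_main_le (F := k * ((t + 1 : ℕ) : ℝ≥0∞) + F) hε ?_).trans ?_
  · rintro τ h0 hS h9 h20 ⟨Q, hQ, hq⟩
    rw [hG, Finset.card_univ, Fintype.card_fin] at h20
    rw [h20] at hQ hq
    have hlt : ¬ τ.reg 20 < τ.reg 0 := by rw [h20, h0.n_eq]; omega
    rw [wp_branch, if_neg hlt]
    calc _ ≤ k + (k * (t : ℝ≥0∞) + F) := by
          refine add_le_add le_rfl ((wp_estimate_le h0 ⟨_, hS⟩ hQ hq h9 hM hf).trans ?_)
          exact add_le_add le_rfl (hΦ Q hQ)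
      _ = _ := by push_cast; ring
  · calc _ = k * ((G.prepTime ε + (t + 1) : ℕ) : ℝ≥0∞) + F := by push_cast; ring
      _ ≤ _ := steps_le (by simp only [t]; omega)

end ReachInstance

/-! ### Chebyshev's inequality for the product estimator -/

/-- The expectation of a quadratic function of `c + X` for a binomial `X`, by its first two moments.
The nonnegativity of the values justifies the computation in the reals. -/
theorem binExp_quadratic {ρ : ℝ} (h0 : 0 ≤ ρ) (h1 : ρ ≤ 1) {α β γ : ℝ}
    (h : ∀ c : ℕ, 0 ≤ α * (c : ℝ) ^ 2 - β * c + γ) (r : ℕ) : ∀ c : ℕ,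
    0 ≤ α * ((c + r * ρ) ^ 2 + r * ρ * (1 - ρ)) - β * (c + r * ρ) + γ ∧
    binExp (ENNReal.ofReal ρ) r (fun c => ENNReal.ofReal (α * (c : ℝ) ^ 2 - β * c + γ)) c
      = ENNReal.ofReal (α * ((c + r * ρ) ^ 2 + r * ρ * (1 - ρ)) - β * (c + r * ρ) + γ) := by
  induction r with
  | zero =>
    intro c
    simpa [binExp] using h c
  | succ r ih =>
    intro c
    obtain ⟨p1, e1⟩ := ih (c + 1)
    obtain ⟨p0, e0⟩ := ih c
    have key : α * ((c + (r + 1 : ℕ) * ρ) ^ 2 + (r + 1 : ℕ) * ρ * (1 - ρ))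
        - β * (c + (r + 1 : ℕ) * ρ) + γ
        = ρ * (α * (((c + 1 : ℕ) + r * ρ) ^ 2 + r * ρ * (1 - ρ)) - β * ((c + 1 : ℕ) + r * ρ) + γ)
          + (1 - ρ) * (α * ((c + r * ρ) ^ 2 + r * ρ * (1 - ρ)) - β * (c + r * ρ) + γ) := by
      push_cast
      ring
    have h1' : 0 ≤ 1 - ρ := sub_nonneg.2 h1
    refine ⟨?_, ?_⟩
    · rw [key]
      exact add_nonneg (mul_nonneg h0 p1) (mul_nonneg h1' p0)
    · rw [binExp, e1, e0, key, ENNReal.ofReal_add (mul_nonneg h0 p1) (mul_nonneg h1' p0),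
        ENNReal.ofReal_mul h0, ENNReal.ofReal_mul h1', ENNReal.ofReal_sub _ h0, ENNReal.ofReal_one]

/-- The expectation of a quadratic function of the product estimator, by its first two moments. -/
theorem prodExp_quadratic {ρ : ℕ → ℝ} (h0 : ∀ i, 0 ≤ ρ i) (h1 : ∀ i, ρ i ≤ 1) (s : ℕ)
    {α β γ : ℝ} (h : ∀ c : ℕ, 0 ≤ α * (c : ℝ) ^ 2 - β * c + γ) (r : ℕ) : ∀ a : ℕ,
    0 ≤ α * (∏ i ∈ Finset.range r, ((s * ρ i) ^ 2 + s * ρ i * (1 - ρ i))) * (a : ℝ) ^ 2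
      - β * (∏ i ∈ Finset.range r, (s * ρ i)) * a + γ ∧
    prodExp (fun i => ENNReal.ofReal (ρ i)) s
        (fun c => ENNReal.ofReal (α * (c : ℝ) ^ 2 - β * c + γ)) r a
      = ENNReal.ofReal (α * (∏ i ∈ Finset.range r, ((s * ρ i) ^ 2 + s * ρ i * (1 - ρ i)))
        * (a : ℝ) ^ 2 - β * (∏ i ∈ Finset.range r, (s * ρ i)) * a + γ) := by
  induction r with
  | zero =>
    intro a
    simpa [prodExp] using h a
  | succ r ih =>
    intro a
    set X := ∏ i ∈ Finset.range r, ((s * ρ i) ^ 2 + s * ρ i * (1 - ρ i))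
    set Y := ∏ i ∈ Finset.range r, (s * ρ i)
    have hc : ∀ c : ℕ, α * X * ((a * c : ℕ) : ℝ) ^ 2 - β * Y * (a * c : ℕ) + γ
        = (α * X * (a : ℝ) ^ 2) * (c : ℝ) ^ 2 - (β * Y * a) * c + γ := by
      intro c
      push_cast
      ring
    obtain ⟨p, e⟩ := binExp_quadratic (h0 r) (h1 r) (α := α * X * (a : ℝ) ^ 2) (β := β * Y * a)
      (γ := γ) (fun c => by rw [← hc]; exact (ih (a * c)).1) s 0
    have key : α * (X * ((s * ρ r) ^ 2 + s * ρ r * (1 - ρ r))) * (a : ℝ) ^ 2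
        - β * (Y * (s * ρ r)) * a + γ
        = α * X * (a : ℝ) ^ 2 * (((0 : ℕ) + s * ρ r) ^ 2 + s * ρ r * (1 - ρ r))
          - β * Y * a * ((0 : ℕ) + s * ρ r) + γ := by
      push_cast
      ring
    rw [Finset.prod_range_succ, Finset.prod_range_succ, key]
    refine ⟨p, ?_⟩
    rw [prodExp, ← e]
    congr 1
    funext c
    rw [(ih (a * c)).2, hc]

/-- The relative variance of the product estimator is at most `ε ^ 2 / 4`. Each factor has relative
variance at most `ε ^ 2 / (8 * n)`, and `(1 + ε ^ 2 / (8 * n)) ^ n ≤ exp (ε ^ 2 / 8)`. -/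
theorem prod_secondMoment_le {ρ : ℕ → ℝ} {r n s : ℕ} {ε : ℝ} (hε : 0 < ε) (hε1 : ε ≤ 1) (hr : r ≤ n)
    (hn : 0 < n) (h0 : ∀ i, 0 ≤ ρ i) (h1 : ∀ i, ρ i ≤ 1)
    (hs : ∀ i < r, 8 * n ≤ ε ^ 2 * (s * ρ i)) :
    ∏ i ∈ Finset.range r, ((s * ρ i) ^ 2 + s * ρ i * (1 - ρ i))
      ≤ (1 + ε ^ 2 / 4) * (∏ i ∈ Finset.range r, (s * ρ i)) ^ 2 := by
  have hn' : (0 : ℝ) < n := by exact_mod_cast hn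
  have hle : ∀ i ∈ Finset.range r, (s * ρ i) ^ 2 + s * ρ i * (1 - ρ i)
      ≤ (1 + ε ^ 2 / (8 * n)) * (s * ρ i) ^ 2 := by
    intro i hi
    have h := hs i (Finset.mem_range.1 hi)
    have hpos : 0 ≤ s * ρ i := mul_nonneg s.cast_nonneg (h0 i)
    have h2 : s * ρ i ≤ ε ^ 2 / (8 * n) * (s * ρ i) ^ 2 := by
      rw [div_mul_eq_mul_div, le_div_iff₀ (by positivity)]
      nlinarith
    nlinarith [mul_nonneg hpos (h0 i)]
  calc _ ≤ ∏ i ∈ Finset.range r, (1 + ε ^ 2 / (8 * n)) * (s * ρ i) ^ 2 := by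
        refine Finset.prod_le_prod (fun i hi => ?_) hle
        have hpos : 0 ≤ s * ρ i := mul_nonneg s.cast_nonneg (h0 i)
        have h1' : 0 ≤ 1 - ρ i := sub_nonneg.2 (h1 i)
        positivity
    _ = (1 + ε ^ 2 / (8 * n)) ^ r * (∏ i ∈ Finset.range r, (s * ρ i)) ^ 2 := by
        rw [Finset.prod_mul_distrib, Finset.prod_const, Finset.card_range, Finset.prod_pow]
    _ ≤ _ := by
        refine mul_le_mul_of_nonneg_right ?_ (sq_nonneg _)
        have hx : 0 ≤ ε ^ 2 / (8 * n) := by positivity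
        calc (1 + ε ^ 2 / (8 * n)) ^ r ≤ (1 + ε ^ 2 / (8 * n)) ^ n :=
              pow_le_pow_right₀ (by linarith) hr
          _ ≤ (Real.exp (ε ^ 2 / (8 * n))) ^ n := by
              gcongr
              rw [add_comm]
              exact Real.add_one_le_exp _
          _ = Real.exp (ε ^ 2 / 8) := by
              rw [← Real.exp_nat_mul]
              congr 1
              field_simp
          _ ≤ _ := by
              have hx8 : |ε ^ 2 / 8| ≤ 1 := by
                rw [abs_of_nonneg (by positivity)]
                nlinarith
              have := (abs_le.1 (Real.abs_exp_sub_one_le hx8)).2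
              rw [abs_of_nonneg (by positivity)] at this
              linarith

/-- Chebyshev's inequality: the expected squared relative error, in units of `ε`, is at most `1 / 4`. -/
theorem prodExp_sq_error_le {w : ℕ → ℝ≥0∞} {r n s : ℕ} {ε Z : ℝ} (hε : 0 < ε) (hε1 : ε ≤ 1)
    (hr : r ≤ n) (hn : 0 < n) (hw1 : ∀ i, w i ≤ 1)
    (hs : ∀ i < r, 8 * n ≤ ε ^ 2 * (s * (w i).toReal)) (hs0 : 0 < s)
    (hZ : ∏ i ∈ Finset.range r, (w i).toReal = Z) :
    prodExp w s (fun a => ENNReal.ofReal (((a : ℝ) / (s ^ r : ℕ) - Z) ^ 2 / (ε * Z) ^ 2)) r 1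
      ≤ ENNReal.ofReal (1 / 4) := by
  have hZ0 : 0 < Z := by
    rw [← hZ]
    refine Finset.prod_pos fun i hi => ENNReal.toReal_nonneg.lt_of_ne fun h => ?_
    have := hs i (Finset.mem_range.1 hi)
    rw [← h, mul_zero, mul_zero] at this
    have : (0 : ℝ) < n := by exact_mod_cast hn
    linarith
  have hs' : (0 : ℝ) < (s ^ r : ℕ) := by exact_mod_cast pow_pos hs0 r
  set D : ℝ := ((s ^ r : ℕ) : ℝ)
  have hD : D = (s : ℝ) ^ r := by simp [D]
  -- the squared error is a quadratic polynomial in the final numerator `a`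
  have hquad : ∀ a : ℕ, ((a : ℝ) / D - Z) ^ 2 / (ε * Z) ^ 2
      = (1 / (D * (ε * Z)) ^ 2) * (a : ℝ) ^ 2 - (2 / (D * Z * ε ^ 2)) * a + 1 / ε ^ 2 := by
    intro a
    field_simp
    ring
  have hww : w = fun i => ENNReal.ofReal (w i).toReal := by
    funext i
    rw [ENNReal.ofReal_toReal ((hw1 i).trans_lt ENNReal.one_lt_top).ne]
  simp only [hquad]
  have h1 : ∀ i, (w i).toReal ≤ 1 := fun i =>
    ENNReal.toReal_le_of_le_ofReal zero_le_one (by simpa using hw1 i)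
  rw [hww, (prodExp_quadratic (fun i => ENNReal.toReal_nonneg) h1 s (fun c => by rw [← hquad]; positivity) r 1).2]
  refine ENNReal.ofReal_le_ofReal ?_
  have hvar := prod_secondMoment_le hε hε1 hr hn (fun i => ENNReal.toReal_nonneg) h1 hs
  have hmean : ∏ i ∈ Finset.range r, (s * (w i).toReal) = D * Z := by
    rw [Finset.prod_mul_distrib, Finset.prod_const, Finset.card_range, hZ, hD]
  rw [hmean] at hvar ⊢
  set X := ∏ i ∈ Finset.range r, ((s * (w i).toReal) ^ 2 + s * (w i).toReal * (1 - (w i).toReal))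
  calc _ ≤ 1 / (D * (ε * Z)) ^ 2 * ((1 + ε ^ 2 / 4) * (D * Z) ^ 2) * ((1 : ℕ) : ℝ) ^ 2
        - 2 / (D * Z * ε ^ 2) * (D * Z) * (1 : ℕ) + 1 / ε ^ 2 := by gcongr
    _ = 1 / 4 := by
      push_cast
      field_simp
      ring

namespace ReachInstance

variable {G : ReachInstance}

/-! ### Bi-directed instances -/

theorem IsBidirected.isReversal (hG : G.IsBidirected) : ∃ rev, G.net.IsReversal rev := by
  obtain ⟨rev, h1, h2⟩ := hG
  exact ⟨rev, h1, fun e => (h2 e).1, fun e => by simp [net, (h2 e).2.2],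
    fun e => by simp [net, (h2 e).2.2]⟩

theorem one_le_odds_mul (e : Fin G.m) : 1 ≤ (G.odds : ℝ≥0∞) * G.net.q e := by
  have hp : (0 : ℚ) < 1 - G.p e := sub_pos.2 (G.p_lt_one e)
  have h : (1 - G.p e)⁻¹ ≤ (G.odds : ℚ) := Nat.ceil_le.1 (ceil_le_odds e)
  rw [inv_le_iff_one_le_mul₀ hp] at h
  have h' : (1 : ℝ) ≤ (G.odds : ℝ) * (1 - G.p e) := by exact_mod_cast h
  change 1 ≤ (G.odds : ℝ≥0∞) * ENNReal.ofReal (1 - G.p e)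
  rw [← ENNReal.ofReal_natCast, ← ENNReal.ofReal_mul (Nat.cast_nonneg _), ← ENNReal.ofReal_one]
  exact ENNReal.ofReal_le_ofReal h'

theorem net_q_ne_zero (e : Fin G.m) : G.net.q e ≠ 0 := by
  intro h
  have := one_le_odds_mul e
  simp [h] at this

theorem net_p_le (e : Fin G.m) : G.net.p e ≤ (G.odds : ℝ≥0∞) * G.net.q e := by
  refine le_trans ?_ (one_le_odds_mul e)
  rw [← G.net.p_add_q e]
  exact le_self_add

theorem IsBidirected.reaches_symm (hG : G.IsBidirected) {u v : Fin G.n}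
    (h : G.net.Reaches Finset.univ u v) : G.net.Reaches Finset.univ v u := by
  obtain ⟨rev, hrev⟩ := hG.isReversal
  induction h with
  | refl => exact Relation.ReflTransGen.refl
  | tail _ hbc ih =>
    obtain ⟨e, he, rfl, rfl⟩ := hbc
    exact ih.head ⟨rev e, Finset.mem_univ _, hrev.tail_rev e, hrev.head_rev e⟩

theorem IsBidirected.rooted_univ (hG : G.IsBidirected)
    (hc : G.net.reach Finset.univ G.root = Finset.univ) {T : Finset (Fin G.n)}
    (hT : G.root ∈ T) : G.net.Rooted T Finset.univ := fun v =>
  ⟨G.root, hT, hG.reaches_symm (FailNet.mem_reach.1 (hc ▸ Finset.mem_univ v))⟩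

/-- The bound for the potential, with `odds` in place of `1 / (1 - p_max)`. -/
theorem IsBidirected.popBound (hG : G.IsBidirected)
    (hc : G.net.reach Finset.univ G.root = Finset.univ) {T : Finset (Fin G.n)}
    (hT : G.root ∈ T) : G.PopBound (G.n * (1 + G.m * G.odds)) T := by
  obtain ⟨rev, hrev⟩ := hG.isReversal
  refine ⟨FailNet.Z_ne_zero (hG.rooted_univ hc hT) net_q_ne_zero, fun R hR => ?_⟩
  have := hrev.sum_Z_insert_le net_p_le (hG.rooted_univ hc (hR hT))
  simpa using this

/-- Each ratio of connection probabilities is bounded below by the survival probability of an arc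
that leads back to an earlier vertex of the search order. -/
theorem IsBidirected.one_le_odds_mul_levelProb (hG : G.IsBidirected)
    (hc : G.net.reach Finset.univ G.root = Finset.univ) {Q : ℕ → Fin G.n}
    (hQ : G.SearchOrder Finset.univ G.root G.n Q) {r : ℕ} (hr : r + 1 < G.n) :
    1 ≤ (G.odds : ℝ≥0∞) * G.levelProb Q r := by
  obtain ⟨rev, hrev⟩ := hG.isReversal
  obtain ⟨i, hi, e, -, ht, hh⟩ := hQ.parent (r + 1) hr (by omega)
  have ht' : G.net.tail (rev e) = Q (r + 1) := (hrev.tail_rev e).trans hh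
  have hh' : G.net.head (rev e) = Q i := (hrev.head_rev e).trans ht
  refine (one_le_odds_mul (rev e)).trans ?_
  gcongr
  have h0 : G.net.Z ((Finset.range (r + 2)).image Q) ≠ 0 :=
    (hG.popBound hc (Finset.mem_image.2 ⟨0, by simp, hQ.zero⟩)).1
  rw [levelProb, FailNet.dropProb, ENNReal.le_div_iff_mul_le (Or.inl h0)
    (Or.inl (FailNet.Z_ne_top _)), ← ht']
  refine FailNet.q_mul_Z_le_Z_erase ?_
  rw [ht', hh', Finset.mem_erase]
  exact ⟨fun h => by have := hQ.inj i (by omega) _ hr h; omega,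
    Finset.mem_image.2 ⟨i, Finset.mem_range.2 (by omega), rfl⟩⟩

/-- The product of the ratios telescopes. -/
theorem IsBidirected.prod_levelProb (hG : G.IsBidirected)
    (hc : G.net.reach Finset.univ G.root = Finset.univ) {Q : ℕ → Fin G.n}
    (hQ : G.SearchOrder Finset.univ G.root G.n Q) :
    ∏ i ∈ Finset.range (G.n - 1), G.levelProb Q i = G.net.Z {G.root} := by
  have h : ∀ r, r + 1 ≤ G.n → (∏ i ∈ Finset.range r, G.levelProb Q i)
      * G.net.Z ((Finset.range (r + 1)).image Q) = G.net.Z {G.root} := by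
    intro r hr
    induction r with
    | zero => simp [hQ.zero]
    | succ r ih =>
      rw [Finset.prod_range_succ, ← ih (by omega), mul_assoc, levelProb,
        FailNet.dropProb_mul _ (hG.popBound hc (Finset.mem_image.2 ⟨0, by simp, hQ.zero⟩)).1,
        hQ.image_erase (by omega)]
  have hn := hQ.pos
  have huniv : (Finset.range G.n).image Q = Finset.univ := by
    rw [← Finset.card_eq_iff_eq_univ, hQ.card, Fintype.card_fin]
  have := h (G.n - 1) (by omega)
  rwa [Nat.sub_add_cancel hn, huniv, FailNet.Z_univ, mul_one] at this

/-- The root as a root set. -/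
theorem rootConnected_iff (S : Finset (Fin G.m)) :
    G.RootConnected S ↔ G.net.Rooted {G.root} S := by
  simp only [FailNet.Rooted, Finset.mem_singleton, exists_eq_left]
  exact Iff.rfl

theorem wt_nonneg (S : Finset (Fin G.m)) : 0 ≤ G.wt S :=
  mul_nonneg (Finset.prod_nonneg fun e _ => (sub_pos.2 (G.p_lt_one e)).le)
    (Finset.prod_nonneg fun e _ => (G.p_pos e).le)

theorem pr_eq_wt (S : Finset (Fin G.m)) : G.net.pr S = ENNReal.ofReal (G.wt S) := by
  classical
  rw [FailNet.pr, wt, ← Finset.prod_mul_prod_compl S]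
  push_cast
  rw [ENNReal.ofReal_mul (Finset.prod_nonneg fun e _ => ?_), ENNReal.ofReal_prod_of_nonneg,
    ENNReal.ofReal_prod_of_nonneg]
  · congr 1
    · exact Finset.prod_congr rfl fun e he => by rw [if_pos he]; rfl
    · exact Finset.prod_congr rfl fun e he => by rw [if_neg (Finset.mem_compl.1 he)]; rfl
  · exact fun e _ => by exact_mod_cast (G.p_pos e).le
  · exact fun e _ => by exact_mod_cast (sub_pos.2 (G.p_lt_one e)).le
  · exact_mod_cast (sub_pos.2 (G.p_lt_one e)).le

theorem Z_root_eq : G.net.Z {G.root} = ENNReal.ofReal G.Zreach := by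
  classical
  rw [FailNet.Z, FailNet.mean, Zreach]
  push_cast
  rw [ENNReal.ofReal_sum_of_nonneg fun S _ => by exact_mod_cast wt_nonneg S, Finset.sum_filter]
  refine Finset.sum_congr rfl fun S _ => ?_
  rw [← pr_eq_wt]
  by_cases h : G.RootConnected S
  · rw [if_pos h, if_pos ((rootConnected_iff S).1 h), Pi.one_apply, mul_one]
  · rw [if_neg h, if_neg fun h' => h ((rootConnected_iff S).2 h')]

theorem Zreach_nonneg : 0 ≤ G.Zreach := by
  classical
  exact Finset.sum_nonneg fun S _ => wt_nonneg S

theorem toReal_Z_root : (G.net.Z {G.root}).toReal = G.Zreach := by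
  rw [Z_root_eq, ENNReal.toReal_ofReal]
  exact_mod_cast Zreach_nonneg

/-- If the root does not reach all vertices, then by symmetry some vertex does not reach the root. -/
theorem IsBidirected.Zreach_eq_zero (hG : G.IsBidirected)
    (hc : G.net.reach Finset.univ G.root ≠ Finset.univ) : G.Zreach = 0 := by
  classical
  refine Finset.sum_eq_zero fun S hS => absurd ?_ hc
  refine Finset.eq_univ_iff_forall.2 fun v => FailNet.mem_reach.2 (hG.reaches_symm ?_)
  refine Relation.ReflTransGen.mono ?_ _ _ ((Finset.mem_filter.1 hS).2 v)
  rintro a b ⟨e, -, he⟩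
  exact ⟨e, Finset.mem_univ _, he⟩

/-! ### Error probability -/

theorem one_le_odds : 1 ≤ G.odds := one_le_oddsUpTo G.m

theorem one_le_ceil_inv {ε : ℚ} (hε : 0 < ε) : 1 ≤ ⌈ε⁻¹⌉₊ :=
  Nat.one_le_iff_ne_zero.2 (Nat.ceil_pos.2 (inv_pos.2 hε)).ne'

theorem IsBidirected.prodExp_le (hG : G.IsBidirected) {ε : ℚ} (hε : 0 < ε) (hε1 : ε ≤ 1)
    (hc : G.net.reach Finset.univ G.root = Finset.univ) {Q : ℕ → Fin G.n}
    (hQ : G.SearchOrder Finset.univ G.root G.n Q) :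
    prodExp (G.levelProb Q) (G.samples ε) (fun a => ENNReal.ofReal
      (((a : ℝ) / (G.samples ε ^ (G.n - 1) : ℕ) - G.Zreach) ^ 2 / (ε * G.Zreach) ^ 2)) (G.n - 1) 1
      ≤ ENNReal.ofReal (1 / 4) := by
  have hn := hQ.pos
  have hε' : (0 : ℝ) < ε := by exact_mod_cast hε
  have hk : (1 : ℝ) ≤ ε * ⌈ε⁻¹⌉₊ := by
    have h := Nat.le_ceil ε⁻¹
    rw [inv_le_iff_one_le_mul₀' hε] at h
    exact_mod_cast h
  refine prodExp_sq_error_le (n := G.n) hε' (by exact_mod_cast hε1) (Nat.sub_le _ _) hn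
    (fun i => G.net.dropProb_le_one _ _) (fun i hi => ?_) ?_ ?_
  · have h := hG.one_le_odds_mul_levelProb hc hQ (r := i) (by omega)
    have hw : G.levelProb Q i ≠ ∞ :=
      ((G.net.dropProb_le_one _ _).trans_lt ENNReal.one_lt_top).ne
    have h' : (1 : ℝ) ≤ G.odds * (G.levelProb Q i).toReal := by
      have := ENNReal.toReal_mono (ENNReal.mul_ne_top (ENNReal.natCast_ne_top _) hw) h
      simpa using this
    have hn' : (0 : ℝ) < G.n := by exact_mod_cast hn
    calc (8 * G.n : ℝ) = 8 * G.n * (1 * 1) * 1 := by ring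
      _ ≤ 8 * G.n * ((ε * ⌈ε⁻¹⌉₊) * (ε * ⌈ε⁻¹⌉₊)) * (G.odds * (G.levelProb Q i).toReal) := by
        gcongr
      _ = _ := by rw [samples]; push_cast; ring
  · have := one_le_ceil_inv hε
    have := G.one_le_odds
    rw [samples]
    positivity
  · rw [← toReal_Z_root, ← hG.prod_levelProb hc hQ, ENNReal.toReal_prod]

open Classical in
/-- A failure of the approximation is an error of at least one unit of `ε`. -/
theorem not_approximates_le {Z ε : ℚ} (hε : 0 < ε) (hZ : 0 < Z) {τ : Mem} {a d : ℕ}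
    (h0 : τ.reg 0 = a) (h1 : τ.reg 1 = d) (hd : 0 < d) :
    (if Approximates Z ε τ then 0 else 1 : ℝ≥0∞)
      ≤ ENNReal.ofReal (((a : ℝ) / (d : ℕ) - Z) ^ 2 / (ε * Z) ^ 2) := by
  by_cases h : Approximates Z ε τ
  · rw [if_pos h]
    exact zero_le
  · rw [if_neg h, ← ENNReal.ofReal_one]
    refine ENNReal.ofReal_le_ofReal ?_
    have hlt : ε * Z < |(a : ℚ) / d - Z| := by
      by_contra hcon
      refine h ⟨by omega, ?_⟩
      rw [h0, h1]
      exact not_lt.1 hcon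
    have hlt' : (ε : ℝ) * Z < |(a : ℝ) / d - Z| := by
      have := (Rat.cast_lt (K := ℝ)).2 hlt
      push_cast at this
      exact this
    have hpos : (0 : ℝ) < (ε : ℝ) * Z := by exact_mod_cast mul_pos hε hZ
    rw [one_le_div (by positivity), ← sq_abs ((a : ℝ) / d - Z)]
    gcongr

end ReachInstance

namespace ReachInstance

variable {G : ReachInstance}

/-! ### Running time -/

/-- Every vertex but the root is the head of an arc. -/
theorem n_le_m_add_one (hc : G.net.reach Finset.univ G.root = Finset.univ) : G.n ≤ G.m + 1 := by
  have h : (Finset.univ : Finset (Fin G.n)) ⊆ insert G.root (Finset.univ.image G.head) := by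
    intro v _
    have hv : G.net.Reaches Finset.univ G.root v := FailNet.mem_reach.1 (hc ▸ Finset.mem_univ v)
    rcases hv.cases_tail with rfl | ⟨u, -, e, -, -, he⟩
    · exact Finset.mem_insert_self _ _
    · exact Finset.mem_insert_of_mem (Finset.mem_image.2 ⟨e, Finset.mem_univ _, he⟩)
  have h1 := (Finset.card_le_card h).trans (Finset.card_insert_le _ _)
  have h2 := Finset.card_image_le (s := Finset.univ) (f := G.head)
  simp only [Finset.card_univ, Fintype.card_fin] at h1 h2
  omega

variable (G) in
/-- The order of magnitude of the running time, in terms of natural numbers. -/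
def timeScale (ε : ℚ) : ℕ := ⌈ε⁻¹⌉₊ ^ 2 * G.odds ^ 2 * G.m ^ 2 * G.n ^ 3

theorem prepTime_le {ε : ℚ} (hε : 0 < ε) (hm : 0 < G.m) :
    G.prepTime ε + 50 ≤ 500 * G.timeScale ε := by
  have hk := one_le_ceil_inv hε
  have hK := G.one_le_odds
  have hn : 1 ≤ G.n := G.root.pos
  rw [prepTime, timeScale]
  generalize ⌈ε⁻¹⌉₊ = k at *
  generalize G.odds = K at *
  generalize G.n = n at *
  generalize G.m = m at *
  have hk2 : 1 ≤ k ^ 2 := Nat.one_le_pow _ _ hk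
  have hK2 : 1 ≤ K ^ 2 := Nat.one_le_pow _ _ hK
  have hm2 : 1 ≤ m ^ 2 := Nat.one_le_pow _ _ hm
  have hn3 : 1 ≤ n ^ 3 := Nat.one_le_pow _ _ hn
  have a1 : k ≤ k ^ 2 := Nat.le_self_pow two_ne_zero k
  have a2 : K ≤ K ^ 2 := Nat.le_self_pow two_ne_zero K
  have a3 : m ≤ m ^ 2 := Nat.le_self_pow two_ne_zero m
  have a4 : n ≤ n ^ 3 := Nat.le_self_pow three_ne_zero n
  have hkX : k ≤ k ^ 2 * K ^ 2 * m ^ 2 * n ^ 3 :=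
    calc k = k * 1 * 1 * 1 := by ring
      _ ≤ _ := by gcongr
  have hmKX : m * K ≤ k ^ 2 * K ^ 2 * m ^ 2 * n ^ 3 :=
    calc m * K = 1 * K * m * 1 := by ring
      _ ≤ _ := by gcongr
  have hnX : n ≤ k ^ 2 * K ^ 2 * m ^ 2 * n ^ 3 :=
    calc n = 1 * 1 * 1 * n := by ring
      _ ≤ _ := by gcongr
  have hmX : m ≤ m * K := Nat.le_mul_of_pos_right _ hK
  have hKX : K ≤ m * K := Nat.le_mul_of_pos_left _ hm
  have : m * (6 * K + 54) = 6 * (m * K) + 54 * m := by ring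
  omega

theorem mainTime_le {ε : ℚ} (hε : 0 < ε) (hm : 0 < G.m) (hnm : G.n ≤ G.m + 1) :
    G.prepTime ε + G.n * (G.samples ε * (G.popCost * (G.n * (1 + G.m * G.odds) + 2) + 20) + 100)
      + 50 ≤ 18000 * G.timeScale ε := by
  have hprep := prepTime_le hε hm
  have hk := one_le_ceil_inv hε
  have hK := G.one_le_odds
  have hn : 1 ≤ G.n := G.root.pos
  suffices h : G.n * (G.samples ε * (G.popCost * (G.n * (1 + G.m * G.odds) + 2) + 20) + 100)
      ≤ 16900 * G.timeScale ε by omega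
  rw [samples, popCost, timeScale]
  generalize ⌈ε⁻¹⌉₊ = k at *
  generalize G.odds = K at *
  generalize G.n = n at *
  generalize G.m = m at *
  have h1 : 130 * (n + m + 1) ≤ 520 * m := by omega
  have hnmK : 1 ≤ n * (m * K) := Nat.one_le_iff_ne_zero.2 (by positivity)
  have h2 : n * (1 + m * K) + 2 ≤ 4 * (n * (m * K)) := by
    have : n ≤ n * (m * K) := Nat.le_mul_of_pos_right _ (by positivity)
    have : n * (1 + m * K) = n + n * (m * K) := by ring
    omega
  have h3 : 1 ≤ n * (m ^ 2 * K) := Nat.one_le_iff_ne_zero.2 (by positivity)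
  have h4 : 1 ≤ n ^ 2 * m ^ 2 * k ^ 2 * K ^ 2 := Nat.one_le_iff_ne_zero.2 (by positivity)
  calc _ ≤ n * (8 * n * k * k * K * (520 * m * (4 * (n * (m * K))) + 20 * (n * (m ^ 2 * K)))
        + 100 * (n ^ 2 * m ^ 2 * k ^ 2 * K ^ 2)) := by gcongr <;> omega
    _ = _ := by ring

theorem timeScale_le {ε : ℚ} (hε : 0 < ε) (hε1 : ε ≤ 1) (hm : 0 < G.m) :
    (G.timeScale ε : ℝ) ≤ 16 * ((ε : ℝ) ^ 2)⁻¹ * ((1 - G.pMax) ^ 3)⁻¹ * (G.m : ℝ) ^ 2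
      * (G.n : ℝ) ^ 3 := by
  have : Nonempty (Fin G.m) := ⟨⟨0, hm⟩⟩
  have hle : ∀ e, (G.p e : ℝ) ≤ G.pMax := fun e =>
    le_ciSup (f := fun e => (G.p e : ℝ)) (Set.finite_range _).bddAbove e
  obtain ⟨e₀, he₀⟩ := exists_eq_ciSup_of_finite (f := fun e => (G.p e : ℝ))
  have hlt : G.pMax < 1 := by
    rw [pMax, ← he₀]
    exact_mod_cast G.p_lt_one e₀
  have hpos : 0 < G.pMax := by
    rw [pMax, ← he₀]
    exact_mod_cast G.p_pos e₀
  have hD : 1 ≤ (1 - G.pMax)⁻¹ := (one_le_inv₀ (by linarith)).2 (by linarith)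
  have hceil : ∀ x : ℚ, 1 ≤ x → ((⌈x⌉₊ : ℕ) : ℝ) ≤ 2 * x := by
    intro x hx
    have := Nat.ceil_lt_add_one (zero_le_one.trans hx)
    have : ((⌈x⌉₊ : ℕ) : ℚ) ≤ 2 * x := by linarith
    exact_mod_cast this
  have hk : ((⌈ε⁻¹⌉₊ : ℕ) : ℝ) ≤ 2 * (ε : ℝ)⁻¹ := by
    have := hceil ε⁻¹ ((one_le_inv₀ hε).2 hε1)
    exact_mod_cast this
  have hK : (G.odds : ℝ) ≤ 2 * (1 - G.pMax)⁻¹ := by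
    rcases oddsUpTo_cases (G := G) G.m with h | ⟨e, h⟩
    · rw [odds, h]
      push_cast
      linarith
    · rw [odds, h]
      have hp : 0 < 1 - G.p e := sub_pos.2 (G.p_lt_one e)
      have h1 := hceil (1 - G.p e)⁻¹ ((one_le_inv₀ hp).2 (by linarith [G.p_pos e]))
      refine h1.trans ?_
      push_cast
      gcongr
      exact hle e
  have hD3 : (1 - G.pMax)⁻¹ ^ 2 ≤ (1 - G.pMax)⁻¹ ^ 3 := pow_le_pow_right₀ hD (by norm_num)
  rw [timeScale]
  push_cast
  calc _ ≤ (2 * (ε : ℝ)⁻¹) ^ 2 * (2 * (1 - G.pMax)⁻¹) ^ 2 * (G.m : ℝ) ^ 2 * (G.n : ℝ) ^ 3 := by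
        gcongr
    _ = 16 * (ε : ℝ)⁻¹ ^ 2 * (1 - G.pMax)⁻¹ ^ 2 * (G.m : ℝ) ^ 2 * (G.n : ℝ) ^ 3 := by ring
    _ ≤ 16 * (ε : ℝ)⁻¹ ^ 2 * (1 - G.pMax)⁻¹ ^ 3 * (G.m : ℝ) ^ 2 * (G.n : ℝ) ^ 3 := by gcongr
    _ = _ := by rw [inv_pow, inv_pow]

/-- The bound `N` shows that the expected time is finite even if there is no arc, when `timeScale`
vanishes. -/
theorem IsBidirected.exists_expectedTime_le (hG : G.IsBidirected) {ε : ℚ} (hε : 0 < ε) :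
    ∃ N : ℕ, expectedTime Prog.main (G.encode ε) ≤ N ∧ (0 < G.m → N ≤ 18000 * G.timeScale ε) := by
  by_cases hc : G.net.reach Finset.univ G.root = Finset.univ
  · refine ⟨_, (expectedTime_le_wp _ _).trans ((wp_main_le_of_connected (F := 0)
      (Φ := fun _ => 0) hε hc (fun T hT => hG.popBound hc hT) (fun _ _ _ _ => le_rfl)
      fun Q _ => ?_).trans_eq (by rw [one_mul, add_zero])),
      fun hm => mainTime_le hε hm (n_le_m_add_one hc)⟩
    have hb : ∀ (w : ℝ≥0∞) r c, binExp w r (fun _ => 0) c = 0 := by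
      intro w r
      induction r with
      | zero => exact fun _ => rfl
      | succ r ih => intro c; simp [binExp, ih]
    have hp : ∀ r a, prodExp (G.levelProb Q) (G.samples ε) (fun _ => 0) r a = 0 := by
      intro r
      induction r with
      | zero => exact fun _ => rfl
      | succ r ih => intro a; simp [prodExp, ih, hb]
    exact (hp _ _).le
  · refine ⟨_, (expectedTime_le_wp _ _).trans ((wp_main_le_of_not_connected (F := 0) hε hc
      fun _ _ _ => le_rfl).trans_eq (by rw [one_mul, add_zero])), fun hm => ?_⟩
    have := prepTime_le hε hm
    omega

open Classical in
theorem IsBidirected.wp_not_approximates_le (hG : G.IsBidirected) {ε : ℚ} (hε : 0 < ε)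
    (hε1 : ε ≤ 1) :
    wp 0 Prog.main (fun σ => if Approximates G.Zreach ε σ then 0 else 1) (G.encode ε)
      ≤ ENNReal.ofReal (1 / 4) := by
  by_cases hc : G.net.reach Finset.univ G.root = Finset.univ
  · have hZ : 0 < G.Zreach := by
      refine lt_of_le_of_ne Zreach_nonneg fun h => ?_
      refine (hG.popBound hc (Finset.mem_singleton_self G.root)).1 ?_
      rw [Z_root_eq, ← h]
      simp
    have hs : 0 < G.samples ε := by
      have := one_le_ceil_inv hε
      have := G.one_le_odds
      have := G.root.pos
      rw [samples]
      positivity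
    refine (wp_main_le_of_connected hε hc (fun T hT => hG.popBound hc hT)
      (fun a τ h0 h1 => not_approximates_le hε hZ h0 h1 (pow_pos hs _))
      fun Q hQ => hG.prodExp_le hε hε1 hc hQ).trans_eq (by rw [zero_mul, zero_add])
  · refine ((wp_main_le_of_not_connected (F := 0) hε hc fun τ h0 h1 => ?_).trans_eq
      (by rw [zero_mul, zero_add])).trans zero_le
    rw [if_pos ⟨by omega, by rw [h0, h1, hG.Zreach_eq_zero hc]; simp⟩]

end ReachInstance

end

theorem theorem4p2 :
    ∃ (A : Cmd) (C : ℝ), ∀ G : ReachInstance, G.IsBidirected → ∀ ε : ℚ, 0 < ε → ε ≤ 1 →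
      3 / 4 ≤ haltProb A (G.encode ε) (Approximates G.Zreach ε) ∧
      (0 < G.m →
        expectedTime A (G.encode ε) ≤
          ENNReal.ofReal
            (C * ((ε : ℝ) ^ 2)⁻¹ * ((1 - G.pMax) ^ 3)⁻¹ * (G.m : ℝ) ^ 2 * (G.n : ℝ) ^ 3)) := by
  classical
  -- `18000` comes from the count of steps, and `16 = 2 ^ 2 * 2 ^ 2` from the rounding of `1 / ε` and
  -- of `1 / (1 - p_max)`, each of which at most doubles them.
  refine ⟨Prog.main, 18000 * 16, fun G hG ε hε hε1 => ?_⟩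
  obtain ⟨N, hN, hN'⟩ := hG.exists_expectedTime_le hε
  refine ⟨?_, fun hm => hN.trans ?_⟩
  · have h := (one_le_haltProb_add Prog.main (G.encode ε) (Approximates G.Zreach ε)
      (hN.trans_lt (ENNReal.natCast_lt_top N)).ne).trans
      (add_le_add le_rfl (hG.wp_not_approximates_le hε hε1))
    have h4 : (3 / 4 : ℝ≥0∞) + ENNReal.ofReal (1 / 4) = 1 := by
      have : (3 / 4 : ℝ≥0∞) = ENNReal.ofReal (3 / 4) := by
        rw [ENNReal.ofReal_div_of_pos (by norm_num)]
        norm_num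
      rw [this, ← ENNReal.ofReal_add (by norm_num) (by norm_num)]
      norm_num
    rw [← h4] at h
    exact (ENNReal.add_le_add_iff_right ENNReal.ofReal_ne_top).1 h
  · rw [← ENNReal.ofReal_natCast]
    refine ENNReal.ofReal_le_ofReal ?_
    have h1 : (N : ℝ) ≤ 18000 * G.timeScale ε := by exact_mod_cast hN' hm
    have h2 := ReachInstance.timeScale_le hε hε1 hm
    calc (N : ℝ) ≤ _ := h1
      _ ≤ 18000 * (16 * ((ε : ℝ) ^ 2)⁻¹ * ((1 - G.pMax) ^ 3)⁻¹ * (G.m : ℝ) ^ 2 * (G.n : ℝ) ^ 3) := by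
        gcongr
      _ = _ := by ring
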